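/- **Theorem 2.1.** Let $\alpha\in(0,\pi)$, $R_0,R_\alpha>0$ and $p,q>0$ with $p+q=1$. Write $e_\theta=(\cos\theta,\sin\theta)$, let $S(x,\theta,r)=\{x+ue_\theta:u\in[-r,r]\}$ be the stick with centre $x\in\mathbb R^2$, angle $\theta$ and half-length $r$, and put $$\rho(dx\,d\theta\,dr)=dx\,\{p\,\delta_0(d\theta)\delta_{R_0}(dr)+q\,\delta_\alpha(d\theta)\delta_{R_\alpha}(dr)\}.$$ For $\lambda>0$ let $\mu_{\lambda\rho}$ be the law of the Poisson point process $\xi$ on $\mathbb R^2\times[0,\pi)\times(0,\infty)$ with intensity measure $\lambda\rho$, and let $\mu_{\lambda\rho}(\,\cdot\mid\Gamma_0)$ be its Palm probability, i.e. its conditional law given that there is a stick centred at the origin. Let $C_0$ be the cluster of the origin: the set of all sticks of $\xi$ that are joined to the stick centred at the origin by a finite chain of successively intersecting sticks of $\xi$. Write $\#C_0=(k,\ell)$, or $C_0\in\Lambda(k,\ell)$, if $C_0$ consists of exactly $k+\ell$ sticks, $k$ of them horizontal and $\ell$ of them at angle $\alpha$. Let $|B|$ be the area of the parallelogram $$B=B^{0,\alpha}_{R_0,R_\alpha}=\{x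 e_0+y e_\alpha:\ |x|\le R_0,\ |y|\le R_\alpha\}.$$ Let $k,\ell\ge1$ be integers and $m=k+\ell$. Then, as $\lambda\to\infty$ (where $a(\lambda)\sim b(\lambda)$ means $a(\lambda)/b(\lambda)\to1$): (i) $$\mu_{\lambda\rho}(C_0\in\Lambda(k,\ell)\mid\Gamma_0)\ \sim\ \left(\frac1{\lambda|B|}\right)^{m-3}e^{-\lambda|B|}\,(pq)^{-2(m-1)}\,m\,p^{3k}k!\,q^{3\ell}\ell!\,;$$ (ii) the conditional probability, under $\mu_{\lambda\rho}(\,\cdot\mid\Gamma_0)$, that $\#C_0=(k,\ell)$ given that $\#C_0=(k',\ell')$ for some integers $k',\ell'\ge0$ with $k'+\ell'=m$, satisfies $$p_{\lambda,m}(k,\ell)\ \sim\ \frac{p^{3k}k!\,q^{3\ell}\ell!}{\sum_{k',\ell'\ge1,\ k'+\ell'=m}p^{3k'}k'!\,q^{3\ell'}\ell'!}\,.$$ In particular the limit depends neither on the angle $\alpha$ nor on $R_0,R_\alpha$. -/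

import Mathlib

open MeasureTheory ProbabilityTheory Filter Topology Set
open scoped ENNReal Nat

namespace Sticks

noncomputable section

/-- The plane `ℝ²`; its `volume` is two-dimensional Lebesgue measure. -/
abbrev Plane : Type := ℝ × ℝ

/-- A marked point `(x, θ, r)`: the centre, the angle and the half-length of a stick.
The restrictions `θ ∈ [0, π)` and `r > 0` are imposed in `Config`. -/
abbrev Germ : Type := Plane × ℝ × ℝ

/-- The unit vector `e_θ = (cos θ, sin θ)`. -/
def unitVec (θ : ℝ) : Plane := (Real.cos θ, Real.sin θ)

/-- The stick `S(x, θ, r) = {x + u e_θ : u ∈ [-r, r]}`, of length `2r`. -/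
def stick (w : Germ) : Set Plane :=
  {y | ∃ u ∈ Icc (-w.2.2) w.2.2, y = w.1 + u • unitVec w.2.1}

/-- The parallelogram `B^{α,β}_{a,b} = {x e_α + y e_β : |x| ≤ a, |y| ≤ b}`. -/
def parallelogram (α β a b : ℝ) : Set Plane :=
  {z | ∃ x ∈ Icc (-a) a, ∃ y ∈ Icc (-b) b, z = x • unitVec α + y • unitVec β}

/-- Configurations of sticks: sets of points of `ℝ² × [0, π) × (0, ∞)` having only finitely
many centres in each bounded region of the plane. -/
def Config : Type :=
  {ξ : Set Germ // (∀ w ∈ ξ, w.2.1 ∈ Ico 0 Real.pi ∧ 0 < w.2.2) ∧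
    ∀ K : Set Plane, Bornology.IsBounded K → {w ∈ ξ | w.1 ∈ K}.Finite}

/-- The number of points of the configuration `ξ` in `A`. -/
def Config.count (A : Set Germ) (ξ : Config) : ℕ∞ := (ξ.1 ∩ A).encard

/-- The σ-algebra on configurations generated by the counts of points in measurable sets. -/
instance instMeasurableSpaceConfig : MeasurableSpace Config :=
  ⨆ (A : Set Germ) (_ : MeasurableSet A), MeasurableSpace.comap (Config.count A) inferInstance

/-- `μ` is the law of a Poisson point process with intensity measure `ν`: the number of points in
a measurable set `A` of finite `ν`-measure is Poisson with mean `ν A`, and the numbers of points in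
pairwise disjoint measurable sets are independent. -/
structure IsPoissonProcess (μ : Measure Config) (ν : Measure Germ) : Prop where
  isProbabilityMeasure : IsProbabilityMeasure μ
  poisson : ∀ A : Set Germ, MeasurableSet A → ν A ≠ ∞ → ∀ n : ℕ,
    μ {ξ | ξ.count A = n} =
      ENNReal.ofReal (Real.exp (-(ν A).toReal) * (ν A).toReal ^ n / (n ! : ℝ))
  indep : ∀ (n : ℕ) (A : Fin n → Set Germ), (∀ i, MeasurableSet (A i)) →
    Pairwise (fun i j => Disjoint (A i) (A j)) →
      iIndepFun (fun i => Config.count (A i)) μ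

/-- The measure `ρ(dx dθ dr) = dx {p δ_0(dθ) δ_{R₀}(dr) + q δ_α(dθ) δ_{R_α}(dr)}`. -/
def rho (p q α R₀ Rα : ℝ) : Measure Germ :=
  (volume : Measure Plane).prod
    (ENNReal.ofReal p • Measure.dirac ((0, R₀) : ℝ × ℝ) +
      ENNReal.ofReal q • Measure.dirac ((α, Rα) : ℝ × ℝ))

/-- The configuration `ξ - x` seen from `x`: every stick is translated by `-x`. -/
def Config.recentre (x : Plane) (ξ : Config) : Config :=
  ⟨{w | (w.1 + x, w.2) ∈ ξ.1}, fun w hw => ξ.2.1 (w.1 + x, w.2) hw, fun K hK => by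
    have hb : Bornology.IsBounded ((fun y : Plane => y + x) '' K) := by
      have h := (LipschitzWith.id.add (LipschitzWith.const x)).isBounded_image hK (β := Plane)
      exact h
    refine Set.Finite.of_finite_image (f := fun w : Germ => (w.1 + x, w.2))
      ((ξ.2.2 _ hb).subset ?_) ?_
    · rintro _ ⟨w, ⟨hw, hwK⟩, rfl⟩
      exact ⟨hw, w.1, hwK, rfl⟩
    · rintro ⟨a, b⟩ _ ⟨c, d⟩ _ h
      simpa using h⟩

/-- The unit square `[0, 1)²`. -/
def unitSquare : Set Plane := Ico 0 1 ×ˢ Ico 0 1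

/-- The conditional probability of `E` given `Γ₀` (the process has a stick centred at the origin),
for a stationary law `μ`. The event `Γ₀` is null, and conditioning on it means, as usual, taking
the Palm probability: the expected number of sticks centred in the unit square from whose centre
the configuration looks as `E` prescribes, divided by the expected number of sticks centred in the
unit square. -/
def palmProb (μ : Measure Config) (E : Set Config) : ℝ≥0∞ :=
  (∫⁻ ξ : Config, ∑' w : {w : Germ // w ∈ ξ.1 ∧ w.1 ∈ unitSquare},
      E.indicator (fun _ => (1 : ℝ≥0∞)) (ξ.recentre w.1.1) ∂μ) /
    (∫⁻ ξ : Config, ∑' _ : {w : Germ // w ∈ ξ.1 ∧ w.1 ∈ unitSquare}, (1 : ℝ≥0∞) ∂μ)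

/-- `w` and `w'` are joined by a chain of successively intersecting sticks of `ξ`. -/
def Connected (ξ : Config) (w w' : Germ) : Prop :=
  Relation.ReflTransGen
    (fun u v => u ∈ ξ.1 ∧ v ∈ ξ.1 ∧ (stick u ∩ stick v).Nonempty) w w'

/-- The sticks of the cluster `C_0` of the origin: those connected to a stick centred at the origin
(none if there is no such stick). -/
def cluster (ξ : Config) : Set Germ :=
  {w | w ∈ ξ.1 ∧ ∃ w₀ ∈ ξ.1, w₀.1 = 0 ∧ Connected ξ w₀ w}

/-- The event `C_0 ∈ Λ(k, ℓ)`: the cluster of the origin consists of exactly `k + ℓ` sticks,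
`k` of them horizontal and `ℓ` of them at angle `α`. -/
def clusterEvent (α : ℝ) (k ℓ : ℕ) : Set Config :=
  {ξ | (cluster ξ).encard = (k + ℓ : ℕ) ∧
    {w ∈ cluster ξ | w.2.1 = 0}.encard = k ∧ {w ∈ cluster ξ | w.2.1 = α}.encard = ℓ}

/-- The event `#C_0 = (k', ℓ')` for some `k' + ℓ' = m`. -/
def clusterSizeEvent (α : ℝ) (m : ℕ) : Set Config :=
  {ξ | ∃ k' ℓ' : ℕ, k' + ℓ' = m ∧ ξ ∈ clusterEvent α k' ℓ'}

end

end Sticks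

namespace Sticks

noncomputable section

/-! In the coordinates of `frame` both kinds of sticks become unit segments parallel to the axes;
two sticks of different kinds meet exactly when their centres have sup-distance at most 1/2, and the
angle and the half-lengths survive only in the Jacobian |B|. Parallel sticks meet only on a null set
of positions. Put s = λ|B|. A linked family of k horizontal and ℓ slanted sticks is avoided by all
other sticks with probability exp(-s(p A_α + q A_0)), where A_0 and A_α are the areas of the unions
of unit squares around the horizontal and the slanted centres.

The multivariate Mecke formula (`lintegral_tupleSum`), applied to ordered listings of clusters,
together with translation invariance (`lintegral_clusterCount`, `lintegral_sum_pin`), shows that the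
Palm probability is m s^(m-1) p^k q^ℓ / (k! ℓ!) times the integral of this exponential over linked
families with one centre pinned.

Both areas are at least 1 and p + q = 1, so the integrand is at most e^(-s), and the main
contribution comes from families where all sticks of each kind nearly coincide. Zooming in by s
within each kind costs s^(-2(m-2)). The area around the points y/s is 1 + `extent y`/s + O(1/s²)
(`tendsto_area`), `extent` being the sum of the two coordinate ranges. In the limit the integral
factorises: the offset z of the two clumps ranges over a unit square, and the clumps contribute ∫
exp(-c `extent`) = ((n+1)!/c^n)² with (c, n) = (q, k-1) and (p, ℓ-1) (`lintegral_exp_extent`).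
Domination holds because linked families have bounded diameter and area - 1 ≥ min(1, distance)
(`rescaledDensity_le`). Collecting powers gives (i).

For (ii), sum over the types of size m: the types with only one kind have probability zero as m ≥ 2,
and the factor depending on m alone cancels.

The Mecke formula itself is derived from the definition of the process: it is checked on products of
a set of germs with an avoidance event, and such products form a generating π-system. -/

lemma measurable_count {A : Set Germ} (hA : MeasurableSet A) : Measurable (Config.count A) :=
  measurable_iff_comap_le.2 (le_iSup₂_of_le (f := fun (A : Set Germ) (_ : MeasurableSet A) =>
    MeasurableSpace.comap (Config.count A) inferInstance) A hA le_rfl)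

/-! ### Avoidance events and the σ-algebra on configurations -/

/-- The event that no point of the configuration lies in `B`. -/
def avoid (B : Set Germ) : Set Config := {ξ | ξ.1 ∩ B = ∅}

lemma avoid_eq_count (B : Set Germ) : avoid B = Config.count B ⁻¹' {0} := by
  ext ξ
  simp [avoid, Config.count]

lemma measurableSet_avoid {B : Set Germ} (hB : MeasurableSet B) : MeasurableSet (avoid B) := by
  rw [avoid_eq_count]
  exact measurable_count hB (measurableSet_singleton _)

/-- The germs with centre in the ball of radius `n`. -/
def window (n : ℕ) : Set Germ := {w | ‖w.1‖ ≤ n}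

lemma measurableSet_window (n : ℕ) : MeasurableSet (window n) :=
  measurableSet_le (by fun_prop) (by fun_prop)

lemma window_mono {n m : ℕ} (h : n ≤ m) : window n ⊆ window m := fun w hw => by
  have : ‖w.1‖ ≤ n := hw
  exact this.trans (by exact_mod_cast h)

lemma mem_window_ceil (w : Germ) : w ∈ window ⌈‖w.1‖⌉₊ := Nat.le_ceil ‖w.1‖

lemma Config.finite_inter_window (ξ : Config) (n : ℕ) : (ξ.1 ∩ window n).Finite := by
  have h := ξ.2.2 (Metric.closedBall 0 n) Metric.isBounded_closedBall
  refine h.subset ?_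
  rintro w ⟨hw, hn⟩
  exact ⟨hw, by simpa [window] using hn⟩

lemma Config.count_ne_top (ξ : Config) {A : Set Germ} {n : ℕ} (hA : A ⊆ window n) :
    ξ.count A ≠ ⊤ := by
  rw [Config.count, Set.encard_ne_top_iff]
  exact (ξ.finite_inter_window n).subset (inter_subset_inter_right _ hA)

/-- The avoidance events of bounded measurable sets. -/
def avoidSystem : Set (Set Config) :=
  {D | ∃ B, MeasurableSet B ∧ (∃ n, B ⊆ window n) ∧ D = avoid B}

lemma isPiSystem_avoidSystem : IsPiSystem avoidSystem := by
  rintro _ ⟨B, hB, ⟨n, hn⟩, rfl⟩ _ ⟨C, hC, ⟨m, hm⟩, rfl⟩ -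
  refine ⟨B ∪ C, hB.union hC, ⟨max n m, union_subset (hn.trans (window_mono (le_max_left _ _)))
    (hm.trans (window_mono (le_max_right _ _)))⟩, ?_⟩
  ext ξ
  simp [avoid, inter_union_distrib_left]

-- Finitely many points of `ξ ∩ A` can be separated by disjoint basic open sets, and conversely
-- disjoint sets that are hit supply distinct points. As the basis is countable, this expresses
-- lower bounds on counts by countably many avoidance events; the windows keep the tested sets
-- bounded.
open TopologicalSpace in
lemma le_count_iff (A : Set Germ) (n : ℕ) (ξ : Config) :
    n ≤ ξ.count A ↔ ∃ s : {s : Fin n → countableBasis Germ × ℕ //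
      Pairwise fun i j => Disjoint ((s i).1 : Set Germ) (s j).1},
      ∀ i, ξ ∉ avoid (A ∩ (s.1 i).1 ∩ window (s.1 i).2) := by
  constructor
  · intro h
    obtain ⟨t, ht, hn⟩ := Set.exists_subset_encard_eq h
    have hfin : t.Finite := Set.finite_of_encard_eq_coe hn
    obtain ⟨U, hU, hdisj⟩ := hfin.t2_separation
    have hcard : hfin.toFinset.card = n := by
      rw [hfin.encard_eq_coe_toFinset_card] at hn
      exact_mod_cast hn
    let e := (hfin.toFinset.equivFinOfCardEq hcard).symm
    have hmem : ∀ i, (e i : Germ) ∈ t := fun i => hfin.mem_toFinset.1 (e i).2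
    have hb : ∀ i, ∃ b ∈ countableBasis Germ, (e i : Germ) ∈ b ∧ b ⊆ U (e i) := fun i =>
      (isBasis_countableBasis Germ).exists_subset_of_mem_open (hU _).1 (hU _).2
    choose b hb1 hb2 hb3 using hb
    refine ⟨⟨fun i => (⟨b i, hb1 i⟩, ⌈‖(e i : Germ).1‖⌉₊), fun i j hij => ?_⟩, fun i => ?_⟩
    · refine (hdisj (hmem i) (hmem j) ?_).mono (hb3 i) (hb3 j)
      intro h
      exact hij (e.injective (Subtype.ext h))
    · intro h
      have : (e i : Germ) ∈ (∅ : Set Germ) := by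
        rw [← (show ξ.1 ∩ _ = ∅ from h)]
        exact ⟨(ht (hmem i)).1, ⟨(ht (hmem i)).2, hb2 i⟩, mem_window_ceil _⟩
      exact this
  · rintro ⟨⟨s, hs⟩, h⟩
    have h' : ∀ i, ∃ w, w ∈ ξ.1 ∩ (A ∩ (s i).1 ∩ window (s i).2) := fun i =>
      Set.nonempty_iff_ne_empty.2 (h i)
    choose f hf using h'
    have hinj : Function.Injective f := by
      intro i j hij
      by_contra hne
      exact Set.disjoint_left.1 (hs hne) (hf i).2.1.2 (hij ▸ (hf j).2.1.2)
    have hr : (range f).encard = n := by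
      rw [← image_univ, hinj.encard_image]
      simp
    rw [← hr]
    refine Set.encard_le_encard ?_
    rintro _ ⟨i, rfl⟩
    exact ⟨(hf i).1, (hf i).2.1.1⟩

open TopologicalSpace in
lemma generateFrom_avoidSystem :
    MeasurableSpace.generateFrom avoidSystem = instMeasurableSpaceConfig := by
  apply le_antisymm
  · refine MeasurableSpace.generateFrom_le ?_
    rintro _ ⟨B, hB, -, rfl⟩
    exact measurableSet_avoid hB
  · refine iSup₂_le fun A hA => measurable_iff_comap_le.1 ?_
    have key : ∀ n : ℕ, MeasurableSet[MeasurableSpace.generateFrom avoidSystem]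
        {ξ : Config | n ≤ ξ.count A} := by
      intro n
      have : {ξ : Config | n ≤ ξ.count A} =
          ⋃ s : {s : Fin n → countableBasis Germ × ℕ //
            Pairwise fun i j => Disjoint ((s i).1 : Set Germ) (s j).1},
            ⋂ i, (avoid (A ∩ (s.1 i).1 ∩ window (s.1 i).2))ᶜ := by
        ext ξ
        rw [mem_ofPred_eq, le_count_iff]
        simp
      rw [this]
      have : Countable (countableBasis Germ) := (countable_countableBasis Germ).to_subtype
      refine @MeasurableSet.iUnion _ _ (_) _ _ fun s => @MeasurableSet.iInter _ _ (_) _ _ fun i =>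
        @MeasurableSet.compl _ _ (_) ?_
      refine MeasurableSpace.measurableSet_generateFrom ⟨_, ?_, ⟨_, inter_subset_right⟩, rfl⟩
      exact (hA.inter ((isBasis_countableBasis Germ).isOpen
        (s.1 i).1.2).measurableSet).inter (measurableSet_window _)
    refine (@ENat.measurable_iff _ (_) _).2 fun n => ?_
    have : Config.count A ⁻¹' {(n : ℕ∞)} =
        {ξ : Config | n ≤ ξ.count A} \ {ξ : Config | ((n + 1 : ℕ) : ℕ∞) ≤ ξ.count A} := by
      ext ξ
      simp only [mem_preimage, mem_singleton_iff, Set.mem_sdiff, mem_ofPred_eq, not_le]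
      constructor
      · intro h
        rw [h]
        exact ⟨le_rfl, by exact_mod_cast Nat.lt_succ_self n⟩
      · rintro ⟨h1, h2⟩
        refine le_antisymm ?_ h1
        push_cast at h2
        exact Order.le_of_lt_add_one h2
    rw [this]
    exact @MeasurableSet.diff _ (_) _ _ (key n) (key (n + 1))

/-! ### The point measure of a configuration, as a kernel -/

/-- The configuration `ξ` without its points in `C`. -/
def Config.diff (ξ : Config) (C : Set Germ) : Config :=
  ⟨ξ.1 \ C, fun w hw => ξ.2.1 w hw.1, fun K hK =>
    (ξ.2.2 K hK).subset fun _ hw => ⟨hw.1.1, hw.2⟩⟩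

/-- The measure `∑ δ_(w, ξ \ {w})`, the sum being over the points `w` of `ξ`. -/
def pointMeasure (ξ : Config) : Measure (Germ × Config) :=
  Measure.sum fun w : ξ.1 => Measure.dirac (w.1, ξ.diff {w.1})

lemma pointMeasure_apply (ξ : Config) {T : Set (Germ × Config)} (hT : MeasurableSet T) :
    pointMeasure ξ T = {w | w ∈ ξ.1 ∧ (w, ξ.diff {w}) ∈ T}.encard := by
  rw [pointMeasure, Measure.sum_apply _ hT, ← ENNReal.tsum_set_one,
    tsum_subtype {w | w ∈ ξ.1 ∧ (w, ξ.diff {w}) ∈ T} (fun _ => (1 : ℝ≥0∞)),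
    tsum_subtype ξ.1 (fun w => Measure.dirac (w, ξ.diff {w}) T)]
  refine tsum_congr fun w => ?_
  by_cases hw : w ∈ ξ.1 <;> by_cases h : (w, ξ.diff {w}) ∈ T <;>
    simp [indicator, hw, h, Measure.dirac_apply' _ hT]

lemma lintegral_pointMeasure (ξ : Config) {f : Germ × Config → ℝ≥0∞} (hf : Measurable f) :
    ∫⁻ z, f z ∂(pointMeasure ξ) = ∑' w : ξ.1, f (w.1, ξ.diff {w.1}) := by
  rw [pointMeasure, lintegral_sum_measure]
  exact tsum_congr fun w => lintegral_dirac' _ hf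

/-- Removing one point empties `B` only if `B` was already empty, in which case any point of `A` may
be removed, or if `B` held a single point, which must then be the removed one. With two points in
`B` nothing is counted. -/
lemma pointMeasure_rectangle (ξ : Config) {A B : Set Germ} (hA : MeasurableSet A)
    (hB : MeasurableSet B) :
    pointMeasure ξ (A ×ˢ avoid B) =
      (if ξ.count B = 0 then (ξ.count A : ℝ≥0∞) else 0) +
      (if ξ.count B = 1 then (ξ.count (A ∩ B) : ℝ≥0∞) else 0) := by
  rw [pointMeasure_apply ξ (hA.prod (measurableSet_avoid hB))]
  by_cases h0 : ξ.count B = 0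
  · have h1 : ξ.1 ∩ B = ∅ := by simpa [Config.count] using h0
    have : {w | w ∈ ξ.1 ∧ (w, ξ.diff {w}) ∈ A ×ˢ avoid B} = ξ.1 ∩ A := by
      ext w
      simp only [mem_ofPred_eq, mem_prod, mem_inter_iff, avoid, Config.diff]
      constructor
      · rintro ⟨h, h', -⟩
        exact ⟨h, h'⟩
      · rintro ⟨h, h'⟩
        refine ⟨h, h', subset_empty_iff.1 ?_⟩
        rw [← h1]
        exact inter_subset_inter_left _ sdiff_subset
    rw [this, if_pos h0, if_neg (by simp [h0]), add_zero, Config.count]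
  · by_cases h1 : ξ.count B = 1
    · obtain ⟨b, hb⟩ := Set.encard_eq_one.1 h1
      have hbB : b ∈ ξ.1 ∩ B := by rw [hb]; rfl
      have : {w | w ∈ ξ.1 ∧ (w, ξ.diff {w}) ∈ A ×ˢ avoid B} = ξ.1 ∩ (A ∩ B) := by
        ext w
        simp only [mem_ofPred_eq, mem_prod, mem_inter_iff, avoid, Config.diff]
        constructor
        · rintro ⟨h, h', h''⟩
          refine ⟨h, h', ?_⟩
          by_cases hbw : b = w
          · exact hbw ▸ hbB.2
          · exfalso
            have : b ∈ (∅ : Set Germ) := by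
              rw [← h'']
              exact ⟨⟨hbB.1, hbw⟩, hbB.2⟩
            exact this
        · rintro ⟨h, h', h''⟩
          refine ⟨h, h', subset_empty_iff.1 ?_⟩
          rintro v ⟨⟨hv, hvw⟩, hvB⟩
          have hv' : v ∈ ξ.1 ∩ B := ⟨hv, hvB⟩
          have hw' : w ∈ ξ.1 ∩ B := ⟨h, h''⟩
          rw [hb] at hv' hw'
          exact hvw (hv'.trans hw'.symm)
      rw [this, if_neg h0, if_pos h1, zero_add, Config.count]
    · have : {w | w ∈ ξ.1 ∧ (w, ξ.diff {w}) ∈ A ×ˢ avoid B} = ∅ := by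
        refine subset_empty_iff.1 ?_
        rintro w ⟨hw, hwA, hwB⟩
        have hsub : ξ.1 ∩ B ⊆ {w} := by
          intro v hv
          by_contra hne
          have : v ∈ (∅ : Set Germ) := by
            rw [← (show (ξ.1 \ {w}) ∩ B = ∅ from hwB)]
            exact ⟨⟨hv.1, hne⟩, hv.2⟩
          exact this
        rcases Set.subset_singleton_iff_eq.1 hsub with h | h
        · exact h0 (by simp [Config.count, h])
        · exact h1 (by simp [Config.count, h])
      rw [this, if_neg h0, if_neg h1]
      simp

lemma measurable_toENNReal_count {A : Set Germ} (hA : MeasurableSet A) :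
    Measurable fun ξ : Config => (ξ.count A : ℝ≥0∞) :=
  (Measurable.of_discrete (f := fun n : ℕ∞ => (n : ℝ≥0∞))).comp (measurable_count hA)

lemma measurable_pointMeasure_rectangle {A B : Set Germ} (hA : MeasurableSet A)
    (hB : MeasurableSet B) : Measurable fun ξ => pointMeasure ξ (A ×ˢ avoid B) := by
  simp_rw [pointMeasure_rectangle _ hA hB]
  refine Measurable.add ?_ ?_
  · exact Measurable.ite (measurable_count hB (measurableSet_singleton 0))
      (measurable_toENNReal_count hA) measurable_const
  · exact Measurable.ite (measurable_count hB (measurableSet_singleton 1))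
      (measurable_toENNReal_count (hA.inter hB)) measurable_const

/-- The germs whose centre has a norm with integral part `n`. -/
def annulus (n : ℕ) : Set Germ := {w | ⌊‖w.1‖⌋₊ = n}

lemma measurableSet_annulus (n : ℕ) : MeasurableSet (annulus n) :=
  (Nat.measurable_floor.comp (by fun_prop : Measurable fun w : Germ => ‖w.1‖))
    (measurableSet_singleton n)

lemma annulus_subset (n : ℕ) : annulus n ⊆ window (n + 1) := fun w hw => by
  have h : ⌊‖w.1‖⌋₊ = n := hw
  have := (Nat.lt_floor_add_one ‖w.1‖).le
  rw [h] at this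
  simpa [window] using this

lemma avoid_empty : avoid ∅ = univ := by
  ext ξ
  simp [avoid]

lemma generateFrom_rectangles :
    MeasurableSpace.generateFrom
      (image2 (· ×ˢ ·) {A : Set Germ | MeasurableSet A ∧ ∃ n, A ⊆ window n} avoidSystem) =
      (Prod.instMeasurableSpace : MeasurableSpace (Germ × Config)) := by
  refine generateFrom_eq_prod ?_ generateFrom_avoidSystem ?_ ?_
  · apply le_antisymm
    · exact MeasurableSpace.generateFrom_le fun A hA => hA.1
    · intro A hA
      have : A = ⋃ n, A ∩ window n := by
        rw [← inter_iUnion, inter_eq_left.2]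
        exact fun w _ => mem_iUnion.2 ⟨_, mem_window_ceil w⟩
      rw [this]
      exact MeasurableSet.iUnion fun n => MeasurableSpace.measurableSet_generateFrom
        ⟨hA.inter (measurableSet_window n), n, inter_subset_right⟩
  · exact ⟨window, fun n => ⟨measurableSet_window n, n, le_rfl⟩,
      eq_univ_of_forall fun w => mem_iUnion.2 ⟨_, mem_window_ceil w⟩⟩
  · exact ⟨fun _ => univ, fun _ => ⟨∅, MeasurableSet.empty, ⟨0, empty_subset _⟩,
      avoid_empty.symm⟩, iUnion_const _⟩

lemma isPiSystem_rectangles : IsPiSystem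
    (image2 (· ×ˢ ·) {A : Set Germ | MeasurableSet A ∧ ∃ n, A ⊆ window n} avoidSystem) := by
  refine IsPiSystem.prod ?_ isPiSystem_avoidSystem
  rintro A ⟨hA, n, hn⟩ B ⟨hB, -⟩ -
  exact ⟨hA.inter hB, n, inter_subset_left.trans hn⟩

lemma pointMeasure_annulus (ξ : Config) (n : ℕ) :
    pointMeasure ξ (annulus n ×ˢ univ) = ξ.count (annulus n) := by
  rw [← avoid_empty, pointMeasure_rectangle _ (measurableSet_annulus n) MeasurableSet.empty]
  simp [Config.count]

instance isFiniteMeasure_pointMeasure_restrict (ξ : Config) (n : ℕ) :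
    IsFiniteMeasure ((pointMeasure ξ).restrict (annulus n ×ˢ univ)) := by
  refine ⟨?_⟩
  rw [Measure.restrict_apply_univ, pointMeasure_annulus, lt_top_iff_ne_top]
  simpa using ξ.count_ne_top (annulus_subset n)

/-- The point measure may be infinite, while the π-system criterion for measurability needs finite
measures; cutting by annuli makes each piece finite, because configurations are locally finite. -/
lemma measurable_pointMeasure_restrict (n : ℕ) :
    Measurable fun ξ => (pointMeasure ξ).restrict (annulus n ×ˢ univ) := by
  refine Measurable.measure_of_isPiSystem generateFrom_rectangles.symm isPiSystem_rectangles ?_ ?_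
  · rintro _ ⟨A, ⟨hA, -⟩, _, ⟨B, hB, -, rfl⟩, rfl⟩
    have : ∀ ξ, (pointMeasure ξ).restrict (annulus n ×ˢ univ) (A ×ˢ avoid B) =
        pointMeasure ξ ((A ∩ annulus n) ×ˢ avoid B) := fun ξ => by
      rw [Measure.restrict_apply (hA.prod (measurableSet_avoid hB)), prod_inter_prod, inter_univ]
    simp_rw [this]
    exact measurable_pointMeasure_rectangle (hA.inter (measurableSet_annulus n)) hB
  · simp_rw [Measure.restrict_apply_univ, pointMeasure_annulus]
    exact measurable_toENNReal_count (measurableSet_annulus n)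

/-- The part of `pointMeasure` carried by the centres in an annulus, as a kernel. -/
def annulusKernel (n : ℕ) : Kernel Config (Germ × Config) :=
  ⟨fun ξ => (pointMeasure ξ).restrict (annulus n ×ˢ univ), measurable_pointMeasure_restrict n⟩

instance isSFiniteKernel_annulusKernel (n : ℕ) : IsSFiniteKernel (annulusKernel n) := by
  classical
  have hm : ∀ j : ℕ, MeasurableSet {ξ : Config | ξ.count (annulus n) = j} := fun j =>
    measurable_count (measurableSet_annulus n) (measurableSet_singleton (j : ℕ∞))
  have heq : annulusKernel n =
      Kernel.sum fun j : ℕ => Kernel.piecewise (hm j) (annulusKernel n) 0 := by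
    ext ξ s hs
    rw [Kernel.sum_apply' _ _ hs]
    obtain ⟨j, hj⟩ := ENat.ne_top_iff_exists.1 (ξ.count_ne_top (annulus_subset n))
    rw [tsum_eq_single j]
    · rw [Kernel.piecewise_apply, if_pos (by exact hj.symm)]
    · intro i hi
      rw [Kernel.piecewise_apply, if_neg]
      · simp
      · intro h
        rw [mem_ofPred_eq, ← hj] at h
        exact hi (by exact_mod_cast h.symm)
  rw [heq]
  refine Kernel.isSFiniteKernel_sum (hκs := fun j => ?_)
  have : IsFiniteKernel (Kernel.piecewise (hm j) (annulusKernel n) 0) := by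
    refine ⟨⟨j, ENNReal.natCast_lt_top j, fun ξ => ?_⟩⟩
    rw [Kernel.piecewise_apply]
    split_ifs with h
    · change (pointMeasure ξ).restrict (annulus n ×ˢ univ) univ ≤ j
      rw [Measure.restrict_apply_univ, pointMeasure_annulus, (show ξ.count _ = j from h)]
      simp
    · simp
  infer_instance

/-- `pointMeasure` as a kernel. -/
def pointKernel : Kernel Config (Germ × Config) := Kernel.sum annulusKernel

instance : IsSFiniteKernel pointKernel := by
  rw [pointKernel]
  infer_instance

lemma pointKernel_apply (ξ : Config) : pointKernel ξ = pointMeasure ξ := by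
  rw [pointKernel, Kernel.sum_apply]
  change Measure.sum (fun n => (pointMeasure ξ).restrict (annulus n ×ˢ univ)) = _
  rw [← Measure.restrict_iUnion]
  · have : (⋃ n, annulus n ×ˢ (univ : Set Config)) = univ :=
      eq_univ_of_forall fun z => mem_iUnion.2 ⟨⌊‖z.1.1‖⌋₊, rfl, mem_univ _⟩
    rw [this, Measure.restrict_univ]
  · intro i j hij
    refine Set.disjoint_left.2 ?_
    rintro z ⟨hi, -⟩ ⟨hj, -⟩
    exact hij ((show ⌊‖z.1.1‖⌋₊ = i from hi).symm.trans hj)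
  · exact fun n => (measurableSet_annulus n).prod MeasurableSet.univ

/-- Sums over the points of a configuration depend measurably on it and on parameters. -/
lemma measurable_tsum_diff {P : Type*} [MeasurableSpace P] {f : P → Germ → Config → ℝ≥0∞}
    (hf : Measurable fun z : P × Germ × Config => f z.1 z.2.1 z.2.2) :
    Measurable fun z : P × Config => ∑' w : z.2.1, f z.1 w.1 (z.2.diff {w.1}) := by
  have h : ∀ z : P × Config, ∑' w : z.2.1, f z.1 w.1 (z.2.diff {w.1}) =
      ∫⁻ y, f z.1 y.1 y.2 ∂((pointKernel.comap Prod.snd measurable_snd : Kernel (P × Config) _) z)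
      := fun z => by
    rw [Kernel.comap_apply, pointKernel_apply,
      lintegral_pointMeasure (f := fun y => f z.1 y.1 y.2) _ (by fun_prop)]
  simp_rw [h]
  exact Measurable.lintegral_kernel_prod_right 
    (f := fun (z : P × Config) (y : Germ × Config) => f z.1 y.1 y.2)
    (by unfold Function.uncurry; fun_prop)

/-! ### The Mecke formula -/

namespace IsPoissonProcess

variable {μ : Measure Config} {ν : Measure Germ}

lemma measure_avoid (h : IsPoissonProcess μ ν) {B : Set Germ} (hB : MeasurableSet B)
    (hν : ν B ≠ ∞) : μ (avoid B) = ENNReal.ofReal (Real.exp (-(ν B).toReal)) := by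
  have := h.poisson B hB hν 0
  simp only [Nat.cast_zero, pow_zero, mul_one, Nat.factorial_zero, Nat.cast_one, div_one] at this
  rw [avoid_eq_count]
  exact this

lemma lintegral_count (h : IsPoissonProcess μ ν) {A : Set Germ} (hA : MeasurableSet A)
    (hν : ν A ≠ ∞) {N : ℕ} (hN : A ⊆ window N) :
    ∫⁻ ξ, (ξ.count A : ℝ≥0∞) ∂μ = ν A := by
  set r : ℝ := (ν A).toReal with hr
  have hr0 : 0 ≤ r := ENNReal.toReal_nonneg
  have hmeas : Measurable fun ξ : Config => (ξ.count A).toNat :=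
    (Measurable.of_discrete (f := ENat.toNat)).comp (measurable_count hA)
  have h1 : ∫⁻ ξ, (ξ.count A : ℝ≥0∞) ∂μ =
      ∫⁻ n : ℕ, (n : ℝ≥0∞) ∂(μ.map fun ξ : Config => (ξ.count A).toNat) := by
    rw [lintegral_map (by fun_prop) hmeas]
    refine lintegral_congr fun ξ => ?_
    obtain ⟨j, hj⟩ := ENat.ne_top_iff_exists.1 (ξ.count_ne_top hN)
    simp [← hj]
  have h2 : ∀ n : ℕ, (μ.map fun ξ : Config => (ξ.count A).toNat) {n} =
      ENNReal.ofReal (Real.exp (-r) * r ^ n / (n ! : ℝ)) := by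
    intro n
    rw [Measure.map_apply hmeas (measurableSet_singleton n), ← h.poisson A hA hν n]
    congr 1
    ext ξ
    obtain ⟨j, hj⟩ := ENat.ne_top_iff_exists.1 (ξ.count_ne_top hN)
    simp [← hj]
  rw [h1, lintegral_countable']
  simp_rw [h2]
  rw [tsum_eq_zero_add' ENNReal.summable]
  have h3 : ∀ n : ℕ, ((n + 1 : ℕ) : ℝ≥0∞) *
      ENNReal.ofReal (Real.exp (-r) * r ^ (n + 1) / ((n + 1)! : ℝ)) =
      ENNReal.ofReal r * ENNReal.ofReal (Real.exp (-r) * r ^ n / (n ! : ℝ)) := by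
    intro n
    rw [← ENNReal.ofReal_natCast, ← ENNReal.ofReal_mul (by positivity), ← ENNReal.ofReal_mul hr0]
    congr 1
    rw [Nat.factorial_succ]
    push_cast
    field_simp
    ring
  simp_rw [h3]
  have h4 : HasSum (fun n : ℕ => Real.exp (-r) * r ^ n / (n ! : ℝ)) 1 :=
    hasSum_one_poissonMeasure ⟨r, hr0⟩
  rw [ENNReal.tsum_mul_left, ← ENNReal.ofReal_tsum_of_nonneg (fun n => by positivity)
    h4.summable, h4.tsum_eq]
  simp [hr, ENNReal.ofReal_toReal hν]

lemma indepFun_count (h : IsPoissonProcess μ ν) {A B : Set Germ} (hA : MeasurableSet A)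
    (hB : MeasurableSet B) (hAB : Disjoint A B) :
    IndepFun (Config.count A) (Config.count B) μ := by
  have := (h.indep 2 ![A, B] (by simp [Fin.forall_fin_two, hA, hB]) (by
    intro i j hij
    fin_cases i <;> fin_cases j <;> simp_all [hAB.symm])).indepFun (show (0 : Fin 2) ≠ 1 by simp)
  simpa using this

/-- The Mecke formula on a rectangle. If `B` is empty, the points of `A` lie in `A \ B`, independent
of `B`: contribution `μ (avoid B) * ν (A \ B)`. If `B` holds one point, and it lies in `A`, the
independent counts of `B \ A` and `A ∩ B` are 0 and 1: contribution `μ (avoid B) * ν (A ∩ B)`. -/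
lemma lintegral_rectangle (h : IsPoissonProcess μ ν) {A B : Set Germ} (hA : MeasurableSet A)
    (hB : MeasurableSet B) (hνA : ν A ≠ ∞) (hνB : ν B ≠ ∞) {N : ℕ} (hN : A ⊆ window N) :
    ∫⁻ ξ, pointMeasure ξ (A ×ˢ avoid B) ∂μ = ν A * μ (avoid B) := by
  simp_rw [pointMeasure_rectangle _ hA hB]
  have hf0 : Measurable fun ξ : Config => if ξ.count B = 0 then (ξ.count A : ℝ≥0∞) else 0 :=
    Measurable.ite (measurable_count hB (measurableSet_singleton 0))
      (measurable_toENNReal_count hA) measurable_const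
  rw [lintegral_add_left hf0]
  have hd : ν (A \ B) ≠ ∞ := measure_ne_top_of_subset sdiff_subset hνA
  have hi : ν (A ∩ B) ≠ ∞ := measure_ne_top_of_subset inter_subset_left hνA
  have hc : ν (B \ A) ≠ ∞ := measure_ne_top_of_subset sdiff_subset hνB
  have hBsplit : ν B = ν (A ∩ B) + ν (B \ A) := by
    rw [inter_comm, measure_inter_add_sdiff _ hA]
  have hAsplit : ν A = ν (A ∩ B) + ν (A \ B) := (measure_inter_add_sdiff _ hB).symm
  have e1 : ∫⁻ ξ : Config, (if ξ.count B = 0 then (ξ.count A : ℝ≥0∞) else 0) ∂μ =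
      μ (avoid B) * ν (A \ B) := by
    have hind : IndepFun (fun ξ : Config => if ξ.count B = 0 then (1 : ℝ≥0∞) else 0)
        (fun ξ : Config => (ξ.count (A \ B) : ℝ≥0∞)) μ :=
      (h.indepFun_count hB (hA.diff hB) disjoint_sdiff_right).comp
        (Measurable.of_discrete (f := fun n : ℕ∞ => if n = 0 then (1 : ℝ≥0∞) else 0))
        (Measurable.of_discrete (f := fun n : ℕ∞ => (n : ℝ≥0∞)))
    have hm : Measurable fun ξ : Config => if ξ.count B = 0 then (1 : ℝ≥0∞) else 0 :=
      (Measurable.of_discrete (f := fun n : ℕ∞ => if n = 0 then (1 : ℝ≥0∞) else 0)).comp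
        (measurable_count hB)
    have := lintegral_mul_eq_lintegral_mul_lintegral_of_indepFun hm
      (measurable_toENNReal_count (hA.diff hB)) hind
    rw [h.lintegral_count (hA.diff hB) hd (sdiff_subset.trans hN)] at this
    have hav : ∫⁻ ξ : Config, (if ξ.count B = 0 then (1 : ℝ≥0∞) else 0) ∂μ = μ (avoid B) := by
      rw [← lintegral_indicator_one (measurableSet_avoid hB), avoid_eq_count]
      refine lintegral_congr fun ξ => ?_
      simp [indicator]
    rw [hav] at this
    rw [← this]
    refine lintegral_congr fun ξ => ?_
    simp only [Pi.mul_apply]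
    split_ifs with h0
    · have h1 : ξ.1 ∩ B = ∅ := by simpa [Config.count] using h0
      have : ξ.1 ∩ A = ξ.1 ∩ (A \ B) := by
        ext w
        have : w ∉ ξ.1 ∩ B := by simp [h1]
        simp only [mem_inter_iff, Set.mem_sdiff] at this ⊢
        tauto
      simp [Config.count, this]
    · simp
  have e2 : ∫⁻ ξ : Config, (if ξ.count B = 1 then (ξ.count (A ∩ B) : ℝ≥0∞) else 0) ∂μ =
      μ (avoid (B \ A)) * (ENNReal.ofReal (Real.exp (-(ν (A ∩ B)).toReal)) * ν (A ∩ B)) := by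
    have hind := h.indepFun_count (hB.diff hA) (hA.inter hB)
      (disjoint_sdiff_left.mono_right inter_subset_left)
    have h1 := hind.measure_inter_preimage_eq_mul {0} {1} (measurableSet_singleton _)
      (measurableSet_singleton _)
    have h2 : μ (Config.count (A ∩ B) ⁻¹' {1}) =
        ENNReal.ofReal (Real.exp (-(ν (A ∩ B)).toReal)) * ν (A ∩ B) := by
      have := h.poisson (A ∩ B) (hA.inter hB) hi 1
      simp only [Nat.cast_one, pow_one, Nat.factorial_one, div_one] at this
      rw [ENNReal.ofReal_mul (Real.exp_nonneg _), ENNReal.ofReal_toReal hi] at this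
      exact this
    rw [avoid_eq_count, ← h2, ← h1, ← lintegral_indicator_one
      ((measurable_count (hB.diff hA) (measurableSet_singleton _)).inter
        (measurable_count (hA.inter hB) (measurableSet_singleton _)))]
    refine lintegral_congr fun ξ => ?_
    have hadd : ξ.count B = ξ.count (B \ A) + ξ.count (A ∩ B) := by
      rw [Config.count, Config.count, Config.count, ← encard_union_eq]
      · congr 1
        ext w
        simp only [mem_inter_iff, Set.mem_sdiff, mem_union]
        tauto
      · exact Set.disjoint_left.2 fun w hw hw' => hw.2.2 hw'.2.1
    have hle : ξ.count (A ∩ B) ≤ ξ.count B := by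
      rw [hadd]
      exact le_add_self
    split_ifs with hB1
    · rw [hB1] at hle hadd
      rcases Order.le_one_iff.1 hle with h0 | h0
      · simp [h0, indicator]
      · rw [h0] at hadd
        have : ξ.count (B \ A) = 0 := by
          have h' : (1 : ℕ∞) = ξ.count (B \ A) + 1 := hadd
          generalize ξ.count (B \ A) = x at h'
          cases x with
          | top => simp at h'
          | coe x =>
            norm_cast at h' ⊢
            omega
        simp [h0, this, indicator]
    · rw [indicator_of_notMem]
      rintro ⟨h0, h1⟩
      rw [mem_preimage, mem_singleton_iff] at h0 h1
      rw [h0, h1] at hadd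
      exact hB1 (by simpa using hadd)
  rw [e1, e2, h.measure_avoid hB hνB, h.measure_avoid (hB.diff hA) hc, ← mul_assoc,
    ← ENNReal.ofReal_mul (Real.exp_nonneg _), ← Real.exp_add]
  have : -(ν (B \ A)).toReal + -(ν (A ∩ B)).toReal = -(ν B).toReal := by
    rw [hBsplit, ENNReal.toReal_add hi hc]
    ring
  rw [this, ← mul_add, mul_comm, hAsplit, add_comm]

/-- The Mecke formula, as an identity of measures. -/
theorem bind_pointKernel (h : IsPoissonProcess μ ν) (hν : ∀ n, ν (window n) ≠ ∞) :
    μ.bind pointKernel = ν.prod μ := by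
  have := h.isProbabilityMeasure
  have heq : ∀ s ∈ image2 (· ×ˢ ·) {A : Set Germ | MeasurableSet A ∧ ∃ n, A ⊆ window n}
      avoidSystem, μ.bind pointKernel s = ν.prod μ s := by
    rintro _ ⟨A, ⟨hA, n, hn⟩, _, ⟨B, hB, ⟨m, hm⟩, rfl⟩, rfl⟩
    rw [Measure.bind_apply (hA.prod (measurableSet_avoid hB)) pointKernel.aemeasurable,
      Measure.prod_prod]
    simp_rw [pointKernel_apply]
    exact h.lintegral_rectangle hA hB (measure_ne_top_of_subset hn (hν n))
      (measure_ne_top_of_subset hm (hν m)) hn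
  have hmem : ∀ n, window n ×ˢ (univ : Set Config) ∈ image2 (· ×ˢ ·)
      {A : Set Germ | MeasurableSet A ∧ ∃ n, A ⊆ window n} avoidSystem := fun n =>
    ⟨window n, ⟨measurableSet_window n, n, le_rfl⟩, univ,
      ⟨∅, MeasurableSet.empty, ⟨0, empty_subset _⟩, avoid_empty.symm⟩, rfl⟩
  refine Measure.ext_of_generateFrom_of_iUnion _ (fun n => window n ×ˢ univ)
    generateFrom_rectangles.symm isPiSystem_rectangles ?_ hmem ?_ heq
  · exact eq_univ_of_forall fun z => mem_iUnion.2 ⟨_, mem_window_ceil z.1, mem_univ _⟩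
  · intro n
    rw [heq _ (hmem n), Measure.prod_prod]
    exact ENNReal.mul_ne_top (hν n) (measure_ne_top _ _)

/-- The Mecke formula. -/
theorem lintegral_tsum_diff (h : IsPoissonProcess μ ν) (hν : ∀ n, ν (window n) ≠ ∞)
    {f : Germ → Config → ℝ≥0∞} (hf : Measurable fun z : Germ × Config => f z.1 z.2) :
    ∫⁻ ξ : Config, ∑' w : ξ.1, f w.1 (ξ.diff {w.1}) ∂μ = ∫⁻ w, ∫⁻ ξ, f w ξ ∂μ ∂ν := by
  have := h.isProbabilityMeasure
  rw [← lintegral_prod (fun z : Germ × Config => f z.1 z.2) hf.aemeasurable,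
    ← h.bind_pointKernel hν, Measure.lintegral_bind pointKernel.aemeasurable hf.aemeasurable]
  simp_rw [pointKernel_apply, lintegral_pointMeasure _ hf]

end IsPoissonProcess

/-! ### Sums over tuples and the multivariate Mecke formula -/

/-- `w` is a tuple of distinct points of `ξ` with the prescribed angles. -/
def IsTuple {n : ℕ} (θ : Fin n → ℝ) (ξ : Config) (w : Fin n → Germ) : Prop :=
  Function.Injective w ∧ ∀ i, w i ∈ ξ.1 ∧ (w i).2.1 = θ i

/-- The sum of `F w (ξ \ w)` over the tuples `w` of distinct points of `ξ` with prescribed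
angles. -/
def tupleSum {n : ℕ} (θ : Fin n → ℝ) (F : (Fin n → Germ) → Config → ℝ≥0∞) (ξ : Config) : ℝ≥0∞ :=
  ∑' w : Fin n → Germ, {w | IsTuple θ ξ w}.indicator (fun w => F w (ξ.diff (range w))) w

lemma tupleSum_zero (θ : Fin 0 → ℝ) (F : (Fin 0 → Germ) → Config → ℝ≥0∞) (ξ : Config) :
    tupleSum θ F ξ = F Fin.elim0 ξ := by
  have h : ∀ w : Fin 0 → Germ, w = Fin.elim0 := fun w => Subsingleton.elim _ _
  rw [tupleSum, tsum_eq_single Fin.elim0 (fun w hw => absurd (h w) hw), indicator_of_mem]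
  · congr 1
    apply Subtype.ext
    simp [Config.diff]
  · exact ⟨fun i => i.elim0, fun i => i.elim0⟩

lemma isTuple_cons {n : ℕ} (θ : Fin (n + 1) → ℝ) (ξ : Config) (v : Germ) (w : Fin n → Germ) :
    IsTuple θ ξ (Fin.cons v w) ↔
      v ∈ ξ.1 ∧ v.2.1 = θ 0 ∧ IsTuple (fun i => θ i.succ) (ξ.diff {v}) w := by
  simp only [IsTuple, Fin.cons_injective_iff, Fin.forall_fin_succ, Fin.cons_zero, Fin.cons_succ,
    Config.diff, Set.mem_sdiff, mem_singleton_iff, mem_range, not_exists, forall_and]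
  tauto

/-- Distinctness is what makes this recursive: once the first point `v` is chosen, the others form a
tuple of distinct points of `ξ \ {v}`. -/
lemma tupleSum_succ {n : ℕ} (θ : Fin (n + 1) → ℝ) (F : (Fin (n + 1) → Germ) → Config → ℝ≥0∞)
    (ξ : Config) :
    tupleSum θ F ξ = ∑' v : ξ.1, {v : Germ | v.2.1 = θ 0}.indicator (fun v =>
      tupleSum (fun i => θ i.succ) (fun w => F (Fin.cons v w)) (ξ.diff {v})) v.1 := by
  rw [tupleSum, ← (Fin.consEquiv fun _ => Germ).tsum_eq, ENNReal.tsum_prod',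
    tsum_subtype ξ.1 (fun v => {v : Germ | v.2.1 = θ 0}.indicator (fun v =>
      tupleSum (fun i => θ i.succ) (fun w => F (Fin.cons v w)) (ξ.diff {v})) v)]
  refine tsum_congr fun v => ?_
  by_cases hv : v ∈ ξ.1 ∧ v.2.1 = θ 0
  · rw [indicator_of_mem hv.1, indicator_of_mem (show v ∈ {v : Germ | v.2.1 = θ 0} from hv.2),
      tupleSum]
    refine tsum_congr fun w => ?_
    by_cases hw : IsTuple (fun i => θ i.succ) (ξ.diff {v}) w
    · rw [indicator_of_mem (s := {w | IsTuple (fun i => θ i.succ) (ξ.diff {v}) w}) hw,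
        indicator_of_mem]
      · change F (Fin.cons v w) _ = F (Fin.cons v w) _
        congr 1
        apply Subtype.ext
        simp only [Config.diff]
        change ξ.1 \ range (Fin.cons v w) = _
        rw [Fin.range_cons, sdiff_sdiff, singleton_union]
      · exact (isTuple_cons _ _ _ _).2 ⟨hv.1, hv.2, hw⟩
    · rw [indicator_of_notMem (s := {w | IsTuple (fun i => θ i.succ) (ξ.diff {v}) w}) hw,
        indicator_of_notMem]
      exact fun h => hw ((isTuple_cons _ _ _ _).1 h).2.2
  · have h0 : ∀ w : Fin n → Germ, {w | IsTuple θ ξ w}.indicator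
        (fun w => F w (ξ.diff (range w))) ((Fin.consEquiv fun _ => Germ) (v, w)) = 0 := by
      intro w
      rw [indicator_of_notMem]
      intro h
      have := (isTuple_cons _ _ _ _).1 h
      exact hv ⟨this.1, this.2.1⟩
    simp_rw [h0, tsum_zero]
    by_cases h : v ∈ ξ.1
    · rw [indicator_of_mem h, indicator_of_notMem]
      exact fun h' => hv ⟨h, h'⟩
    · rw [indicator_of_notMem h]

lemma measurable_cons {E : Type*} [MeasurableSpace E] {n : ℕ} :
    Measurable fun z : E × (Fin n → E) => (Fin.cons z.1 z.2 : Fin (n + 1) → E) := by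
  rw [measurable_pi_iff]
  intro i
  refine Fin.cases ?_ (fun j => ?_) i
  · simpa using measurable_fst
  · simp only [Fin.cons_succ]
    fun_prop

lemma lintegral_fin_cons {E : Type*} [MeasureSpace E] [SigmaFinite (volume : Measure E)] {n : ℕ}
    {f : (Fin (n + 1) → E) → ℝ≥0∞} (hf : Measurable f) :
    ∫⁻ x, f x = ∫⁻ v, ∫⁻ x : Fin n → E, f (Fin.cons v x) := by
  rw [← lintegral_prod (fun z : E × (Fin n → E) => f (Fin.cons z.1 z.2))
    (hf.comp measurable_cons).aemeasurable, ← Measure.volume_eq_prod]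
  refine Eq.trans ?_ ((volume_preserving_piFinSuccAbove (fun _ : Fin (n + 1) => E)
    0).lintegral_map_equiv (fun z : E × (Fin n → E) => f (Fin.cons z.1 z.2)) _).symm
  refine lintegral_congr fun x => ?_
  congr 1
  funext i
  refine Fin.cases ?_ (fun j => ?_) i <;> simp [MeasurableEquiv.piFinSuccAbove, Fin.tail]

lemma measurableSet_angle (a : ℝ) : MeasurableSet {v : Germ | v.2.1 = a} :=
  measurableSet_eq_fun (by fun_prop) measurable_const

/-- The parameter space `P` is there for the induction: at each step the chosen first point joins
the parameters. -/
lemma measurable_tupleSum {n : ℕ} {P : Type*} [MeasurableSpace P] (θ : Fin n → ℝ)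
    {F : P → (Fin n → Germ) → Config → ℝ≥0∞}
    (hF : Measurable fun z : P × (Fin n → Germ) × Config => F z.1 z.2.1 z.2.2) :
    Measurable fun z : P × Config => tupleSum θ (F z.1) z.2 := by
  induction n generalizing P with
  | zero =>
    simp_rw [tupleSum_zero]
    exact hF.comp (by fun_prop : Measurable fun z : P × Config =>
      (z.1, (Fin.elim0 : Fin 0 → Germ), z.2))
  | succ n ih =>
    simp_rw [tupleSum_succ]
    have hcons : Measurable fun z : (P × Germ) × (Fin n → Germ) × Config =>
        F z.1.1 (Fin.cons z.1.2 z.2.1) z.2.2 :=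
      hF.comp (f := fun z : (P × Germ) × (Fin n → Germ) × Config =>
          (z.1.1, (Fin.cons z.1.2 z.2.1 : Fin (n + 1) → Germ), z.2.2))
        (measurable_fst.fst.prodMk ((measurable_cons.comp
          (measurable_fst.snd.prodMk measurable_snd.fst)).prodMk measurable_snd.snd))
    have h1 := ih (fun i => θ i.succ) (P := P × Germ)
      (F := fun z w η => F z.1 (Fin.cons z.2 w) η) hcons
    refine measurable_tsum_diff (f := fun p v η => {v : Germ | v.2.1 = θ 0}.indicator (fun v =>
      tupleSum (fun i => θ i.succ) (fun w => F p (Fin.cons v w)) η) v) ?_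
    have h2 : Measurable fun z : P × Germ × Config =>
        tupleSum (fun i => θ i.succ) (fun w => F z.1 (Fin.cons z.2.1 w)) z.2.2 :=
      h1.comp (f := fun z : P × Germ × Config => ((z.1, z.2.1), z.2.2)) (by fun_prop)
    exact h2.indicator (s := {z : P × Germ × Config | z.2.1.2.1 = θ 0})
      ((measurableSet_angle (θ 0)).preimage measurable_snd.fst)

/-- The multivariate Mecke formula, derived from the univariate one. -/
lemma lintegral_tupleSum {μ : Measure Config} [SFinite μ] {n : ℕ} {B : Type*}
    (a : B → ℝ) (γ : B → Plane → Germ) (c : B → ℝ≥0∞) (hγ : ∀ b, Measurable (γ b))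
    (hM : ∀ (b : B) (f : Germ → Config → ℝ≥0∞), Measurable (fun z : Germ × Config => f z.1 z.2) →
      ∫⁻ ξ : Config, ∑' v : ξ.1, {v : Germ | v.2.1 = a b}.indicator
        (fun v => f v (ξ.diff {v})) v.1 ∂μ = c b * ∫⁻ x, ∫⁻ ξ, f (γ b x) ξ ∂μ)
    (τ : Fin n → B) {F : (Fin n → Germ) → Config → ℝ≥0∞}
    (hF : Measurable fun z : (Fin n → Germ) × Config => F z.1 z.2) :
    ∫⁻ ξ, tupleSum (fun i => a (τ i)) F ξ ∂μ =
      (∏ i, c (τ i)) * ∫⁻ x : Fin n → Plane, ∫⁻ ξ, F (fun i => γ (τ i) (x i)) ξ ∂μ := by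
  induction n with
  | zero =>
    simp_rw [tupleSum_zero]
    rw [Finset.univ_eq_empty, Finset.prod_empty, one_mul, volume_pi,
      Measure.pi_of_empty _ (Fin.elim0 : Fin 0 → Plane), lintegral_dirac]
    refine lintegral_congr fun ξ => ?_
    congr 1
    exact Subsingleton.elim _ _
  | succ n ih =>
    have hcons : Measurable fun z : Germ × (Fin n → Germ) × Config =>
        F (Fin.cons z.1 z.2.1) z.2.2 :=
      hF.comp (f := fun z : Germ × (Fin n → Germ) × Config =>
          ((Fin.cons z.1 z.2.1 : Fin (n + 1) → Germ), z.2.2))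
        ((measurable_cons.comp
          (measurable_fst.prodMk measurable_snd.fst)).prodMk measurable_snd.snd)
    simp_rw [tupleSum_succ]
    -- The inner sum depends on `ξ` only through `ξ \ {v}`, which the univariate formula replaces by
    -- `ξ` itself; the induction hypothesis then applies with `v` fixed.
    rw [hM (τ 0) (fun v η => tupleSum (fun i => a (τ i.succ)) (fun w => F (Fin.cons v w)) η)
      (measurable_tupleSum (F := fun v w η => F (Fin.cons v w) η) _ hcons)]
    have h1 : ∀ v, ∫⁻ ξ, tupleSum (fun i => a (τ i.succ)) (fun w => F (Fin.cons v w)) ξ ∂μ =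
        (∏ i : Fin n, c (τ i.succ)) * ∫⁻ x : Fin n → Plane, ∫⁻ ξ,
          F (Fin.cons v fun i => γ (τ i.succ) (x i)) ξ ∂μ := fun v => by
      refine ih (fun i => τ i.succ) (F := fun w η => F (Fin.cons v w) η) ?_
      exact hcons.comp (f := fun z : (Fin n → Germ) × Config => (v, z.1, z.2)) (by fun_prop)
    simp_rw [h1]
    have hγ' : Measurable fun x : Fin (n + 1) → Plane => fun i => γ (τ i) (x i) :=
      measurable_pi_lambda _ fun i => (hγ _).comp (measurable_pi_apply i)
    have hG : Measurable fun x : Fin (n + 1) → Plane => ∫⁻ ξ, F (fun i => γ (τ i) (x i)) ξ ∂μ := by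
      refine Measurable.lintegral_prod_right' (f := fun y : (Fin (n + 1) → Plane) × Config =>
        F (fun i => γ (τ i) (y.1 i)) y.2) ?_
      exact hF.comp (f := fun y : (Fin (n + 1) → Plane) × Config =>
        ((fun i => γ (τ i) (y.1 i)), y.2)) ((hγ'.comp measurable_fst).prodMk measurable_snd)
    have hc : ∀ (v : Plane) (x : Fin n → Plane),
        (fun i => γ (τ i) ((Fin.cons v x : Fin (n + 1) → Plane) i)) =
          (Fin.cons (γ (τ 0) v) fun i => γ (τ i.succ) (x i) : Fin (n + 1) → Germ) := fun v x => by
      funext i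
      refine Fin.cases ?_ (fun j => ?_) i <;> simp
    have hG' : Measurable fun v => ∫⁻ x : Fin n → Plane, ∫⁻ ξ,
        F (Fin.cons (γ (τ 0) v) fun i => γ (τ i.succ) (x i)) ξ ∂μ := by
      simp_rw [← hc]
      exact (hG.comp measurable_cons).lintegral_prod_right'
    rw [lintegral_const_mul _ hG', lintegral_fin_cons hG, Fin.prod_univ_succ, mul_assoc]
    simp_rw [hc]

/-! ### Clusters and their ordered listings -/

/-- Two sticks intersect. -/
def Meets (v w : Germ) : Prop := (stick v ∩ stick w).Nonempty

lemma Meets.symm {v w : Germ} (h : Meets v w) : Meets w v := by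
  rwa [Meets, inter_comm]

/-- The germ translated by `x`. -/
def shift (x : Plane) (w : Germ) : Germ := (w.1 + x, w.2)

lemma shift_injective (x : Plane) : Function.Injective (shift x) := by
  rintro ⟨a, b⟩ ⟨c, d⟩ h
  simpa [shift] using h

lemma shift_shift_neg (x : Plane) (w : Germ) : shift x (shift (-x) w) = w := by
  simp [shift]

lemma add_mem_stick_shift (x : Plane) (w : Germ) (y : Plane) :
    y + x ∈ stick (shift x w) ↔ y ∈ stick w := by
  simp only [stick, shift, mem_ofPred_eq]
  refine exists_congr fun u => and_congr_right fun _ => ?_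
  rw [add_right_comm, add_left_inj]

lemma meets_shift (x : Plane) (v w : Germ) : Meets (shift x v) (shift x w) ↔ Meets v w := by
  constructor
  · rintro ⟨y, h1, h2⟩
    refine ⟨y - x, (add_mem_stick_shift x v _).1 ?_, (add_mem_stick_shift x w _).1 ?_⟩ <;>
      simpa
  · rintro ⟨y, h1, h2⟩
    exact ⟨y + x, (add_mem_stick_shift x v _).2 h1, (add_mem_stick_shift x w _).2 h2⟩

/-- The sticks of `ξ` connected to `w`. -/
def component (ξ : Config) (w : Germ) : Set Germ := {v | v ∈ ξ.1 ∧ Connected ξ w v}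

lemma Connected.symm {ξ : Config} {v w : Germ} (h : Connected ξ v w) : Connected ξ w v := by
  induction h with
  | refl => exact .refl
  | tail _ hs ih => exact ih.head ⟨hs.2.1, hs.1, Meets.symm hs.2.2⟩

lemma connected_recentre (ξ : Config) (x : Plane) (v w : Germ) :
    Connected (ξ.recentre x) v w ↔ Connected ξ (shift x v) (shift x w) := by
  constructor
  · intro h
    refine Relation.ReflTransGen.lift (shift x) ?_ _ _ h
    rintro a b ⟨ha, hb, hab⟩
    exact ⟨ha, hb, (meets_shift x a b).2 hab⟩
  · intro h
    have h' : Connected (ξ.recentre x) (shift (-x) (shift x v)) (shift (-x) (shift x w)) := by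
      refine Relation.ReflTransGen.lift (shift (-x)) ?_ _ _ h
      rintro a b ⟨ha, hb, hab⟩
      refine ⟨?_, ?_, (meets_shift (-x) a b).2 hab⟩
      · change shift x (shift (-x) a) ∈ ξ.1
        rwa [shift_shift_neg]
      · change shift x (shift (-x) b) ∈ ξ.1
        rwa [shift_shift_neg]
    simpa [shift] using h'

/-- Several sticks could share the centre of `w`, but they all meet there, so the cluster of the
origin seen from that centre is still a single component. -/
lemma shift_image_cluster {ξ : Config} {w : Germ} (hw : w ∈ ξ.1) :
    shift w.1 '' cluster (ξ.recentre w.1) = component ξ w := by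
  have hself : ∀ u ∈ ξ.1, u.1 ∈ stick u := fun u hu =>
    ⟨0, ⟨by linarith [(ξ.2.1 u hu).2], (ξ.2.1 u hu).2.le⟩, by simp⟩
  ext v
  constructor
  · rintro ⟨v, ⟨hv, u, hu, hu0, huv⟩, rfl⟩
    refine ⟨hv, ?_⟩
    have hu' : shift w.1 u ∈ ξ.1 := hu
    have hc : (shift w.1 u).1 = w.1 := by simp [shift, hu0]
    refine Relation.ReflTransGen.head ⟨hw, hu', w.1, hself w hw, ?_⟩
      ((connected_recentre ξ w.1 u v).1 huv)
    have := hself _ hu'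
    rwa [hc] at this
  · rintro ⟨hv, hwv⟩
    refine ⟨shift (-w.1) v, ⟨?_, shift (-w.1) w, ?_, ?_, ?_⟩, shift_shift_neg _ _⟩
    · change shift w.1 (shift (-w.1) v) ∈ ξ.1
      rwa [shift_shift_neg]
    · change shift w.1 (shift (-w.1) w) ∈ ξ.1
      rwa [shift_shift_neg]
    · simp [shift]
    · rw [connected_recentre, shift_shift_neg, shift_shift_neg]
      exact hwv

lemma recentre_mem_clusterEvent {ξ : Config} {w : Germ} (hw : w ∈ ξ.1) (α : ℝ) (k ℓ : ℕ) :
    ξ.recentre w.1 ∈ clusterEvent α k ℓ ↔ (component ξ w).encard = (k + ℓ : ℕ) ∧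
      {v ∈ component ξ w | v.2.1 = 0}.encard = k ∧
      {v ∈ component ξ w | v.2.1 = α}.encard = ℓ := by
  have h1 : ∀ a : ℝ, {v ∈ component ξ w | v.2.1 = a} =
      shift w.1 '' {v ∈ cluster (ξ.recentre w.1) | v.2.1 = a} := by
    intro a
    rw [← shift_image_cluster hw]
    ext v
    constructor
    · rintro ⟨⟨u, hu, rfl⟩, ha⟩
      exact ⟨u, ⟨hu, ha⟩, rfl⟩
    · rintro ⟨u, ⟨hu, ha⟩, rfl⟩
      exact ⟨⟨u, hu, rfl⟩, ha⟩
  rw [h1, h1, ← shift_image_cluster hw, (shift_injective _).encard_image,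
    (shift_injective _).encard_image, (shift_injective _).encard_image]
  rfl

/-- The sticks of the tuple form a connected set. -/
def Linked {n : ℕ} (w : Fin n → Germ) : Prop :=
  ∀ i j, Relation.ReflTransGen (fun i j => Meets (w i) (w j)) i j

/-- The tuple lists the sticks of a cluster of `ξ`. -/
def IsClusterTuple {n : ℕ} (θ : Fin n → ℝ) (ξ : Config) (w : Fin n → Germ) : Prop :=
  IsTuple θ ξ w ∧ Linked w ∧ ∀ v ∈ (ξ.diff (range w)).1, ∀ i, ¬ Meets (w i) v

lemma IsClusterTuple.component_eq {n : ℕ} {θ : Fin n → ℝ} {ξ : Config} {w : Fin n → Germ}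
    (h : IsClusterTuple θ ξ w) (i : Fin n) : component ξ (w i) = range w := by
  obtain ⟨⟨-, hw⟩, hl, hiso⟩ := h
  ext v
  constructor
  · rintro ⟨-, hc⟩
    induction hc with
    | refl => exact mem_range_self i
    | tail _ hs ih =>
      obtain ⟨j, rfl⟩ := ih
      by_contra hv
      exact hiso _ ⟨hs.2.1, hv⟩ j hs.2.2
  · rintro ⟨j, rfl⟩
    exact ⟨(hw j).1, Relation.ReflTransGen.lift w
      (fun a b hab => ⟨(hw a).1, (hw b).1, hab⟩) _ _ (hl i j)⟩

/-- A chain in `ξ` between two sticks of the component never leaves the component, so it can be read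
as a chain of indices. -/
lemma IsTuple.isClusterTuple {n : ℕ} {θ : Fin n → ℝ} {ξ : Config} {w : Fin n → Germ} {v : Germ}
    (h : IsTuple θ ξ w) (hr : range w = component ξ v) : IsClusterTuple θ ξ w := by
  refine ⟨h, fun i j => ?_, fun u hu i hui => ?_⟩
  · have hi : w i ∈ component ξ v := hr ▸ mem_range_self i
    have hj : w j ∈ component ξ v := hr ▸ mem_range_self j
    have hc : Connected ξ (w i) (w j) := hi.2.symm.trans hj.2
    have key : ∀ u, Connected ξ (w i) u →
        ∃ l, w l = u ∧ Relation.ReflTransGen (fun i j => Meets (w i) (w j)) i l := by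
      intro u hu
      induction hu with
      | refl => exact ⟨i, rfl, .refl⟩
      | tail hu hs ih =>
        obtain ⟨l, rfl, hl⟩ := ih
        have hmem : _ ∈ component ξ v := ⟨hs.2.1, hi.2.trans (hu.tail hs)⟩
        rw [← hr] at hmem
        obtain ⟨l', rfl⟩ := hmem
        exact ⟨l', rfl, hl.tail hs.2.2⟩
    obtain ⟨l, hl, hil⟩ := key _ hc
    rwa [h.1 hl] at hil
  · have hi : w i ∈ component ξ v := hr ▸ mem_range_self i
    exact hu.2 (hr ▸ ⟨hu.1, hi.2.tail ⟨hi.1, hu.1, hui⟩⟩)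

/-- The angles of the two kinds of sticks. -/
def angle (α : ℝ) (b : Bool) : ℝ := if b then α else 0

/-- The kinds in a tuple of `k` horizontal sticks followed by `ℓ` sticks at angle `α`. -/
def kind (k ℓ : ℕ) : Fin (k + ℓ) → Bool := Fin.append (fun _ => false) (fun _ => true)

@[simp] lemma kind_castAdd (k ℓ : ℕ) (i : Fin k) : kind k ℓ (Fin.castAdd ℓ i) = false := by
  simp [kind]

@[simp] lemma kind_natAdd (k ℓ : ℕ) (i : Fin ℓ) : kind k ℓ (Fin.natAdd k i) = true := by
  simp [kind]

/-- A listing is a pair of orderings, one of the horizontal and one of the slanted sticks. The total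
count excludes sticks of `C` at any third angle, and `α ≠ 0` keeps the two kinds apart. -/
lemma encard_tuples {α : ℝ} (hα : α ≠ 0) {k ℓ : ℕ} {ξ : Config} {C : Set Germ} (hC : C ⊆ ξ.1)
    (h : C.encard = (k + ℓ : ℕ)) (h0 : {v ∈ C | v.2.1 = 0}.encard = k)
    (h1 : {v ∈ C | v.2.1 = α}.encard = ℓ) :
    {w | IsTuple (fun i => angle α (kind k ℓ i)) ξ w ∧ range w = C}.encard =
      (k ! * ℓ ! : ℕ) := by
  classical
  set C0 := {v ∈ C | v.2.1 = 0} with hC0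
  set C1 := {v ∈ C | v.2.1 = α} with hC1
  have hfin : C.Finite := Set.finite_of_encard_eq_coe h
  have : Fintype C0 := (hfin.subset (sep_subset _ _)).fintype
  have : Fintype C1 := (hfin.subset (sep_subset _ _)).fintype
  have hcard0 : Fintype.card C0 = k := by
    rw [← Set.coe_fintypeCard] at h0
    exact_mod_cast h0
  have hcard1 : Fintype.card C1 = ℓ := by
    rw [← Set.coe_fintypeCard] at h1
    exact_mod_cast h1
  let Ψ : (Fin k ↪ C0) × (Fin ℓ ↪ C1) → Fin (k + ℓ) → Germ := fun z =>
    Fin.append (fun i => (z.1 i : Germ)) (fun i => (z.2 i : Germ))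
  have hΨinj : Function.Injective Ψ := by
    rintro ⟨e, f⟩ ⟨e', f'⟩ hz
    refine Prod.ext ?_ ?_
    · ext1 i
      have := congrFun hz (Fin.castAdd ℓ i)
      simpa [Ψ, Subtype.ext_iff] using this
    · ext1 i
      have := congrFun hz (Fin.natAdd k i)
      simpa [Ψ, Subtype.ext_iff] using this
  have hset : {w | IsTuple (fun i => angle α (kind k ℓ i)) ξ w ∧ range w = C} = range Ψ := by
    ext w
    constructor
    · rintro ⟨⟨hinj, hw⟩, hr⟩
      have hm : ∀ i, w i ∈ C := fun i => hr ▸ mem_range_self i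
      refine ⟨⟨⟨fun i => ⟨w (Fin.castAdd ℓ i), hm _, ?_⟩, fun i j hij => ?_⟩,
        ⟨fun i => ⟨w (Fin.natAdd k i), hm _, ?_⟩, fun i j hij => ?_⟩⟩, ?_⟩
      · simpa [angle] using (hw (Fin.castAdd ℓ i)).2
      · exact Fin.castAdd_injective _ _ (hinj (Subtype.ext_iff.1 hij))
      · simpa [angle] using (hw (Fin.natAdd k i)).2
      · exact Fin.natAdd_injective _ _ (hinj (Subtype.ext_iff.1 hij))
      · funext i
        refine Fin.addCases (fun j => ?_) (fun j => ?_) i <;>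
          simp only [Ψ, Fin.append_left, Fin.append_right] <;> rfl
    · rintro ⟨⟨e, f⟩, rfl⟩
      have hm : ∀ i, Ψ (e, f) i ∈ C ∧ (Ψ (e, f) i).2.1 = angle α (kind k ℓ i) := by
        intro i
        refine Fin.addCases (fun j => ?_) (fun j => ?_) i
        · have he : (e j : Germ) ∈ C ∧ (e j : Germ).2.1 = 0 := (e j).2
          simpa [Ψ, angle] using he
        · have hf : (f j : Germ) ∈ C ∧ (f j : Germ).2.1 = α := (f j).2
          simpa [Ψ, angle] using hf
      have hinj : Function.Injective (Ψ (e, f)) := by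
        intro i j hij
        have hk : kind k ℓ i = kind k ℓ j := by
          have h2 := (hm i).2
          rw [hij, (hm j).2] at h2
          rcases hi : kind k ℓ i <;> rcases hj : kind k ℓ j <;>
            simp_all [angle]
        revert hij hk
        refine Fin.addCases (fun i => ?_) (fun i => ?_) i <;>
          refine Fin.addCases (fun j => ?_) (fun j => ?_) j <;> intro hij hk
        · simpa [Ψ, Subtype.ext_iff.symm] using hij
        · simp at hk
        · simp at hk
        · simpa [Ψ, Subtype.ext_iff.symm] using hij
      refine ⟨⟨hinj, fun i => ⟨hC (hm i).1, (hm i).2⟩⟩, ?_⟩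
      -- `k + ℓ` distinct elements of a set of that size exhaust it.
      refine hfin.eq_of_subset_of_encard_le' ?_ ?_
      · rintro _ ⟨i, rfl⟩
        exact (hm i).1
      · rw [h, ← image_univ, hinj.encard_image]
        simp
  rw [hset, ← image_univ, hΨinj.encard_image, encard_univ, ENat.card_eq_coe_fintype_card,
    Fintype.card_prod, Fintype.card_embedding_eq, Fintype.card_embedding_eq, hcard0, hcard1,
    Fintype.card_fin, Fintype.card_fin, Nat.descFactorial_self, Nat.descFactorial_self]

/-- The summand over tuples that counts the clusters, weighted by the number of their centres
in `U`. -/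
def clusterWeight {n : ℕ} (U : Set Plane) (w : Fin n → Germ) (η : Config) : ℝ≥0∞ :=
  (∑ i, U.indicator 1 (w i).1) * {w | Linked w}.indicator 1 w *
    {z : (Fin n → Germ) × Config | ∀ v ∈ z.2.1, ∀ i, ¬ Meets (z.1 i) v}.indicator 1 (w, η)

/-- Double counting of pairs of a listed cluster and one of its sticks centred in `U`. For a fixed
stick there are `k ! * ℓ !` listings of its component if the type is right and none otherwise; for a
fixed listing the sticks centred in `U` are counted by the weight. -/
lemma tupleSum_clusterWeight {α : ℝ} (hα : α ≠ 0) (k ℓ : ℕ) (U : Set Plane) (ξ : Config) :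
    tupleSum (fun i => angle α (kind k ℓ i)) (clusterWeight U) ξ =
      (k ! * ℓ ! : ℕ) * ∑' w : {w : Germ // w ∈ ξ.1 ∧ w.1 ∈ U},
        (clusterEvent α k ℓ).indicator (fun _ => (1 : ℝ≥0∞)) (ξ.recentre w.1.1) := by
  classical
  set θ : Fin (k + ℓ) → ℝ := fun i => angle α (kind k ℓ i) with hθ
  have hG : ∀ v ∈ ξ.1, ∀ w, IsClusterTuple θ ξ w ∧ v ∈ range w ↔
      IsTuple θ ξ w ∧ range w = component ξ v := by
    intro v hv w
    constructor
    · rintro ⟨h, i, rfl⟩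
      exact ⟨h.1, (h.component_eq i).symm⟩
    · rintro ⟨h, hr⟩
      exact ⟨h.isClusterTuple hr, hr ▸ ⟨hv, .refl⟩⟩
  have hcount : ∀ v ∈ ξ.1, ∑' w : Fin (k + ℓ) → Germ,
      (if IsClusterTuple θ ξ w ∧ v ∈ range w then (1 : ℝ≥0∞) else 0) =
      (k ! * ℓ ! : ℕ) * (clusterEvent α k ℓ).indicator (fun _ => (1 : ℝ≥0∞))
        (ξ.recentre v.1) := by
    intro v hv
    have h1 : ∑' w : Fin (k + ℓ) → Germ,
        (if IsClusterTuple θ ξ w ∧ v ∈ range w then (1 : ℝ≥0∞) else 0) =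
        {w | IsTuple θ ξ w ∧ range w = component ξ v}.encard := by
      rw [← ENNReal.tsum_set_one, tsum_subtype _ (fun _ => (1 : ℝ≥0∞))]
      refine tsum_congr fun w => ?_
      simp only [hG v hv, indicator, mem_ofPred_eq]
    rw [h1]
    by_cases hE : ξ.recentre v.1 ∈ clusterEvent α k ℓ
    · obtain ⟨h, h0, h1⟩ := (recentre_mem_clusterEvent hv α k ℓ).1 hE
      rw [encard_tuples hα (fun u hu => hu.1) h h0 h1, indicator_of_mem hE, mul_one]
      rfl
    · rw [indicator_of_notMem hE, mul_zero]
      have : {w | IsTuple θ ξ w ∧ range w = component ξ v} = ∅ := by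
        refine subset_empty_iff.1 ?_
        rintro w ⟨⟨hinj, hw⟩, hr⟩
        refine hE ((recentre_mem_clusterEvent hv α k ℓ).2 ?_)
        have hsep : ∀ b, {u ∈ component ξ v | u.2.1 = angle α b} = w '' {i | kind k ℓ i = b} := by
          intro b
          rw [← hr]
          ext u
          constructor
          · rintro ⟨⟨i, rfl⟩, hi⟩
            refine ⟨i, ?_, rfl⟩
            rw [(hw i).2] at hi
            change kind k ℓ i = b
            rcases hki : kind k ℓ i <;> rcases b <;> simp_all [angle]
          · rintro ⟨i, hi, rfl⟩
            refine ⟨mem_range_self i, ?_⟩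
            rw [(hw i).2, ← (show kind k ℓ i = b from hi)]
        have hf : {i | kind k ℓ i = false} = range (Fin.castAdd ℓ : Fin k → Fin (k + ℓ)) := by
          ext i
          refine Fin.addCases (fun j => ?_) (fun j => ?_) i <;> simp [Fin.ext_iff]
          intro x
          omega
        have ht : {i | kind k ℓ i = true} = range (Fin.natAdd k : Fin ℓ → Fin (k + ℓ)) := by
          ext i
          refine Fin.addCases (fun j => ?_) (fun j => ?_) i <;> simp [Fin.ext_iff]
          intro x
          omega
        refine ⟨?_, ?_, ?_⟩
        · rw [← hr, ← image_univ, hinj.encard_image]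
          simp
        · have := hsep false
          simp only [angle, Bool.false_eq_true, if_false] at this
          rw [this, hinj.encard_image, hf, ← image_univ,
            (Fin.castAdd_injective k ℓ).encard_image]
          simp
        · have := hsep true
          simp only [angle, if_true] at this
          rw [this, hinj.encard_image, ht, ← image_univ,
            (Fin.natAdd_injective ℓ k).encard_image]
          simp
      simp [this]
  have hR : (k ! * ℓ ! : ℕ) * ∑' w : {w : Germ // w ∈ ξ.1 ∧ w.1 ∈ U},
        (clusterEvent α k ℓ).indicator (fun _ => (1 : ℝ≥0∞)) (ξ.recentre w.1.1) =
      ∑' v : Germ, ∑' w : Fin (k + ℓ) → Germ, U.indicator 1 v.1 *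
        (if IsClusterTuple θ ξ w ∧ v ∈ range w then (1 : ℝ≥0∞) else 0) := by
    rw [← ENNReal.tsum_mul_left]
    refine (tsum_subtype {w : Germ | w ∈ ξ.1 ∧ w.1 ∈ U} fun w => (k ! * ℓ ! : ℕ) *
      (clusterEvent α k ℓ).indicator (fun _ => (1 : ℝ≥0∞)) (ξ.recentre w.1)).trans ?_
    refine tsum_congr fun v => ?_
    rw [ENNReal.tsum_mul_left]
    by_cases hv : v ∈ ξ.1
    · rw [hcount v hv]
      by_cases hU : v.1 ∈ U <;> simp [indicator, hv, hU]
    · rw [indicator_of_notMem (fun h => hv h.1)]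
      symm
      rw [mul_eq_zero, ENNReal.tsum_eq_zero]
      refine Or.inr fun w => if_neg ?_
      rintro ⟨h, i, rfl⟩
      exact hv (h.1.2 i).1
  rw [hR, ENNReal.tsum_comm, tupleSum]
  refine tsum_congr fun w => ?_
  by_cases hw : IsClusterTuple θ ξ w
  · rw [indicator_of_mem (show w ∈ {w | IsTuple θ ξ w} from hw.1), clusterWeight,
      indicator_of_mem (show w ∈ {w | Linked w} from hw.2.1),
      indicator_of_mem (by exact hw.2.2)]
    simp only [Pi.one_apply, mul_one, hw, true_and]
    have h2 : ∀ v : Germ, U.indicator 1 v.1 * (if v ∈ range w then (1 : ℝ≥0∞) else 0) =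
        (range w).indicator (fun v => U.indicator 1 v.1) v := by
      intro v
      by_cases hv : v ∈ range w
      · rw [if_pos hv, indicator_of_mem hv, mul_one]
      · rw [if_neg hv, indicator_of_notMem hv, mul_zero]
    simp_rw [h2]
    rw [← tsum_subtype (range w) (fun v => U.indicator (1 : Plane → ℝ≥0∞) v.1),
      tsum_range (f := fun v : Germ => U.indicator (1 : Plane → ℝ≥0∞) v.1) hw.1.1, tsum_fintype]
  · simp only [hw, false_and, if_false, mul_zero, tsum_zero]
    by_cases ht : IsTuple θ ξ w
    · rw [indicator_of_mem (show w ∈ {w | IsTuple θ ξ w} from ht), clusterWeight]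
      by_cases hl : Linked w
      · rw [indicator_of_notMem (a := (w, ξ.diff (range w))), mul_zero]
        exact fun h => hw ⟨ht, hl, h⟩
      · rw [indicator_of_notMem (show w ∉ {w | Linked w} from hl), mul_zero, zero_mul]
    · exact indicator_of_notMem (show w ∉ {w | IsTuple θ ξ w} from ht) _

/-! ### Geometry of sticks in affine coordinates -/

/-- The half-lengths of the two kinds of sticks. -/
def halfLength (R₀ Rα : ℝ) (b : Bool) : ℝ := if b then Rα else R₀

/-- The linear map taking the unit square centred at the origin to the parallelogram. -/
def frame (α R₀ Rα : ℝ) : Plane →ₗ[ℝ] Plane :=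
  (LinearMap.fst ℝ ℝ ℝ).smulRight ((2 * R₀) • unitVec 0) +
    (LinearMap.snd ℝ ℝ ℝ).smulRight ((2 * Rα) • unitVec α)

/-- The stick of kind `b` whose centre has the coordinates `x`. -/
def germ (α R₀ Rα : ℝ) (b : Bool) (x : Plane) : Germ :=
  (frame α R₀ Rα x, angle α b, halfLength R₀ Rα b)

section Geometry

variable {α R₀ Rα : ℝ}

lemma frame_apply (x : Plane) :
    frame α R₀ Rα x = x.1 • (2 * R₀) • unitVec 0 + x.2 • (2 * Rα) • unitVec α := rfl

lemma frame_injective (hα₀ : 0 < α) (hαπ : α < Real.pi) (hR₀ : 0 < R₀) (hRα : 0 < Rα) :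
    Function.Injective (frame α R₀ Rα) := by
  have hs := Real.sin_pos_of_pos_of_lt_pi hα₀ hαπ
  rw [← LinearMap.ker_eq_bot, LinearMap.ker_eq_bot']
  rintro ⟨u, v⟩ h
  simp only [frame_apply, unitVec, Prod.smul_mk, Prod.mk_add_mk, smul_eq_mul, Real.cos_zero,
    Real.sin_zero, Prod.mk_eq_zero] at h
  obtain ⟨h1, h2⟩ := h
  have hv : v = 0 := by
    have h3 : v * (2 * Rα * Real.sin α) = 0 := by linarith
    exact (mul_eq_zero.1 h3).resolve_right (by positivity)
  subst hv
  have hu : u = 0 := by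
    have h3 : u * (2 * R₀) = 0 := by linarith
    exact (mul_eq_zero.1 h3).resolve_right (by positivity)
  simp [hu]

lemma det_frame_ne_zero (hα₀ : 0 < α) (hαπ : α < Real.pi) (hR₀ : 0 < R₀) (hRα : 0 < Rα) :
    LinearMap.det (frame α R₀ Rα) ≠ 0 := by
  have h : IsUnit (frame α R₀ Rα) := by
    rw [LinearMap.isUnit_iff_ker_eq_bot, LinearMap.ker_eq_bot]
    exact frame_injective hα₀ hαπ hR₀ hRα
  exact (h.map (LinearMap.det : (Plane →ₗ[ℝ] Plane) →* ℝ)).ne_zero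

lemma measurable_frame : Measurable (frame α R₀ Rα) :=
  (LinearMap.continuous_of_finiteDimensional _).measurable

lemma measurable_germ (b : Bool) : Measurable (germ α R₀ Rα b) :=
  measurable_frame.prodMk measurable_const

lemma parallelogram_eq (hR₀ : 0 < R₀) (hRα : 0 < Rα) :
    parallelogram 0 α R₀ Rα = frame α R₀ Rα '' (Icc (-(1 / 2)) (1 / 2) ×ˢ Icc (-(1 / 2)) (1 / 2))
    := by
  ext z
  constructor
  · rintro ⟨x, ⟨hx, hx'⟩, y, ⟨hy, hy'⟩, rfl⟩
    refine ⟨(x / (2 * R₀), y / (2 * Rα)), ⟨⟨?_, ?_⟩, ?_, ?_⟩, ?_⟩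
    · rw [le_div_iff₀ (by positivity)]
      linarith
    · rw [div_le_iff₀ (by positivity)]
      linarith
    · rw [le_div_iff₀ (by positivity)]
      linarith
    · rw [div_le_iff₀ (by positivity)]
      linarith
    · rw [frame_apply, smul_smul, smul_smul, div_mul_cancel₀ _ (by positivity),
        div_mul_cancel₀ _ (by positivity)]
  · rintro ⟨⟨u, v⟩, ⟨⟨hu, hu'⟩, hv, hv'⟩, rfl⟩
    refine ⟨u * (2 * R₀), ⟨?_, ?_⟩, v * (2 * Rα), ⟨?_, ?_⟩, ?_⟩
    · simp only at hu
      nlinarith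
    · simp only at hu'
      nlinarith
    · simp only at hv
      nlinarith
    · simp only at hv'
      nlinarith
    · rw [frame_apply, smul_smul, smul_smul]

lemma volume_real_parallelogram (hR₀ : 0 < R₀) (hRα : 0 < Rα) :
    volume.real (parallelogram 0 α R₀ Rα) = |LinearMap.det (frame α R₀ Rα)| := by
  rw [measureReal_def, parallelogram_eq hR₀ hRα, Measure.addHaar_image_linearMap,
    Measure.volume_eq_prod, Measure.prod_prod, Real.volume_Icc]
  norm_num

lemma volume_real_parallelogram_pos (hα₀ : 0 < α) (hαπ : α < Real.pi) (hR₀ : 0 < R₀)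
    (hRα : 0 < Rα) : 0 < volume.real (parallelogram 0 α R₀ Rα) := by
  rw [volume_real_parallelogram hR₀ hRα]
  exact abs_pos.2 (det_frame_ne_zero hα₀ hαπ hR₀ hRα)

/-- The Jacobian of `frame` is the area of the parallelogram, the image of a unit square. Only
through it do the angle and the half-lengths enter the asymptotics. -/
lemma lintegral_frame (hα₀ : 0 < α) (hαπ : α < Real.pi) (hR₀ : 0 < R₀) (hRα : 0 < Rα)
    {f : Plane → ℝ≥0∞} (hf : Measurable f) :
    ∫⁻ x, f x = ENNReal.ofReal (volume.real (parallelogram 0 α R₀ Rα)) *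
      ∫⁻ x, f (frame α R₀ Rα x) := by
  have hd := det_frame_ne_zero hα₀ hαπ hR₀ hRα
  rw [← lintegral_map hf measurable_frame, Measure.map_linearMap_addHaar_eq_smul_addHaar _ hd,
    lintegral_smul_measure, volume_real_parallelogram hR₀ hRα, smul_eq_mul, ← mul_assoc,
    ← ENNReal.ofReal_mul (abs_nonneg _), ← abs_mul, mul_inv_cancel₀ hd]
  simp

lemma mem_stick_false (hR₀ : 0 < R₀) (x y : Plane) :
    y ∈ stick (germ α R₀ Rα false x) ↔
      ∃ u ∈ Icc (-(1 / 2) : ℝ) (1 / 2), y = frame α R₀ Rα (x + (u, 0)) := by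
  simp only [stick, germ, angle, halfLength, Bool.false_eq_true, if_false, mem_ofPred_eq]
  constructor
  · rintro ⟨u, ⟨hu, hu'⟩, rfl⟩
    refine ⟨u / (2 * R₀), ⟨?_, ?_⟩, ?_⟩
    · rw [le_div_iff₀ (by positivity)]
      linarith
    · rw [div_le_iff₀ (by positivity)]
      linarith
    · rw [map_add, frame_apply (u / (2 * R₀), 0), smul_smul, div_mul_cancel₀ _ (by positivity)]
      simp
  · rintro ⟨u, ⟨hu, hu'⟩, rfl⟩
    refine ⟨u * (2 * R₀), ⟨by nlinarith, by nlinarith⟩, ?_⟩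
    rw [map_add, frame_apply (u, 0), smul_smul]
    simp

lemma mem_stick_true (hRα : 0 < Rα) (x y : Plane) :
    y ∈ stick (germ α R₀ Rα true x) ↔
      ∃ u ∈ Icc (-(1 / 2) : ℝ) (1 / 2), y = frame α R₀ Rα (x + (0, u)) := by
  simp only [stick, germ, angle, halfLength, if_true, mem_ofPred_eq]
  constructor
  · rintro ⟨u, ⟨hu, hu'⟩, rfl⟩
    refine ⟨u / (2 * Rα), ⟨?_, ?_⟩, ?_⟩
    · rw [le_div_iff₀ (by positivity)]
      linarith
    · rw [div_le_iff₀ (by positivity)]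
      linarith
    · rw [map_add, frame_apply (0, u / (2 * Rα)), smul_smul, smul_smul,
        div_mul_cancel₀ _ (by positivity)]
      simp
  · rintro ⟨u, ⟨hu, hu'⟩, rfl⟩
    refine ⟨u * (2 * Rα), ⟨by nlinarith, by nlinarith⟩, ?_⟩
    rw [map_add, frame_apply (0, u), smul_smul, smul_smul]
    simp

/-- In coordinates a horizontal and a vertical unit segment cross at the height of the first and the
abscissa of the second, if at all. The metric on `Plane` is the sup metric, so the condition is a
unit square. -/
lemma meets_false_true (hα₀ : 0 < α) (hαπ : α < Real.pi) (hR₀ : 0 < R₀) (hRα : 0 < Rα)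
    (x y : Plane) :
    Meets (germ α R₀ Rα false x) (germ α R₀ Rα true y) ↔ dist x y ≤ 1 / 2 := by
  have hinj := frame_injective hα₀ hαπ hR₀ hRα
  rw [Prod.dist_eq, max_le_iff, Real.dist_eq, Real.dist_eq, abs_le, abs_le]
  constructor
  · rintro ⟨z, h1, h2⟩
    obtain ⟨u, ⟨hu, hu'⟩, rfl⟩ := (mem_stick_false hR₀ x z).1 h1
    obtain ⟨v, ⟨hv, hv'⟩, h⟩ := (mem_stick_true hRα y _).1 h2
    have h := hinj h
    rw [Prod.ext_iff] at h
    simp only [Prod.fst_add, Prod.snd_add, add_zero] at h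
    exact ⟨⟨by linarith, by linarith⟩, by linarith, by linarith⟩
  · rintro ⟨⟨h1, h2⟩, h3, h4⟩
    refine ⟨_, (mem_stick_false hR₀ x _).2 ⟨y.1 - x.1, ⟨by linarith, by linarith⟩, rfl⟩,
      (mem_stick_true hRα y _).2 ⟨x.2 - y.2, ⟨by linarith, by linarith⟩, ?_⟩⟩
    congr 1
    ext <;> simp

lemma meets_of_ne (hα₀ : 0 < α) (hαπ : α < Real.pi) (hR₀ : 0 < R₀) (hRα : 0 < Rα)
    {b c : Bool} (hbc : b ≠ c) (x y : Plane) :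
    Meets (germ α R₀ Rα b x) (germ α R₀ Rα c y) ↔ dist x y ≤ 1 / 2 := by
  cases b <;> cases c
  · exact absurd rfl hbc
  · exact meets_false_true hα₀ hαπ hR₀ hRα x y
  · rw [dist_comm, ← meets_false_true hα₀ hαπ hR₀ hRα y x]
    exact ⟨Meets.symm, Meets.symm⟩
  · exact absurd rfl hbc

/-- The coordinate that two intersecting sticks of kind `b` have in common. -/
def transverse (b : Bool) (x : Plane) : ℝ := if b then x.1 else x.2

lemma Meets.same_kind (hα₀ : 0 < α) (hαπ : α < Real.pi) (hR₀ : 0 < R₀) (hRα : 0 < Rα)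
    {b : Bool} {x y : Plane} (h : Meets (germ α R₀ Rα b x) (germ α R₀ Rα b y)) :
    transverse b x = transverse b y ∧ dist x y ≤ 1 := by
  have hinj := frame_injective hα₀ hαπ hR₀ hRα
  obtain ⟨z, h1, h2⟩ := h
  rw [Prod.dist_eq, max_le_iff, Real.dist_eq, Real.dist_eq, abs_le, abs_le]
  cases b
  · obtain ⟨u, ⟨hu, hu'⟩, rfl⟩ := (mem_stick_false hR₀ x z).1 h1
    obtain ⟨v, ⟨hv, hv'⟩, h⟩ := (mem_stick_false hR₀ y _).1 h2
    have h := hinj h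
    rw [Prod.ext_iff] at h
    simp only [Prod.fst_add, Prod.snd_add, add_zero] at h
    exact ⟨h.2, ⟨by linarith, by linarith⟩, by linarith, by linarith⟩
  · obtain ⟨u, ⟨hu, hu'⟩, rfl⟩ := (mem_stick_true hRα x z).1 h1
    obtain ⟨v, ⟨hv, hv'⟩, h⟩ := (mem_stick_true hRα y _).1 h2
    have h := hinj h
    rw [Prod.ext_iff] at h
    simp only [Prod.fst_add, Prod.snd_add, add_zero] at h
    exact ⟨h.1, ⟨by linarith, by linarith⟩, by linarith, by linarith⟩

lemma Meets.dist_le (hα₀ : 0 < α) (hαπ : α < Real.pi) (hR₀ : 0 < R₀) (hRα : 0 < Rα)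
    {b c : Bool} {x y : Plane} (h : Meets (germ α R₀ Rα b x) (germ α R₀ Rα c y)) :
    dist x y ≤ 1 := by
  by_cases hbc : b = c
  · subst hbc
    exact (h.same_kind hα₀ hαπ hR₀ hRα).2
  · exact ((meets_of_ne hα₀ hαπ hR₀ hRα hbc x y).1 h).trans (by norm_num)

lemma meets_germ_add (b c : Bool) (x y z : Plane) :
    Meets (germ α R₀ Rα b (x + z)) (germ α R₀ Rα c (y + z)) ↔
      Meets (germ α R₀ Rα b x) (germ α R₀ Rα c y) := by
  have h : ∀ b x, germ α R₀ Rα b (x + z) = shift (frame α R₀ Rα z) (germ α R₀ Rα b x) :=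
    fun b x => by simp [germ, shift]
  rw [h, h, meets_shift]

lemma volume_transverse (b : Bool) (a : ℝ) : volume {x : Plane | transverse b x = a} = 0 := by
  have h1 : {x : Plane | transverse true x = a} = {a} ×ˢ univ := by
    ext x
    simp [transverse]
  have h2 : {x : Plane | transverse false x = a} = univ ×ˢ {a} := by
    ext x
    simp [transverse]
  cases b
  · rw [h2, Measure.volume_eq_prod, Measure.prod_prod]
    simp
  · rw [h1, Measure.volume_eq_prod, Measure.prod_prod]
    simp

/-- Writing positions on a stick as `c * r` with `c ∈ [-1, 1]` makes the parameter space compact and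
independent of the germs, so projecting the closed incidence relation keeps it closed. -/
lemma isClosed_meets_nonneg : IsClosed {z : Germ × Germ | 0 ≤ z.1.2.2 ∧ 0 ≤ z.2.2.2 ∧
    Meets z.1 z.2} := by
  have h1 : IsClosed {z : (Germ × Germ) × (Icc (-1 : ℝ) 1 × Icc (-1 : ℝ) 1) |
      0 ≤ z.1.1.2.2 ∧ 0 ≤ z.1.2.2.2 ∧
      z.1.1.1 + ((z.2.1 : ℝ) * z.1.1.2.2) • unitVec z.1.1.2.1 =
        z.1.2.1 + ((z.2.2 : ℝ) * z.1.2.2.2) • unitVec z.1.2.2.1} := by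
    have hu : Continuous unitVec := by
      unfold unitVec
      fun_prop
    have c1 : IsClosed {z : (Germ × Germ) × (Icc (-1 : ℝ) 1 × Icc (-1 : ℝ) 1) |
        0 ≤ z.1.1.2.2} := isClosed_le continuous_const (by fun_prop)
    have c2 : IsClosed {z : (Germ × Germ) × (Icc (-1 : ℝ) 1 × Icc (-1 : ℝ) 1) |
        0 ≤ z.1.2.2.2} := isClosed_le continuous_const (by fun_prop)
    have c3 : IsClosed {z : (Germ × Germ) × (Icc (-1 : ℝ) 1 × Icc (-1 : ℝ) 1) |
        z.1.1.1 + ((z.2.1 : ℝ) * z.1.1.2.2) • unitVec z.1.1.2.1 =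
          z.1.2.1 + ((z.2.2 : ℝ) * z.1.2.2.2) • unitVec z.1.2.2.1} :=
      isClosed_eq (by fun_prop) (by fun_prop)
    exact c1.inter (c2.inter c3)
  have h2 := isClosedMap_fst_of_compactSpace _ h1
  convert h2 using 1
  ext ⟨⟨x, θ, r⟩, ⟨x', θ', r'⟩⟩
  have aux : ∀ s u : ℝ, u ∈ Icc (-s) s → ∃ c ∈ Icc (-1 : ℝ) 1, c * s = u := by
    rintro s u ⟨h, h'⟩
    rcases (show 0 ≤ s by linarith).eq_or_lt with h0 | h0
    · subst h0
      exact ⟨0, by simp, by linarith⟩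
    · exact ⟨u / s, ⟨by rw [le_div_iff₀ h0]; linarith, by rw [div_le_iff₀ h0]; linarith⟩,
        div_mul_cancel₀ _ h0.ne'⟩
  constructor
  · rintro ⟨hr, hr', y, ⟨u, hu, rfl⟩, v, hv, h⟩
    obtain ⟨c, hc, rfl⟩ := aux _ _ hu
    obtain ⟨d, hd, rfl⟩ := aux _ _ hv
    exact ⟨((_, _), ⟨c, hc⟩, ⟨d, hd⟩), ⟨hr, hr', h⟩, rfl⟩
  · rintro ⟨⟨_, ⟨c, hc, hc'⟩, d, hd, hd'⟩, ⟨hr, hr', h⟩, rfl⟩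
    simp only at hr hr' h
    exact ⟨hr, hr', _, ⟨c * r, ⟨by nlinarith, by nlinarith⟩, rfl⟩, d * r',
      ⟨by nlinarith, by nlinarith⟩, h⟩

/-- A stick of negative half-length is empty, so the sign conditions of `isClosed_meets_nonneg` are
automatic. -/
lemma measurableSet_meets : MeasurableSet {z : Germ × Germ | Meets z.1 z.2} := by
  convert isClosed_meets_nonneg.measurableSet using 1
  ext z
  refine ⟨fun h => ?_, fun h => h.2.2⟩
  obtain ⟨y, ⟨u, ⟨hu, hu'⟩, -⟩, v, ⟨hv, hv'⟩, -⟩ := id h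
  exact ⟨by linarith, by linarith, h⟩

/-- Linkedness depends only on the incidence relation, one of finitely many on `Fin n`. -/
lemma measurableSet_linked (n : ℕ) : MeasurableSet {w : Fin n → Germ | Linked w} := by
  have h : {w : Fin n → Germ | Linked w} =
      ⋃ R : {R : Fin n → Fin n → Prop // ∀ i j, Relation.ReflTransGen R i j},
        ⋂ (i : Fin n) (j : Fin n), {w : Fin n → Germ | Meets (w i) (w j) ↔ R.1 i j} := by
    ext w
    simp only [mem_ofPred_eq, mem_iUnion, mem_iInter]
    constructor
    · intro h
      exact ⟨⟨fun i j => Meets (w i) (w j), h⟩, fun i j => Iff.rfl⟩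
    · rintro ⟨⟨R, hR⟩, h⟩ i j
      have : (fun i j => Meets (w i) (w j)) = R := by
        funext i j
        exact propext (h i j)
      rw [this]
      exact hR i j
  rw [h]
  refine MeasurableSet.iUnion fun R => MeasurableSet.iInter fun i =>
    MeasurableSet.iInter fun j => ?_
  have hm : MeasurableSet {w : Fin n → Germ | Meets (w i) (w j)} :=
    measurableSet_meets.preimage (f := fun w : Fin n → Germ => (w i, w j)) (by fun_prop)
  by_cases hR : R.1 i j
  · simpa [hR] using hm
  · simp only [hR, iff_false]
    exact hm.compl

/-- The germs whose stick meets one of the sticks of `w`. -/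
def hitting {n : ℕ} (w : Fin n → Germ) : Set Germ := {v | ∃ i, Meets (w i) v}

lemma measurableSet_hitting' (n : ℕ) :
    MeasurableSet {z : (Fin n → Germ) × Germ | z.2 ∈ hitting z.1} := by
  have : {z : (Fin n → Germ) × Germ | z.2 ∈ hitting z.1} =
      ⋃ i, {z : (Fin n → Germ) × Germ | Meets (z.1 i) z.2} := by
    ext z
    simp [hitting]
  rw [this]
  exact MeasurableSet.iUnion fun i =>
    measurableSet_meets.preimage (f := fun z : (Fin n → Germ) × Germ => (z.1 i, z.2)) (by fun_prop)

lemma measurableSet_hitting {n : ℕ} (w : Fin n → Germ) : MeasurableSet (hitting w) :=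
  (measurableSet_hitting' n).preimage measurable_prodMk_left

/-- The event is the zero set of the number of points of the configuration that hit the tuple, which
is jointly measurable by `measurable_tsum_diff`. -/
lemma measurableSet_avoid_hitting (n : ℕ) :
    MeasurableSet {z : (Fin n → Germ) × Config | ∀ v ∈ z.2.1, ∀ i, ¬ Meets (z.1 i) v} := by
  have h := measurable_tsum_diff (P := Fin n → Germ)
    (f := fun w v _ => (hitting w).indicator 1 v) (by
      have := (measurable_one (α := ℝ≥0∞)).indicator (measurableSet_hitting' n)
      exact this.comp (g := {z : (Fin n → Germ) × Germ | z.2 ∈ hitting z.1}.indicator 1)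
        (f := fun z : (Fin n → Germ) × Germ × Config => (z.1, z.2.1)) (by fun_prop))
  convert h (measurableSet_singleton 0) using 1
  ext ⟨w, η⟩
  simp only [mem_ofPred_eq, mem_preimage, mem_singleton_iff, ENNReal.tsum_eq_zero, Subtype.forall]
  refine forall₂_congr fun v hv => ?_
  rw [indicator_apply_eq_zero]
  simp [hitting]

lemma measurable_clusterWeight (n : ℕ) {U : Set Plane} (hU : MeasurableSet U) :
    Measurable fun z : (Fin n → Germ) × Config => clusterWeight U z.1 z.2 := by
  unfold clusterWeight
  refine Measurable.mul (Measurable.mul ?_ ?_) ?_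
  · refine Finset.measurable_sum _ fun i _ => ?_
    exact (measurable_one.indicator hU).comp
      (by fun_prop : Measurable fun z : (Fin n → Germ) × Config => (z.1 i).1)
  · exact (measurable_one.indicator (measurableSet_linked n)).comp measurable_fst
  · exact measurable_one.indicator (measurableSet_avoid_hitting n)

end Geometry

/-! ### The intensity of clusters -/

/-- The union of the unit squares centred at the points of kind `b`. -/
def cover {n : ℕ} (τ : Fin n → Bool) (b : Bool) (x : Fin n → Plane) : Set Plane :=
  {y | ∃ i, τ i = b ∧ dist (x i) y ≤ 1 / 2}

/-- The proportion of the sticks of kind `b`. -/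
def proportion (p q : ℝ) (b : Bool) : ℝ := if b then q else p

/-- The density, in coordinates, of the event that the sticks of kinds `τ` with centres `x` form
a cluster. -/
def clusterDensity (α R₀ Rα p q : ℝ) {n : ℕ} (τ : Fin n → Bool) (s : ℝ) (x : Fin n → Plane) :
    ℝ≥0∞ :=
  {x : Fin n → Plane | Linked fun i => germ α R₀ Rα (τ i) (x i)}.indicator 1 x *
    ENNReal.ofReal (Real.exp (-(s * (p * volume.real (cover τ true x) +
      q * volume.real (cover τ false x)))))

/-- The number of sticks centred in `U` whose clusters are of type `(k, ℓ)`. -/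
def clusterCount (α : ℝ) (k ℓ : ℕ) (U : Set Plane) (ξ : Config) : ℝ≥0∞ :=
  ∑' w : {w : Germ // w ∈ ξ.1 ∧ w.1 ∈ U},
    (clusterEvent α k ℓ).indicator (fun _ => (1 : ℝ≥0∞)) (ξ.recentre w.1.1)

lemma measurable_clusterCount {α : ℝ} (hα : α ≠ 0) (k ℓ : ℕ) {U : Set Plane}
    (hU : MeasurableSet U) : Measurable (clusterCount α k ℓ U) := by
  have h : clusterCount α k ℓ U = fun ξ => ((k ! * ℓ ! : ℕ) : ℝ≥0∞)⁻¹ *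
      tupleSum (fun i => angle α (kind k ℓ i)) (clusterWeight U) ξ := by
    funext ξ
    rw [tupleSum_clusterWeight hα, ← mul_assoc, ENNReal.inv_mul_cancel, one_mul, clusterCount]
    · exact_mod_cast (Nat.mul_pos (Nat.factorial_pos _) (Nat.factorial_pos _)).ne'
    · exact ENNReal.natCast_ne_top _
  rw [h]
  refine Measurable.const_mul ?_ _
  exact (measurable_tupleSum (P := Unit) (F := fun _ => clusterWeight U) _
    ((measurable_clusterWeight _ hU).comp measurable_snd)).comp
    (measurable_prodMk_left (x := ()))

lemma volume_unitSquare : volume unitSquare = 1 := by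
  rw [unitSquare, Measure.volume_eq_prod, Measure.prod_prod, Real.volume_Ico]
  norm_num

lemma measurableSet_unitSquare : MeasurableSet unitSquare :=
  measurableSet_Ico.prod measurableSet_Ico

section Intensity

variable {α R₀ Rα p q t : ℝ}

lemma lintegral_rho {g : Germ → ℝ≥0∞} (hg : Measurable g) :
    ∫⁻ w, g w ∂(ENNReal.ofReal t • rho p q α R₀ Rα) = ENNReal.ofReal t *
      (ENNReal.ofReal p * (∫⁻ x, g (x, 0, R₀)) + ENNReal.ofReal q * ∫⁻ x, g (x, α, Rα)) := by
  have h1 : Measurable fun x : Plane => g (x, 0, R₀) := hg.comp (by fun_prop)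
  have h2 : Measurable fun x : Plane => g (x, α, Rα) := hg.comp (by fun_prop)
  rw [lintegral_smul_measure, rho, lintegral_prod _ hg.aemeasurable, smul_eq_mul]
  congr 1
  have h3 : ∀ x : Plane, ∫⁻ y, g (x, y) ∂(ENNReal.ofReal p • Measure.dirac ((0, R₀) : ℝ × ℝ) +
      ENNReal.ofReal q • Measure.dirac ((α, Rα) : ℝ × ℝ)) =
      ENNReal.ofReal p * g (x, 0, R₀) + ENNReal.ofReal q * g (x, α, Rα) := fun x => by
    rw [lintegral_add_measure, lintegral_smul_measure, lintegral_smul_measure,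
      lintegral_dirac, lintegral_dirac, smul_eq_mul, smul_eq_mul]
  simp_rw [h3]
  rw [lintegral_add_left (h1.const_mul _), lintegral_const_mul _ h1, lintegral_const_mul _ h2]

lemma rho_apply {S : Set Germ} (hS : MeasurableSet S) :
    (ENNReal.ofReal t • rho p q α R₀ Rα) S = ENNReal.ofReal t *
      (ENNReal.ofReal p * volume {x : Plane | (x, 0, R₀) ∈ S} +
        ENNReal.ofReal q * volume {x : Plane | (x, α, Rα) ∈ S}) := by
  have e : ∀ θ r : ℝ, ∫⁻ x : Plane, S.indicator 1 (x, θ, r) = volume {x : Plane | (x, θ, r) ∈ S} :=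
    fun θ r => lintegral_indicator_one
      (hS.preimage (by fun_prop : Measurable fun x : Plane => (x, θ, r)))
  rw [← lintegral_indicator_one hS, lintegral_rho (measurable_one.indicator hS), e, e]

lemma rho_window_ne_top (n : ℕ) : (ENNReal.ofReal t • rho p q α R₀ Rα) (window n) ≠ ∞ := by
  have h : volume {x : Plane | ‖x‖ ≤ n} ≠ ∞ := by
    have : {x : Plane | ‖x‖ ≤ n} = Metric.closedBall 0 n := by
      ext
      simp
    rw [this]
    exact measure_closedBall_lt_top.ne
  rw [rho_apply (measurableSet_window n)]
  exact ENNReal.mul_ne_top ENNReal.ofReal_ne_top (ENNReal.add_ne_top.2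
    ⟨ENNReal.mul_ne_top ENNReal.ofReal_ne_top h, ENNReal.mul_ne_top ENNReal.ofReal_ne_top h⟩)

/-- The Mecke formula for one kind of stick, written in coordinates; this is the hypothesis `hM` of
`lintegral_tupleSum`. -/
lemma lintegral_tsum_angle (hα₀ : 0 < α) (hαπ : α < Real.pi) (hR₀ : 0 < R₀) (hRα : 0 < Rα)
    (ht : 0 < t) {μ : Measure Config}
    (hμ : IsPoissonProcess μ (ENNReal.ofReal t • rho p q α R₀ Rα)) (b : Bool)
    (f : Germ → Config → ℝ≥0∞) (hf : Measurable fun z : Germ × Config => f z.1 z.2) :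
    ∫⁻ ξ : Config, ∑' v : ξ.1, {v : Germ | v.2.1 = angle α b}.indicator
        (fun v => f v (ξ.diff {v})) v.1 ∂μ =
      ENNReal.ofReal (t * volume.real (parallelogram 0 α R₀ Rα) * proportion p q b) *
        ∫⁻ x, ∫⁻ ξ, f (germ α R₀ Rα b x) ξ ∂μ := by
  have := hμ.isProbabilityMeasure
  set β := volume.real (parallelogram 0 α R₀ Rα) with hβ
  have hβ0 : 0 ≤ β := measureReal_nonneg
  have h1 := hμ.lintegral_tsum_diff rho_window_ne_top
    (f := fun v η => {v : Germ | v.2.1 = angle α b}.indicator (fun v => f v η) v)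
    (hf.indicator ((measurableSet_angle (angle α b)).preimage measurable_fst))
  refine h1.trans ?_
  have hF : Measurable fun w => ∫⁻ ξ, f w ξ ∂μ := hf.lintegral_prod_right'
  have h2 : ∀ w, ∫⁻ ξ, {v : Germ | v.2.1 = angle α b}.indicator (fun v => f v ξ) w ∂μ =
      {v : Germ | v.2.1 = angle α b}.indicator (fun v => ∫⁻ ξ, f v ξ ∂μ) w := by
    intro w
    by_cases hw : w ∈ {v : Germ | v.2.1 = angle α b}
    · simp_rw [indicator_of_mem hw]
    · simp_rw [indicator_of_notMem hw, lintegral_zero]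
  simp_rw [h2]
  rw [lintegral_rho (hF.indicator (measurableSet_angle _)), ENNReal.ofReal_mul (by positivity),
    ENNReal.ofReal_mul ht.le]
  cases b
  · have hm : Measurable fun x : Plane => ∫⁻ ξ, f (x, 0, R₀) ξ ∂μ :=
      hF.comp (g := fun w => ∫⁻ ξ, f w ξ ∂μ) (by fun_prop)
    have e := lintegral_frame hα₀ hαπ hR₀ hRα hm
    simp only [angle, Bool.false_eq_true, if_false, indicator, mem_ofPred_eq, if_true, hα₀.ne',
      lintegral_zero, mul_zero, add_zero, e, proportion, germ, halfLength]
    ring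
  · have hm : Measurable fun x : Plane => ∫⁻ ξ, f (x, α, Rα) ξ ∂μ :=
      hF.comp (g := fun w => ∫⁻ ξ, f w ξ ∂μ) (by fun_prop)
    have e := lintegral_frame hα₀ hαπ hR₀ hRα hm
    simp only [angle, if_true, indicator, mem_ofPred_eq, hα₀.ne, if_false,
      lintegral_zero, mul_zero, zero_add, e, proportion, germ, halfLength]
    ring

lemma cover_subset_iUnion {n : ℕ} (τ : Fin n → Bool) (b : Bool) (x : Fin n → Plane) :
    cover τ b x ⊆ ⋃ i, Metric.closedBall (x i) (1 / 2) := by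
  rintro y ⟨i, -, hi⟩
  exact mem_iUnion.2 ⟨i, by rwa [Metric.mem_closedBall, dist_comm]⟩

lemma volume_cover_ne_top {n : ℕ} (τ : Fin n → Bool) (b : Bool) (x : Fin n → Plane) :
    volume (cover τ b x) ≠ ∞ := by
  refine measure_ne_top_of_subset (cover_subset_iUnion τ b x) ?_
  refine ((measure_iUnion_le _).trans_lt ?_).ne
  rw [tsum_fintype]
  exact ENNReal.sum_lt_top.2 fun i _ => measure_closedBall_lt_top

/-- A stick of kind `b` hits the opposite kind exactly when its centre is in the cover of that kind;
it hits its own kind only on finitely many lines, which are null. -/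
lemma volume_germ_mem_hitting (hα₀ : 0 < α) (hαπ : α < Real.pi) (hR₀ : 0 < R₀) (hRα : 0 < Rα)
    {n : ℕ} (τ : Fin n → Bool) (x : Fin n → Plane) (b : Bool) :
    volume {y | germ α R₀ Rα b y ∈ hitting fun i => germ α R₀ Rα (τ i) (x i)} =
      volume (cover τ (!b) x) := by
  apply le_antisymm
  · have hsub : {y | germ α R₀ Rα b y ∈ hitting fun i => germ α R₀ Rα (τ i) (x i)} ⊆
        cover τ (!b) x ∪ ⋃ i, {y | transverse b y = transverse b (x i)} := by
      rintro y ⟨i, hi⟩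
      by_cases hb : τ i = b
      · right
        simp only [hb] at hi
        exact mem_iUnion.2 ⟨i, (hi.same_kind hα₀ hαπ hR₀ hRα).1.symm⟩
      · left
        exact ⟨i, by cases b <;> simpa using hb, (meets_of_ne hα₀ hαπ hR₀ hRα hb _ _).1 hi⟩
    refine (measure_mono hsub).trans ((measure_union_le _ _).trans ?_)
    rw [measure_iUnion_null fun i => volume_transverse b _, add_zero]
  · refine measure_mono ?_
    rintro y ⟨i, hi, hd⟩
    exact ⟨i, (meets_of_ne hα₀ hαπ hR₀ hRα (by rw [hi]; simp) _ _).2 hd⟩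

lemma rho_hitting (hα₀ : 0 < α) (hαπ : α < Real.pi) (hR₀ : 0 < R₀) (hRα : 0 < Rα)
    (hp : 0 < p) (hq : 0 < q) (ht : 0 < t) {n : ℕ} (τ : Fin n → Bool) (x : Fin n → Plane) :
    (ENNReal.ofReal t • rho p q α R₀ Rα) (hitting fun i => germ α R₀ Rα (τ i) (x i)) =
      ENNReal.ofReal (t * volume.real (parallelogram 0 α R₀ Rα) *
        (p * volume.real (cover τ true x) + q * volume.real (cover τ false x))) := by
  set S := hitting fun i => germ α R₀ Rα (τ i) (x i) with hS
  have hSm : MeasurableSet S := measurableSet_hitting _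
  have hβ0 : 0 ≤ volume.real (parallelogram 0 α R₀ Rα) := measureReal_nonneg
  have h : ∀ b, volume {y : Plane | (y, angle α b, halfLength R₀ Rα b) ∈ S} =
      ENNReal.ofReal (volume.real (parallelogram 0 α R₀ Rα) * volume.real (cover τ (!b) x)) := by
    intro b
    have hm : MeasurableSet {y : Plane | (y, angle α b, halfLength R₀ Rα b) ∈ S} :=
      hSm.preimage (by fun_prop)
    rw [← lintegral_indicator_one hm, lintegral_frame hα₀ hαπ hR₀ hRα
      (measurable_one.indicator hm), ENNReal.ofReal_mul hβ0,
      ofReal_measureReal (volume_cover_ne_top _ _ _),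
      ← volume_germ_mem_hitting hα₀ hαπ hR₀ hRα τ x b]
    congr 1
    exact lintegral_indicator_one (hSm.preimage (measurable_germ b))
  have hf := h false
  have ht' := h true
  simp only [angle, halfLength, Bool.false_eq_true, if_false, if_true, Bool.not_false,
    Bool.not_true] at hf ht'
  rw [rho_apply hSm, hf, ht', ← ENNReal.ofReal_mul hp.le, ← ENNReal.ofReal_mul hq.le,
    ← ENNReal.ofReal_add (by positivity) (by positivity), ← ENNReal.ofReal_mul ht.le]
  congr 1
  ring

lemma lintegral_clusterWeight (hα₀ : 0 < α) (hαπ : α < Real.pi) (hR₀ : 0 < R₀) (hRα : 0 < Rα)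
    (hp : 0 < p) (hq : 0 < q) (ht : 0 < t) {μ : Measure Config}
    (hμ : IsPoissonProcess μ (ENNReal.ofReal t • rho p q α R₀ Rα)) {n : ℕ} (τ : Fin n → Bool)
    (U : Set Plane) (x : Fin n → Plane) :
    ∫⁻ ξ, clusterWeight U (fun i => germ α R₀ Rα (τ i) (x i)) ξ ∂μ =
      (∑ i, (frame α R₀ Rα ⁻¹' U).indicator 1 (x i)) * clusterDensity α R₀ Rα p q τ
        (t * volume.real (parallelogram 0 α R₀ Rα)) x := by
  set w : Fin n → Germ := fun i => germ α R₀ Rα (τ i) (x i) with hw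
  have hβ0 : 0 ≤ volume.real (parallelogram 0 α R₀ Rα) := measureReal_nonneg
  have hset : ∀ ξ : Config, {z : (Fin n → Germ) × Config |
      ∀ v ∈ z.2.1, ∀ i, ¬ Meets (z.1 i) v}.indicator (1 : (Fin n → Germ) × Config → ℝ≥0∞) (w, ξ) =
      (avoid (hitting w)).indicator 1 ξ := by
    intro ξ
    have : (w, ξ) ∈ {z : (Fin n → Germ) × Config | ∀ v ∈ z.2.1, ∀ i, ¬ Meets (z.1 i) v} ↔
        ξ ∈ avoid (hitting w) := by
      rw [avoid, mem_ofPred_eq, mem_ofPred_eq, Set.eq_empty_iff_forall_notMem]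
      simp only [hitting, mem_inter_iff, mem_ofPred_eq, not_and, not_exists]
    by_cases h : ξ ∈ avoid (hitting w)
    · rw [indicator_of_mem h, indicator_of_mem (this.2 h)]
      rfl
    · rw [indicator_of_notMem h, indicator_of_notMem (fun h' => h (this.1 h'))]
  simp_rw [clusterWeight, hset]
  rw [lintegral_const_mul _ (measurable_one.indicator (measurableSet_avoid
    (measurableSet_hitting w))), lintegral_indicator_one (measurableSet_avoid
    (measurableSet_hitting w)), hμ.measure_avoid (measurableSet_hitting w), rho_hitting hα₀ hαπ hR₀
    hRα hp hq ht, ENNReal.toReal_ofReal, clusterDensity, mul_assoc]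
  · rfl
  · positivity
  · rw [rho_hitting hα₀ hαπ hR₀ hRα hp hq ht]
    exact ENNReal.ofReal_ne_top

/-- Each cluster is listed `k ! * ℓ !` times. The Mecke formula makes the listed sticks
deterministic and leaves the void probability of the germs hitting them, which is the exponential in
`clusterDensity`. -/
theorem lintegral_clusterCount (hα₀ : 0 < α) (hαπ : α < Real.pi) (hR₀ : 0 < R₀) (hRα : 0 < Rα)
    (hp : 0 < p) (hq : 0 < q) (ht : 0 < t) {μ : Measure Config}
    (hμ : IsPoissonProcess μ (ENNReal.ofReal t • rho p q α R₀ Rα)) (k ℓ : ℕ) :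
    (k ! * ℓ ! : ℕ) * ∫⁻ ξ, clusterCount α k ℓ unitSquare ξ ∂μ =
      ENNReal.ofReal (t * volume.real (parallelogram 0 α R₀ Rα) * p) ^ k *
      ENNReal.ofReal (t * volume.real (parallelogram 0 α R₀ Rα) * q) ^ ℓ *
      ∫⁻ x, (∑ i, (frame α R₀ Rα ⁻¹' unitSquare).indicator 1 (x i)) *
        clusterDensity α R₀ Rα p q (kind k ℓ) (t * volume.real (parallelogram 0 α R₀ Rα)) x := by
  have := hμ.isProbabilityMeasure
  have h := lintegral_tupleSum (angle α) (germ α R₀ Rα) _ (fun b => measurable_germ b)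
    (lintegral_tsum_angle hα₀ hαπ hR₀ hRα ht hμ) (kind k ℓ)
    (measurable_clusterWeight (k + ℓ) measurableSet_unitSquare)
  simp_rw [tupleSum_clusterWeight hα₀.ne',
    lintegral_clusterWeight hα₀ hαπ hR₀ hRα hp hq ht hμ] at h
  rw [lintegral_const_mul' _ _ (ENNReal.natCast_ne_top _)] at h
  refine h.trans ?_
  rw [Fin.prod_univ_add]
  simp [proportion]

lemma lintegral_card_unitSquare (hp : 0 < p) (hq : 0 < q) (hpq : p + q = 1)
    {μ : Measure Config}
    (hμ : IsPoissonProcess μ (ENNReal.ofReal t • rho p q α R₀ Rα)) :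
    ∫⁻ ξ : Config, ∑' _ : {w : Germ // w ∈ ξ.1 ∧ w.1 ∈ unitSquare}, (1 : ℝ≥0∞) ∂μ =
      ENNReal.ofReal t := by
  have hm : MeasurableSet {w : Germ | w.1 ∈ unitSquare} :=
    measurableSet_unitSquare.preimage measurable_fst
  have hsub : {w : Germ | w.1 ∈ unitSquare} ⊆ window 1 := by
    rintro w ⟨⟨h1, h2⟩, h3, h4⟩
    simp only [window, mem_ofPred_eq, Nat.cast_one, Prod.norm_def, max_le_iff, Real.norm_eq_abs,
      abs_le]
    exact ⟨⟨by linarith, h2.le⟩, by linarith, h4.le⟩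
  have h := hμ.lintegral_count hm (measure_ne_top_of_subset hsub (rho_window_ne_top 1)) hsub
  rw [rho_apply hm] at h
  have hU : volume {x : Plane | x ∈ unitSquare} = 1 := volume_unitSquare
  simp only [mem_ofPred_eq, hU, mul_one] at h
  rw [← ENNReal.ofReal_add hp.le hq.le, hpq, ENNReal.ofReal_one, mul_one] at h
  rw [← h]
  exact lintegral_congr fun ξ => ENNReal.tsum_set_one {w : Germ | w ∈ ξ.1 ∧ w.1 ∈ unitSquare}

end Intensity

/-! ### Exponential integrals of coordinate ranges -/

section Range

/-- The range of a finite family of real numbers. -/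
def spread {n : ℕ} (x : Fin n → ℝ) : ℝ := (⨆ i, x i) - ⨅ i, x i

lemma le_iSup_fin {n : ℕ} (x : Fin n → ℝ) (i : Fin n) : x i ≤ ⨆ i, x i :=
  le_ciSup (Set.finite_range x).bddAbove i

lemma iInf_fin_le {n : ℕ} (x : Fin n → ℝ) (i : Fin n) : ⨅ i, x i ≤ x i :=
  ciInf_le (Set.finite_range x).bddBelow i

lemma spread_nonneg {n : ℕ} (x : Fin (n + 1) → ℝ) : 0 ≤ spread x :=
  sub_nonneg.2 ((iInf_fin_le x 0).trans (le_iSup_fin x 0))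

lemma spread_smul {n : ℕ} {c : ℝ} (hc : 0 ≤ c) (x : Fin n → ℝ) :
    spread (fun i => c * x i) = c * spread x := by
  rw [spread, spread, ← Real.mul_iSup_of_nonneg hc, ← Real.mul_iInf_of_nonneg hc, mul_sub]

lemma measurable_spread (n : ℕ) : Measurable (spread : (Fin n → ℝ) → ℝ) :=
  (Measurable.iSup fun i => measurable_pi_apply i).sub
    (Measurable.iInf fun i => measurable_pi_apply i)

/-- Up to a constant the integrand is the gamma density of shape `n + 2` and rate `c`. -/
lemma lintegral_exp_mul_pow {c : ℝ} (hc : 0 < c) (n : ℕ) :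
    ∫⁻ r, ENNReal.ofReal (c ^ 2 * Real.exp (-(c * r))) * ENNReal.ofReal r ^ (n + 1) =
      ENNReal.ofReal ((n + 1)! / c ^ n) := by
  have h := lintegral_gammaPDF_eq_one (a := (n : ℝ) + 2) (r := c) (by positivity) hc
  have hG : Real.Gamma ((n : ℝ) + 2) = (n + 1)! := by
    rw [← Real.Gamma_nat_eq_factorial]
    congr 1
    push_cast
    ring
  have hfac : (0 : ℝ) < (n + 1)! := by positivity
  have hp : ∀ r, ENNReal.ofReal (c ^ 2 * Real.exp (-(c * r))) * ENNReal.ofReal r ^ (n + 1) =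
      ENNReal.ofReal ((n + 1)! / c ^ n) * gammaPDF ((n : ℝ) + 2) c r := by
    intro r
    rcases lt_or_ge r 0 with hr | hr
    · rw [gammaPDF_of_neg hr, ENNReal.ofReal_of_nonpos hr.le]
      simp
    · rw [gammaPDF_of_nonneg hr, hG, ← ENNReal.ofReal_pow hr, ← ENNReal.ofReal_mul (by positivity),
        ← ENNReal.ofReal_mul (by positivity)]
      congr 1
      have e1 : (n : ℝ) + 2 - 1 = ((n + 1 : ℕ) : ℝ) := by
        push_cast
        ring
      have e2 : (n : ℝ) + 2 = ((n + 2 : ℕ) : ℝ) := by push_cast; rfl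
      rw [e1, e2, Real.rpow_natCast, Real.rpow_natCast]
      field_simp
      ring
  simp_rw [hp]
  rw [lintegral_const_mul' _ _ ENNReal.ofReal_ne_top, h, mul_one]

lemma volume_enclosing {n : ℕ} (x : Fin (n + 1) → ℝ) (r : ℝ) :
    volume {a | ∀ i, x i ∈ Icc a (a + r)} = ENNReal.ofReal (r - spread x) := by
  have : {a | ∀ i, x i ∈ Icc a (a + r)} = Icc ((⨆ i, x i) - r) (⨅ i, x i) := by
    ext a
    constructor
    · intro h
      exact ⟨by linarith [ciSup_le fun i => (h i).2], le_ciInf fun i => (h i).1⟩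
    · rintro ⟨h1, h2⟩ i
      exact ⟨h2.trans (iInf_fin_le x i), by linarith [le_iSup_fin x i]⟩
  rw [this, Real.volume_Icc, spread]
  congr 1
  ring

/-- An interval of length `r` encloses the points for a set of left ends of length `(r - spread
x)⁺`, and `∫ c² e^(-cr) (r - d)⁺ dr = e^(-cd)` for `d ≥ 0`. This replaces the range by a condition
on each point separately. -/
lemma ofReal_exp_spread {c : ℝ} (hc : 0 < c) {n : ℕ} (x : Fin (n + 1) → ℝ) :
    ENNReal.ofReal (Real.exp (-(c * spread x))) =
      ∫⁻ r, ENNReal.ofReal (c ^ 2 * Real.exp (-(c * r))) *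
        volume {a | ∀ i, x i ∈ Icc a (a + r)} := by
  have h := lintegral_exp_mul_pow hc 0
  simp only [zero_add, pow_one, Nat.factorial_one, Nat.cast_one, pow_zero, div_one,
    ENNReal.ofReal_one] at h
  rw [← lintegral_sub_right_eq_self _ (spread x)] at h
  simp_rw [volume_enclosing]
  rw [← mul_one (ENNReal.ofReal (Real.exp _)), ← h,
    ← lintegral_const_mul' _ _ ENNReal.ofReal_ne_top]
  refine lintegral_congr fun r => ?_
  rw [← mul_assoc, ← ENNReal.ofReal_mul (Real.exp_nonneg _)]
  congr 2
  rw [mul_left_comm, ← Real.exp_add]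
  congr 2
  ring

/-- Integrate first over the points for a fixed enclosing interval `[a, a + r]`: the `n` free points
give `r ^ n`. The pinned point 0 forces `a ∈ [-r, 0]`, which gives one more `r`, and the gamma
integral remains. -/
lemma lintegral_exp_spread {c : ℝ} (hc : 0 < c) (n : ℕ) :
    ∫⁻ w : Fin n → ℝ, ENNReal.ofReal (Real.exp (-(c * spread (Fin.cons 0 w : Fin (n + 1) → ℝ)))) =
      ENNReal.ofReal ((n + 1)! / c ^ n) := by
  have hm : MeasurableSet {z : (Fin n → ℝ) × ℝ × ℝ |
      ∀ i, (Fin.cons 0 z.1 : Fin (n + 1) → ℝ) i ∈ Icc z.2.2 (z.2.2 + z.2.1)} := by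
    simp only [Fin.forall_fin_succ, Fin.cons_zero, Fin.cons_succ, mem_Icc]
    measurability
  set S := {z : (Fin n → ℝ) × ℝ × ℝ |
      ∀ i, (Fin.cons 0 z.1 : Fin (n + 1) → ℝ) i ∈ Icc z.2.2 (z.2.2 + z.2.1)} with hS
  have hc2 : Measurable fun r : ℝ => ENNReal.ofReal (c ^ 2 * Real.exp (-(c * r))) := by fun_prop
  have h1 : ∀ (w : Fin n → ℝ) (r : ℝ),
      volume {a | ∀ i, (Fin.cons 0 w : Fin (n + 1) → ℝ) i ∈ Icc a (a + r)} =
        ∫⁻ a, S.indicator 1 (w, r, a) := fun w r =>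
    (lintegral_indicator_one (hm.preimage (by fun_prop : Measurable fun a : ℝ => (w, r, a)))).symm
  have hind : Measurable (S.indicator (1 : (Fin n → ℝ) × ℝ × ℝ → ℝ≥0∞)) :=
    measurable_one.indicator hm
  simp_rw [ofReal_exp_spread hc, h1]
  rw [lintegral_lintegral_swap, ← lintegral_exp_mul_pow hc n]
  · refine lintegral_congr fun r => ?_
    rw [lintegral_const_mul', lintegral_lintegral_swap]
    · congr 1
      have h2 : ∀ a, ∫⁻ w : Fin n → ℝ, S.indicator 1 (w, r, a) =
          (Icc (-r) 0).indicator (fun _ => ENNReal.ofReal r ^ n) a := by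
        intro a
        have e : ∫⁻ w : Fin n → ℝ, S.indicator 1 (w, r, a) =
            volume {w : Fin n → ℝ | (w, r, a) ∈ S} :=
          lintegral_indicator_one
            (hm.preimage (by fun_prop : Measurable fun w : Fin n → ℝ => (w, r, a)))
        rw [e]
        by_cases ha : a ∈ Icc (-r) 0
        · rw [indicator_of_mem ha]
          have : {w : Fin n → ℝ | (w, r, a) ∈ S} = Set.pi univ fun _ => Icc a (a + r) := by
            ext w
            simp only [hS, mem_ofPred_eq, Fin.forall_fin_succ, Fin.cons_zero, Fin.cons_succ,
              mem_univ_pi]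
            refine ⟨fun h => h.2, fun h => ⟨⟨ha.2, by linarith [ha.1]⟩, h⟩⟩
          rw [this, volume_pi_pi]
          simp
        · rw [indicator_of_notMem ha]
          have : {w : Fin n → ℝ | (w, r, a) ∈ S} = ∅ := by
            refine subset_empty_iff.1 fun w hw => ha ?_
            have := hw 0
            simp only [Fin.cons_zero] at this
            exact ⟨by linarith [this.2], this.1⟩
          rw [this, measure_empty]
      simp_rw [h2]
      rw [lintegral_indicator_const measurableSet_Icc, Real.volume_Icc]
      rw [pow_succ]
      congr 2
      ring
    · exact (hind.comp (by fun_prop : Measurable fun z : (Fin n → ℝ) × ℝ =>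
        (z.1, r, z.2))).aemeasurable
    · exact ENNReal.ofReal_ne_top
  · refine Measurable.aemeasurable ?_
    refine Measurable.mul (hc2.comp measurable_snd) ?_
    exact Measurable.lintegral_prod_right' (f := fun z : ((Fin n → ℝ) × ℝ) × ℝ =>
      S.indicator 1 (z.1.1, z.1.2, z.2)) (hind.comp (by fun_prop))

/-- The sum of the ranges of the two coordinates of a family of points. -/
def extent {n : ℕ} (x : Fin n → Plane) : ℝ := spread (fun i => (x i).1) + spread fun i => (x i).2

lemma measurable_extent (n : ℕ) : Measurable (extent : (Fin n → Plane) → ℝ) :=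
  ((measurable_spread n).comp (by fun_prop)).add ((measurable_spread n).comp (by fun_prop))

lemma extent_smul {n : ℕ} {c : ℝ} (hc : 0 ≤ c) (x : Fin n → Plane) :
    extent (c • x) = c * extent x := by
  have h1 : (fun i => ((c • x) i).1) = fun i => c * (x i).1 := by
    funext i
    simp
  have h2 : (fun i => ((c • x) i).2) = fun i => c * (x i).2 := by
    funext i
    simp
  rw [extent, h1, h2, spread_smul hc, spread_smul hc, extent, mul_add]

/-- The exponential factorises over the two coordinates, hence the square. -/
lemma lintegral_exp_extent {c : ℝ} (hc : 0 < c) (n : ℕ) :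
    ∫⁻ w : Fin n → Plane,
      ENNReal.ofReal (Real.exp (-(c * extent (Fin.cons 0 w : Fin (n + 1) → Plane)))) =
      ENNReal.ofReal (((n + 1)! / c ^ n) ^ 2) := by
  have hcons : Measurable fun w : Fin n → ℝ => (Fin.cons 0 w : Fin (n + 1) → ℝ) :=
    measurable_cons.comp (measurable_prodMk_left (x := (0 : ℝ)))
  have hm : Measurable fun w : Fin n → ℝ =>
      ENNReal.ofReal (Real.exp (-(c * spread (Fin.cons 0 w : Fin (n + 1) → ℝ)))) :=
    (((measurable_spread _).comp hcons).const_mul c).neg.exp.ennreal_ofReal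
  have h := (volume_measurePreserving_arrowProdEquivProdArrow ℝ ℝ (Fin n)).lintegral_map_equiv
    (fun z : (Fin n → ℝ) × (Fin n → ℝ) =>
      ENNReal.ofReal (Real.exp (-(c * spread (Fin.cons 0 z.1 : Fin (n + 1) → ℝ)))) *
      ENNReal.ofReal (Real.exp (-(c * spread (Fin.cons 0 z.2 : Fin (n + 1) → ℝ))))) _
  rw [Measure.volume_eq_prod, lintegral_prod_mul hm.aemeasurable hm.aemeasurable,
    lintegral_exp_spread hc] at h
  rw [sq, ENNReal.ofReal_mul (by positivity), h]
  refine lintegral_congr fun w => ?_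
  rw [← ENNReal.ofReal_mul (Real.exp_nonneg _), ← Real.exp_add]
  congr 2
  have h1 : (fun i => ((Fin.cons 0 w : Fin (n + 1) → Plane) i).1) =
      Fin.cons 0 (MeasurableEquiv.arrowProdEquivProdArrow ℝ ℝ (Fin n) w).1 := by
    funext i
    refine Fin.cases ?_ (fun j => ?_) i <;>
      simp [MeasurableEquiv.arrowProdEquivProdArrow, Equiv.arrowProdEquivProdArrow]
  have h2 : (fun i => ((Fin.cons 0 w : Fin (n + 1) → Plane) i).2) =
      Fin.cons 0 (MeasurableEquiv.arrowProdEquivProdArrow ℝ ℝ (Fin n) w).2 := by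
    funext i
    refine Fin.cases ?_ (fun j => ?_) i <;>
      simp [MeasurableEquiv.arrowProdEquivProdArrow, Equiv.arrowProdEquivProdArrow]
  rw [extent, h1, h2]
  ring

end Range

/-! ### The area of a union of unit squares -/

/-- The union of the unit squares centred at the points of a family. -/
def blob {n : ℕ} (y : Fin n → Plane) : Set Plane := {z | ∃ i, dist (y i) z ≤ 1 / 2}

/-- The area of the union of the unit squares centred at the points of a family. -/
def area {n : ℕ} (y : Fin n → Plane) : ℝ := volume.real (blob y)

section Area

variable {n : ℕ}

lemma dist_le_half_iff (a z : Plane) :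
    dist a z ≤ 1 / 2 ↔ (a.1 - 1 / 2 ≤ z.1 ∧ z.1 ≤ a.1 + 1 / 2) ∧
      (a.2 - 1 / 2 ≤ z.2 ∧ z.2 ≤ a.2 + 1 / 2) := by
  rw [Prod.dist_eq, max_le_iff, Real.dist_eq, Real.dist_eq, abs_le, abs_le]
  constructor
  · rintro ⟨⟨h1, h2⟩, h3, h4⟩
    exact ⟨⟨by linarith, by linarith⟩, by linarith, by linarith⟩
  · rintro ⟨⟨h1, h2⟩, h3, h4⟩
    exact ⟨⟨by linarith, by linarith⟩, by linarith, by linarith⟩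

lemma volume_real_rectangle {s t : Set ℝ} :
    (volume : Measure Plane).real (s ×ˢ t) = volume.real s * volume.real t := by
  rw [Measure.volume_eq_prod, measureReal_prod_prod]

lemma volume_blob_ne_top (y : Fin n → Plane) : volume (blob y) ≠ ∞ := by
  have hsub : blob y ⊆ ⋃ i, Metric.closedBall (y i) (1 / 2) := by
    rintro z ⟨i, hi⟩
    exact mem_iUnion.2 ⟨i, by rwa [Metric.mem_closedBall, dist_comm]⟩
  refine measure_ne_top_of_subset hsub ((measure_iUnion_le _).trans_lt ?_).ne
  rw [tsum_fintype]
  exact ENNReal.sum_lt_top.2 fun i _ => measure_closedBall_lt_top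

lemma area_add (y : Fin n → Plane) (c : Plane) : area (fun i => y i + c) = area y := by
  have : blob y = (fun z => z + c) ⁻¹' blob fun i => y i + c := by
    ext z
    simp [blob]
  rw [area, area, measureReal_def, measureReal_def, this, measure_preimage_add_right]

lemma area_swap (y : Fin n → Plane) : area (fun i => (y i).swap) = area y := by
  have : blob y = Prod.swap ⁻¹' blob fun i => (y i).swap := by
    ext z
    simp [blob, Prod.dist_eq, max_comm]
  have hp : MeasurePreserving (MeasurableEquiv.prodComm : Plane ≃ᵐ Plane) volume volume :=
    Measure.measurePreserving_swap
  rw [area, area, measureReal_def, measureReal_def, this]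
  exact congrArg ENNReal.toReal (hp.measure_preimage_equiv _).symm

/-- The square at `y j` and the part of the square at `y i` lying to the right of it are disjoint;
the latter has height 1 and width `min 1` of the horizontal offset. -/
lemma one_add_min_le_area_aux (y : Fin n → Plane) (i j : Fin n) :
    1 + min 1 ((y i).1 - (y j).1) ≤ area y := by
  have hsq : (volume : Measure Plane).real (Icc ((y j).1 - 1 / 2) ((y j).1 + 1 / 2) ×ˢ
      Icc ((y j).2 - 1 / 2) ((y j).2 + 1 / 2)) = 1 := by
    rw [volume_real_rectangle, Real.volume_real_Icc_of_le (by linarith),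
      Real.volume_real_Icc_of_le (by linarith)]
    ring
  rcases le_or_gt ((y i).1 - (y j).1) 0 with hd | hd
  · have : (volume : Measure Plane).real (Icc ((y j).1 - 1 / 2) ((y j).1 + 1 / 2) ×ˢ
        Icc ((y j).2 - 1 / 2) ((y j).2 + 1 / 2)) ≤ area y := by
      refine measureReal_mono ?_ (volume_blob_ne_top y)
      rintro z ⟨h1, h2⟩
      exact ⟨j, (dist_le_half_iff _ _).2 ⟨h1, h2⟩⟩
    linarith [min_le_right 1 ((y i).1 - (y j).1)]
  · set m := max ((y j).1 + 1 / 2) ((y i).1 - 1 / 2) with hm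
    have hmle : m ≤ (y i).1 + 1 / 2 := max_le (by linarith) (by linarith)
    have hvol : (volume : Measure Plane).real (Ioc m ((y i).1 + 1 / 2) ×ˢ
        Icc ((y i).2 - 1 / 2) ((y i).2 + 1 / 2)) = min 1 ((y i).1 - (y j).1) := by
      rw [volume_real_rectangle, Real.volume_real_Ioc_of_le hmle,
        Real.volume_real_Icc_of_le (by linarith), hm, ← min_sub_sub_left]
      ring_nf
      rw [min_comm]
    have hdisj : Disjoint (Icc ((y j).1 - 1 / 2) ((y j).1 + 1 / 2) ×ˢ
        Icc ((y j).2 - 1 / 2) ((y j).2 + 1 / 2)) (Ioc m ((y i).1 + 1 / 2) ×ˢ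
        Icc ((y i).2 - 1 / 2) ((y i).2 + 1 / 2)) := by
      refine Set.disjoint_left.2 ?_
      rintro z ⟨⟨-, h1⟩, -⟩ ⟨⟨h2, -⟩, -⟩
      linarith [le_max_left ((y j).1 + 1 / 2) ((y i).1 - 1 / 2)]
    have hne : volume (blob y) ≠ ∞ := volume_blob_ne_top y
    have hsub1 : Icc ((y j).1 - 1 / 2) ((y j).1 + 1 / 2) ×ˢ
        Icc ((y j).2 - 1 / 2) ((y j).2 + 1 / 2) ⊆ blob y := by
      rintro z ⟨h1, h2⟩
      exact ⟨j, (dist_le_half_iff _ _).2 ⟨h1, h2⟩⟩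
    have hsub2 : Ioc m ((y i).1 + 1 / 2) ×ˢ
        Icc ((y i).2 - 1 / 2) ((y i).2 + 1 / 2) ⊆ blob y := by
      rintro z ⟨⟨h1, h1'⟩, h2⟩
      exact ⟨i, (dist_le_half_iff _ _).2 ⟨⟨by
        linarith [le_max_right ((y j).1 + 1 / 2) ((y i).1 - 1 / 2)], h1'⟩, h2⟩⟩
    have h := measureReal_union (μ := (volume : Measure Plane)) hdisj
      (measurableSet_Ioc.prod measurableSet_Icc) (measure_ne_top_of_subset hsub1 hne)
      (measure_ne_top_of_subset hsub2 hne)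
    rw [hsq, hvol] at h
    rw [← h]
    exact measureReal_mono (union_subset hsub1 hsub2) hne

lemma one_add_min_dist_le_area (y : Fin n → Plane) (i j : Fin n) :
    1 + min 1 (dist (y i) (y j)) ≤ area y := by
  have h1 := one_add_min_le_area_aux y i j
  have h2 := one_add_min_le_area_aux y j i
  have h3 := one_add_min_le_area_aux (fun i => (y i).swap) i j
  have h4 := one_add_min_le_area_aux (fun i => (y i).swap) j i
  rw [area_swap] at h3 h4
  simp only [Prod.fst_swap] at h3 h4
  rw [Prod.dist_eq, Real.dist_eq, Real.dist_eq]
  rcases max_cases |(y i).1 - (y j).1| |(y i).2 - (y j).2| with ⟨h, -⟩ | ⟨h, -⟩ <;> rw [h]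
  · rcases abs_cases ((y i).1 - (y j).1) with ⟨h, -⟩ | ⟨h, -⟩ <;> rw [h]
    · exact h1
    · rwa [neg_sub]
  · rcases abs_cases ((y i).2 - (y j).2) with ⟨h, -⟩ | ⟨h, -⟩ <;> rw [h]
    · exact h3
    · rwa [neg_sub]

lemma area_le (y : Fin (n + 1) → Plane) :
    area y ≤ (1 + spread fun i => (y i).1) * (1 + spread fun i => (y i).2) := by
  set a := fun i => (y i).1 with ha
  set b := fun i => (y i).2 with hb
  have hsa := spread_nonneg a
  have hsb := spread_nonneg b
  unfold spread at hsa hsb ⊢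
  have hsub : blob y ⊆ Icc ((⨅ i, a i) - 1 / 2) ((⨆ i, a i) + 1 / 2) ×ˢ
      Icc ((⨅ i, b i) - 1 / 2) ((⨆ i, b i) + 1 / 2) := by
    rintro z ⟨i, hi⟩
    obtain ⟨⟨h1, h2⟩, h3, h4⟩ := (dist_le_half_iff _ _).1 hi
    have e1 := iInf_fin_le a i
    have e2 := le_iSup_fin a i
    have e3 := iInf_fin_le b i
    have e4 := le_iSup_fin b i
    simp only [ha] at e1 e2
    simp only [hb] at e3 e4
    exact ⟨⟨by linarith, by linarith⟩, by linarith, by linarith⟩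
  refine (measureReal_mono hsub ?_).trans ?_
  · exact (isCompact_Icc.prod isCompact_Icc).measure_lt_top.ne
  · rw [volume_real_rectangle, Real.volume_real_Icc_of_le (by linarith),
      Real.volume_real_Icc_of_le (by linarith)]
    apply le_of_eq
    ring

/-- Let `a, b ≤ 1` be the two ranges and cut the bounding box into three horizontal bands. In the
middle band, of height `1 - b`, the leftmost and rightmost squares together fill the whole width `1
+ a`. The topmost and lowest squares fill width 1 of the outer bands, of height `b`. The total is
`(1 + a)(1 - b) + 2b = 1 + a + b - ab`. -/
lemma le_area (y : Fin (n + 1) → Plane) (h1 : spread (fun i => (y i).1) ≤ 1)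
    (h2 : spread (fun i => (y i).2) ≤ 1) :
    1 + extent y - spread (fun i => (y i).1) * spread (fun i => (y i).2) ≤ area y := by
  unfold extent
  set a := fun i => (y i).1 with ha
  set b := fun i => (y i).2 with hb
  have hsa := spread_nonneg a
  have hsb := spread_nonneg b
  unfold spread at hsa hsb h1 h2 ⊢
  obtain ⟨l, hl⟩ := exists_eq_ciInf_of_finite (f := a)
  obtain ⟨r, hr⟩ := exists_eq_ciSup_of_finite (f := a)
  obtain ⟨d, hd⟩ := exists_eq_ciInf_of_finite (f := b)
  obtain ⟨t, ht⟩ := exists_eq_ciSup_of_finite (f := b)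
  have ba := iInf_fin_le a
  have ua := le_iSup_fin a
  have bb := iInf_fin_le b
  have ub := le_iSup_fin b
  set i1 := ⨅ i, a i
  set s1 := ⨆ i, a i
  set i2 := ⨅ i, b i
  set s2 := ⨆ i, b i
  simp only [ha] at ba ua hl hr
  simp only [hb] at bb ub hd ht
  set M : Set Plane := Icc (i1 - 1 / 2) (s1 + 1 / 2) ×ˢ Ioc (s2 - 1 / 2) (i2 + 1 / 2) with hM
  set T : Set Plane := Icc ((y t).1 - 1 / 2) ((y t).1 + 1 / 2) ×ˢ Ioc (i2 + 1 / 2) (s2 + 1 / 2)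
    with hT
  set D : Set Plane := Icc ((y d).1 - 1 / 2) ((y d).1 + 1 / 2) ×ˢ Ioc (i2 - 1 / 2) (s2 - 1 / 2)
    with hD
  have hne : volume (blob y) ≠ ∞ := volume_blob_ne_top y
  have hMs : M ⊆ blob y := by
    rintro z ⟨⟨z1, z2⟩, z3, z4⟩
    rcases le_or_gt z.1 (i1 + 1 / 2) with hz | hz
    · exact ⟨l, (dist_le_half_iff _ _).2 ⟨⟨by linarith, by linarith⟩, by linarith [ub l],
        by linarith [bb l]⟩⟩
    · exact ⟨r, (dist_le_half_iff _ _).2 ⟨⟨by linarith, by linarith⟩, by linarith [ub r],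
        by linarith [bb r]⟩⟩
  have hTs : T ⊆ blob y := by
    rintro z ⟨hz, z3, z4⟩
    exact ⟨t, (dist_le_half_iff _ _).2 ⟨hz, by linarith, by linarith⟩⟩
  have hDs : D ⊆ blob y := by
    rintro z ⟨hz, z3, z4⟩
    exact ⟨d, (dist_le_half_iff _ _).2 ⟨hz, by linarith, by linarith⟩⟩
  have hMT : Disjoint M T := Set.disjoint_left.2 fun z hz hz' => by
    linarith [hz.2.2, hz'.2.1]
  have hMD : Disjoint (M ∪ T) D := Set.disjoint_left.2 fun z hz hz' => by
    rcases hz with hz | hz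
    · linarith [hz.2.1, hz'.2.2]
    · linarith [hz.2.1, hz'.2.2]
  have e1 := measureReal_union (μ := (volume : Measure Plane)) hMT
    (measurableSet_Icc.prod measurableSet_Ioc) (measure_ne_top_of_subset hMs hne)
    (measure_ne_top_of_subset hTs hne)
  have e2 := measureReal_union (μ := (volume : Measure Plane)) hMD
    (measurableSet_Icc.prod measurableSet_Ioc)
    (measure_ne_top_of_subset (union_subset hMs hTs) hne)
    (measure_ne_top_of_subset hDs hne)
  have v1 : (volume : Measure Plane).real M = (1 + (s1 - i1)) * (1 - (s2 - i2)) := by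
    rw [hM, volume_real_rectangle, Real.volume_real_Icc_of_le (by linarith),
      Real.volume_real_Ioc_of_le (by linarith)]
    ring
  have v2 : (volume : Measure Plane).real T = s2 - i2 := by
    rw [hT, volume_real_rectangle, Real.volume_real_Icc_of_le (by linarith),
      Real.volume_real_Ioc_of_le (by linarith)]
    ring
  have v3 : (volume : Measure Plane).real D = s2 - i2 := by
    rw [hD, volume_real_rectangle, Real.volume_real_Icc_of_le (by linarith),
      Real.volume_real_Ioc_of_le (by linarith)]
    ring
  have h := measureReal_mono (μ := (volume : Measure Plane))
    (union_subset (union_subset hMs hTs) hDs) hne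
  rw [e2, e1, v1, v2, v3] at h
  refine le_trans (le_of_eq ?_) h
  ring

/-- The bounds `le_area` and `area_le` differ from `1 + extent` only by the product of the two
ranges, which is of second order in `s⁻¹`. -/
lemma tendsto_area (y : Fin (n + 1) → Plane) :
    Tendsto (fun s : ℝ => s * (area (s⁻¹ • y) - 1)) atTop (𝓝 (extent y)) := by
  set a := spread fun i => (y i).1 with ha
  set b := spread fun i => (y i).2 with hb
  have ha0 : 0 ≤ a := spread_nonneg _
  have hb0 : 0 ≤ b := spread_nonneg _
  have he : extent y = a + b := rfl
  have h1 : ∀ s : ℝ, 0 < s → (spread fun i => ((s⁻¹ • y) i).1) = s⁻¹ * a := fun s hs => by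
    rw [ha, ← spread_smul (inv_nonneg.2 hs.le)]
    simp
  have h2 : ∀ s : ℝ, 0 < s → (spread fun i => ((s⁻¹ • y) i).2) = s⁻¹ * b := fun s hs => by
    rw [hb, ← spread_smul (inv_nonneg.2 hs.le)]
    simp
  have hlim : ∀ c : ℝ, Tendsto (fun s : ℝ => a + b + c * s⁻¹) atTop (𝓝 (extent y)) := fun c => by
    have := (tendsto_inv_atTop_zero (𝕜 := ℝ)).const_mul c
    rw [mul_zero] at this
    simpa [he] using this.const_add (a + b)
  refine tendsto_of_tendsto_of_tendsto_of_le_of_le' (hlim (-(a * b))) (hlim (a * b)) ?_ ?_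
  · filter_upwards [eventually_gt_atTop 0, eventually_ge_atTop a, eventually_ge_atTop b]
      with s hs hsa hsb
    have h := le_area (s⁻¹ • y) (by rw [h1 s hs, inv_mul_le_iff₀ hs]; linarith)
      (by rw [h2 s hs, inv_mul_le_iff₀ hs]; linarith)
    rw [h1 s hs, h2 s hs, extent_smul (inv_nonneg.2 hs.le), he] at h
    have h' : s * (s⁻¹ * (a + b) - s⁻¹ * a * (s⁻¹ * b)) ≤ s * (area (s⁻¹ • y) - 1) :=
      mul_le_mul_of_nonneg_left (by linarith) hs.le
    refine le_trans (le_of_eq ?_) h'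
    field_simp
    ring
  · filter_upwards [eventually_gt_atTop 0] with s hs
    have h := area_le (s⁻¹ • y)
    rw [h1 s hs, h2 s hs] at h
    have h' : s * (area (s⁻¹ • y) - 1) ≤ s * ((1 + s⁻¹ * a) * (1 + s⁻¹ * b) - 1) :=
      mul_le_mul_of_nonneg_left (by linarith) hs.le
    refine h'.trans (le_of_eq ?_)
    field_simp
    ring

end Area

/-! ### Pinning a point and changing scale -/

section Translation

/-- For a translation invariant function, it does not matter which point is pinned. -/
lemma lintegral_pin_comm {n : ℕ} {f : (Fin n → Plane) → ℝ≥0∞} (hf : Measurable f)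
    (hinv : ∀ x c, f (fun i => x i + c) = f x) {V : Set Plane} (hV : MeasurableSet V)
    (hV0 : volume V ≠ 0) (hV1 : volume V ≠ ∞) (i j : Fin n) :
    ∫⁻ x, V.indicator 1 (x i) * f x = ∫⁻ x, V.indicator 1 (x j) * f x := by
  have hind : Measurable (V.indicator (1 : Plane → ℝ≥0∞)) := measurable_one.indicator hV
  have hI : ∀ l : Fin n, Measurable fun x : Fin n → Plane =>
      V.indicator (1 : Plane → ℝ≥0∞) (x l) * f x :=
    fun l => (hind.comp (measurable_pi_apply l)).mul hf
  -- Mass transport: the factor `volume V` is written as an integral over translations `c` that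
  -- carry the other point into `V`; translating the family by `c` then exchanges the roles of `i`
  -- and `j`.
  have h1 : volume V * ∫⁻ x, V.indicator 1 (x i) * f x =
      ∫⁻ x : Fin n → Plane, ∫⁻ c : Plane, V.indicator 1 (x i) * f x * V.indicator 1 (x j + c) := by
    rw [← lintegral_const_mul _ (hI i)]
    refine lintegral_congr fun x => ?_
    have hc : Measurable fun c => V.indicator (1 : Plane → ℝ≥0∞) (x j + c) :=
      hind.comp (measurable_const_add (x j))
    rw [lintegral_const_mul _ hc,
      lintegral_add_left_eq_self (fun c => V.indicator (1 : Plane → ℝ≥0∞) c),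
      lintegral_indicator_one hV, mul_comm]
  have h2 : volume V * ∫⁻ x, V.indicator 1 (x j) * f x =
      ∫⁻ c : Plane, ∫⁻ x : Fin n → Plane, V.indicator 1 (x i - c) * f x * V.indicator 1 (x j) := by
    rw [lintegral_lintegral_swap, ← lintegral_const_mul _ (hI j)]
    · refine lintegral_congr fun x => ?_
      have e : ∀ c, V.indicator (1 : Plane → ℝ≥0∞) (x i - c) * f x * V.indicator 1 (x j) =
          V.indicator 1 (x j) * f x * V.indicator (1 : Plane → ℝ≥0∞) (x i - c) := fun c => by ring
      simp_rw [e]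
      have hc : Measurable fun c => V.indicator (1 : Plane → ℝ≥0∞) (x i - c) :=
        hind.comp (measurable_const_sub (x i))
      rw [lintegral_const_mul _ hc,
        lintegral_sub_left_eq_self (fun c => V.indicator (1 : Plane → ℝ≥0∞) c),
        lintegral_indicator_one hV, mul_comm]
    · refine Measurable.aemeasurable (Measurable.mul (Measurable.mul ?_ ?_) ?_)
      · exact hind.comp (by fun_prop : Measurable fun z : Plane × (Fin n → Plane) => z.2 i - z.1)
      · exact hf.comp measurable_snd
      · exact hind.comp (by fun_prop : Measurable fun z : Plane × (Fin n → Plane) => z.2 j)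
  rw [← ENNReal.mul_right_inj hV0 hV1, h1, h2, lintegral_lintegral_swap]
  · refine lintegral_congr fun c => ?_
    rw [← lintegral_add_right_eq_self
      (fun x : Fin n → Plane => V.indicator 1 (x i - c) * f x * V.indicator 1 (x j)) (fun _ => c)]
    refine lintegral_congr fun x => ?_
    have : f (x + fun _ => c) = f x := hinv x c
    simp only [Pi.add_apply, add_sub_cancel_right, this]
  · refine Measurable.aemeasurable (Measurable.mul (Measurable.mul ?_ ?_) ?_)
    · exact hind.comp (by fun_prop : Measurable fun z : (Fin n → Plane) × Plane => z.1 i)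
    · exact hf.comp measurable_fst
    · exact hind.comp (by fun_prop : Measurable fun z : (Fin n → Plane) × Plane => z.1 j + z.2)

lemma measurable_append (k ℓ : ℕ) :
    Measurable fun z : (Fin k → Plane) × (Fin ℓ → Plane) =>
      (Fin.append z.1 z.2 : Fin (k + ℓ) → Plane) := by
  rw [measurable_pi_iff]
  intro i
  refine Fin.addCases (fun j => ?_) (fun j => ?_) i
  · simp only [Fin.append_left]
    fun_prop
  · simp only [Fin.append_right]
    fun_prop

lemma lintegral_fin_append {k ℓ : ℕ} {f : (Fin (k + ℓ) → Plane) → ℝ≥0∞} (hf : Measurable f) :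
    ∫⁻ x, f x = ∫⁻ a : Fin k → Plane, ∫⁻ b : Fin ℓ → Plane, f (Fin.append a b) := by
  rw [← lintegral_prod (fun z : (Fin k → Plane) × (Fin ℓ → Plane) => f (Fin.append z.1 z.2))
    (hf.comp (measurable_append k ℓ)).aemeasurable, ← Measure.volume_eq_prod]
  have h1 := (volume_measurePreserving_piCongrLeft (fun _ : Fin (k + ℓ) => Plane)
    finSumFinEquiv).lintegral_map_equiv f _
  have h2 := (volume_measurePreserving_sumPiEquivProdPi_symm
    (fun _ : Fin k ⊕ Fin ℓ => Plane)).lintegral_map_equiv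
    (fun x => f (MeasurableEquiv.piCongrLeft (fun _ : Fin (k + ℓ) => Plane) finSumFinEquiv x)) _
  rw [h1, h2]
  refine lintegral_congr fun z => ?_
  congr 1
  funext i
  refine Fin.addCases (fun j => ?_) (fun j => ?_) i
  · have := Equiv.piCongrLeft_apply_apply (fun _ : Fin (k + ℓ) => Plane) finSumFinEquiv
      ((MeasurableEquiv.sumPiEquivProdPi fun _ : Fin k ⊕ Fin ℓ => Plane).symm z) (Sum.inl j)
    rw [Fin.append_left]
    exact this
  · have := Equiv.piCongrLeft_apply_apply (fun _ : Fin (k + ℓ) => Plane) finSumFinEquiv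
      ((MeasurableEquiv.sumPiEquivProdPi fun _ : Fin k ⊕ Fin ℓ => Plane).symm z) (Sum.inr j)
    rw [Fin.append_right]
    exact this

lemma measurable_cons_const_add (n : ℕ) :
    Measurable fun z : Plane × (Fin n → Plane) =>
      (Fin.cons z.1 (fun i => z.2 i + z.1) : Fin (n + 1) → Plane) :=
  measurable_cons.comp (by fun_prop : Measurable fun z : Plane × (Fin n → Plane) =>
    (z.1, fun i => z.2 i + z.1))

/-- The family made of `0`, the points `u`, the point `z` and the points `z + v`. -/
def pinned {k ℓ : ℕ} (u : Fin k → Plane) (z : Plane) (v : Fin ℓ → Plane) :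
    Fin (k + 1 + (ℓ + 1)) → Plane :=
  Fin.append (Fin.cons 0 u : Fin (k + 1) → Plane)
    (Fin.cons z fun i => v i + z : Fin (ℓ + 1) → Plane)

lemma measurable_pinned (k ℓ : ℕ) : Measurable fun y : (Fin k → Plane) × Plane × (Fin ℓ → Plane) =>
    pinned y.1 y.2.1 y.2.2 := by
  refine (measurable_append (k + 1) (ℓ + 1)).comp (Measurable.prodMk ?_ ?_)
  · exact measurable_cons.comp
      (by fun_prop : Measurable fun y : (Fin k → Plane) × Plane × (Fin ℓ → Plane) =>
        ((0 : Plane), y.1))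
  · exact (measurable_cons_const_add ℓ).comp measurable_snd

/-- Integration of a translation invariant function with one pinned point. -/
lemma lintegral_pin {k ℓ : ℕ} {f : (Fin (k + 1 + (ℓ + 1)) → Plane) → ℝ≥0∞} (hf : Measurable f)
    (hinv : ∀ x c, f (fun i => x i + c) = f x) {V : Set Plane} (hV : MeasurableSet V) :
    ∫⁻ x, V.indicator 1 (x (Fin.castAdd (ℓ + 1) 0)) * f x =
      volume V * ∫⁻ u : Fin k → Plane, ∫⁻ z : Plane, ∫⁻ v : Fin ℓ → Plane, f (pinned u z v) := by
  have hind : Measurable (V.indicator (1 : Plane → ℝ≥0∞)) := measurable_one.indicator hV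
  have hI : Measurable fun x : Fin (k + 1 + (ℓ + 1)) → Plane =>
      V.indicator (1 : Plane → ℝ≥0∞) (x (Fin.castAdd (ℓ + 1) 0)) * f x :=
    (hind.comp (measurable_pi_apply _)).mul hf
  rw [lintegral_fin_append hI, lintegral_fin_cons]
  · rw [← lintegral_indicator_one hV, ← lintegral_mul_const _ hind]
    refine lintegral_congr fun a => ?_
    simp only [Fin.append_left, Fin.cons_zero]
    rw [← lintegral_const_mul]
    · rw [← lintegral_add_right_eq_self _ (fun _ => a)]
      refine lintegral_congr fun u => ?_
      rw [lintegral_const_mul]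
      · congr 1
        rw [lintegral_fin_cons]
        · rw [← lintegral_add_right_eq_self _ a]
          refine lintegral_congr fun z => ?_
          rw [← lintegral_add_right_eq_self _ (fun _ => z + a)]
          refine lintegral_congr fun v => ?_
          rw [← hinv (pinned u z v) a]
          congr 1
          funext i
          refine Fin.addCases (fun j => ?_) (fun j => ?_) i
          · refine Fin.cases ?_ (fun j => ?_) j <;> simp [pinned]
          · refine Fin.cases ?_ (fun j => ?_) j <;> simp [pinned, add_assoc]
        · exact hf.comp ((measurable_append _ _).comp measurable_prodMk_left)
      · exact hf.comp ((measurable_append _ _).comp measurable_prodMk_left)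
    · refine Measurable.lintegral_prod_right' (f := fun y : (Fin k → Plane) × Plane =>
        ∫⁻ v : Fin ℓ → Plane, f (pinned y.1 y.2 v)) ?_
      refine Measurable.lintegral_prod_right' (f := fun y : ((Fin k → Plane) × Plane) ×
        (Fin ℓ → Plane) => f (pinned y.1.1 y.1.2 y.2)) ?_
      exact (hf.comp (measurable_pinned k ℓ)).comp (by fun_prop :
        Measurable fun y : ((Fin k → Plane) × Plane) × (Fin ℓ → Plane) => (y.1.1, y.1.2, y.2))
  · exact (hI.comp (measurable_append _ _)).lintegral_prod_right'

lemma lintegral_inv_smul_pi {n : ℕ} (f : (Fin n → Plane) → ℝ≥0∞) {s : ℝ} (hs : 0 < s) :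
    ∫⁻ x : Fin n → Plane, f (s⁻¹ • x) = ENNReal.ofReal (s ^ (2 * n)) * ∫⁻ x, f x := by
  have hs' : s⁻¹ ≠ 0 := inv_ne_zero hs.ne'
  have h := Measure.map_addHaar_smul (volume : Measure (Fin n → Plane)) hs'
  have h2 := (Homeomorph.smulOfNeZero (α := Fin n → Plane) s⁻¹
    hs').toMeasurableEquiv.measurableEmbedding.lintegral_map (μ := volume) f
  have h3 : (⇑(Homeomorph.smulOfNeZero (α := Fin n → Plane) s⁻¹ hs').toMeasurableEquiv) =
      fun x => s⁻¹ • x := rfl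
  rw [h3] at h2
  rw [← h2]
  change ∫⁻ x, f x ∂(Measure.map (fun x => s⁻¹ • x) volume) = _
  rw [h, lintegral_smul_measure, smul_eq_mul]
  congr 2
  rw [Module.finrank_pi_fintype]
  simp only [Module.finrank_prod, Module.finrank_self, Finset.sum_const, Finset.card_univ,
    Fintype.card_fin, smul_eq_mul]
  rw [inv_pow, inv_inv, abs_of_pos (by positivity)]
  congr 1
  ring

end Translation

/-! ### Translation invariance and linked families -/

section Density

variable {α R₀ Rα p q : ℝ}

lemma cover_append_false {k ℓ : ℕ} (a : Fin k → Plane) (b : Fin ℓ → Plane) :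
    cover (kind k ℓ) false (Fin.append a b) = blob a := by
  ext z
  constructor
  · rintro ⟨i, hi, hd⟩
    revert hi hd
    refine Fin.addCases (fun j => ?_) (fun j => ?_) i
    · intro _ hd
      exact ⟨j, by simpa using hd⟩
    · simp
  · rintro ⟨j, hd⟩
    exact ⟨Fin.castAdd ℓ j, by simp, by simpa using hd⟩

lemma cover_append_true {k ℓ : ℕ} (a : Fin k → Plane) (b : Fin ℓ → Plane) :
    cover (kind k ℓ) true (Fin.append a b) = blob b := by
  ext z
  constructor
  · rintro ⟨i, hi, hd⟩
    revert hi hd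
    refine Fin.addCases (fun j => ?_) (fun j => ?_) i
    · simp
    · intro _ hd
      exact ⟨j, by simpa using hd⟩
  · rintro ⟨j, hd⟩
    exact ⟨Fin.natAdd k j, by simp, by simpa using hd⟩

lemma volume_real_cover_add {n : ℕ} (τ : Fin n → Bool) (b : Bool) (x : Fin n → Plane)
    (c : Plane) : volume.real (cover τ b fun i => x i + c) = volume.real (cover τ b x) := by
  have : cover τ b x = (fun z => z + c) ⁻¹' cover τ b fun i => x i + c := by
    ext z
    simp [cover]
  rw [measureReal_def, measureReal_def, this, measure_preimage_add_right]

lemma clusterDensity_add {n : ℕ} (τ : Fin n → Bool) (s : ℝ) (x : Fin n → Plane) (c : Plane) :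
    clusterDensity α R₀ Rα p q τ s (fun i => x i + c) = clusterDensity α R₀ Rα p q τ s x := by
  have h : (Linked fun i => germ α R₀ Rα (τ i) (x i + c)) ↔
      Linked fun i => germ α R₀ Rα (τ i) (x i) := by
    simp only [Linked, meets_germ_add]
  rw [clusterDensity, clusterDensity, volume_real_cover_add, volume_real_cover_add]
  congr 1
  by_cases hl : Linked fun i => germ α R₀ Rα (τ i) (x i)
  · rw [indicator_of_mem (by exact h.2 hl), indicator_of_mem (by exact hl)]
    rfl
  · rw [indicator_of_notMem (by exact fun h' => hl (h.1 h')), indicator_of_notMem (by exact hl)]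

lemma measurable_volume_real_cover {n : ℕ} (τ : Fin n → Bool) (b : Bool) :
    Measurable fun x : Fin n → Plane => volume.real (cover τ b x) := by
  have hm : MeasurableSet {z : (Fin n → Plane) × Plane | z.2 ∈ cover τ b z.1} := by
    have : {z : (Fin n → Plane) × Plane | z.2 ∈ cover τ b z.1} =
        ⋃ i : {i // τ i = b}, {z : (Fin n → Plane) × Plane | dist (z.1 i) z.2 ≤ 1 / 2} := by
      ext z
      simp [cover]
    rw [this]
    exact MeasurableSet.iUnion fun i => measurableSet_le (by fun_prop) measurable_const
  exact (measurable_measure_prodMk_left hm).ennreal_toReal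

lemma measurableSet_linked_germ {n : ℕ} (τ : Fin n → Bool) :
    MeasurableSet {x : Fin n → Plane | Linked fun i => germ α R₀ Rα (τ i) (x i)} :=
  (measurableSet_linked n).preimage
    (measurable_pi_lambda _ fun i => (measurable_germ (τ i)).comp (measurable_pi_apply i))

lemma measurable_clusterDensity {n : ℕ} (τ : Fin n → Bool) (s : ℝ) :
    Measurable (clusterDensity α R₀ Rα p q τ s) := by
  refine (measurable_one.indicator (measurableSet_linked_germ τ)).mul
    (Measurable.ennreal_ofReal (Measurable.exp (Measurable.neg (Measurable.const_mul ?_ s))))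
  exact ((measurable_volume_real_cover τ true).const_mul p).add
    ((measurable_volume_real_cover τ false).const_mul q)

lemma dist_le_of_reflTransGen {n : ℕ} {x : Fin n → Plane} {r : Fin n → Fin n → Prop}
    (hr : ∀ i j, r i j → dist (x i) (x j) ≤ 1) {i j : Fin n} (h : Relation.ReflTransGen r i j) :
    dist (x i) (x j) ≤ n := by
  classical
  let G : SimpleGraph (Fin n) := SimpleGraph.fromRel r
  have hadj : ∀ a b, G.Adj a b → dist (x a) (x b) ≤ 1 := by
    rintro a b ⟨-, h | h⟩
    · exact hr a b h
    · rw [dist_comm]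
      exact hr b a h
  have hreach : G.Reachable i j := by
    induction h with
    | refl => exact SimpleGraph.Reachable.refl _
    | @tail b c _ hbc ih =>
      by_cases hne : b = c
      · exact hne ▸ ih
      · exact ih.trans (SimpleGraph.Adj.reachable ⟨hne, Or.inl hbc⟩)
  have hwalk : ∀ {a b : Fin n} (w : G.Walk a b), dist (x a) (x b) ≤ w.length := by
    intro a b w
    induction w with
    | nil => simp
    | @cons a b c hab w ih =>
      have := dist_triangle (x a) (x b) (x c)
      rw [SimpleGraph.Walk.length_cons]
      push_cast
      linarith [hadj _ _ hab]
  obtain ⟨w⟩ := hreach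
  -- Passing to a simple path bounds the length by the number of vertices, uniformly in the family.
  refine (hwalk w.toPath.1).trans ?_
  have := w.toPath.2.length_lt
  rw [Fintype.card_fin] at this
  exact_mod_cast this.le

lemma Linked.dist_le (hα₀ : 0 < α) (hαπ : α < Real.pi) (hR₀ : 0 < R₀) (hRα : 0 < Rα) {n : ℕ}
    {τ : Fin n → Bool} {x : Fin n → Plane} (h : Linked fun i => germ α R₀ Rα (τ i) (x i))
    (i j : Fin n) : dist (x i) (x j) ≤ n :=
  dist_le_of_reflTransGen (fun _ _ hij => Meets.dist_le hα₀ hαπ hR₀ hRα hij) (h i j)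

/-- If all pairs of different kinds meet, two sticks of the same kind are joined through any stick
of the other kind. Together with `Linked.exists_cross` this decides linkedness whenever all the
cross distances lie on the same side of 1/2. -/
lemma linked_of_cross (hα₀ : 0 < α) (hαπ : α < Real.pi) (hR₀ : 0 < R₀) (hRα : 0 < Rα) {n : ℕ}
    {τ : Fin n → Bool} {x : Fin n → Plane} (hτ : ∀ b, ∃ i, τ i = b)
    (h : ∀ i j, τ i ≠ τ j → dist (x i) (x j) ≤ 1 / 2) :
    Linked fun i => germ α R₀ Rα (τ i) (x i) := by
  have hm : ∀ i j, τ i ≠ τ j → Meets (germ α R₀ Rα (τ i) (x i)) (germ α R₀ Rα (τ j) (x j)) :=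
    fun i j hij => (meets_of_ne hα₀ hαπ hR₀ hRα hij _ _).2 (h i j hij)
  intro i j
  by_cases hij : τ i = τ j
  · obtain ⟨l, hl⟩ := hτ (!τ i)
    have hil : Relation.ReflTransGen (fun i j => Meets (germ α R₀ Rα (τ i) (x i))
        (germ α R₀ Rα (τ j) (x j))) i l := .single (hm i l (by simp [hl]))
    exact hil.tail (hm l j (by simp [hl, hij]))
  · exact Relation.ReflTransGen.single (hm i j hij)

lemma Linked.exists_cross (hα₀ : 0 < α) (hαπ : α < Real.pi) (hR₀ : 0 < R₀) (hRα : 0 < Rα) {n : ℕ}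
    {τ : Fin n → Bool} {x : Fin n → Plane} (hτ : ∀ b, ∃ i, τ i = b)
    (h : Linked fun i => germ α R₀ Rα (τ i) (x i)) :
    ∃ i j, τ i ≠ τ j ∧ dist (x i) (x j) ≤ 1 / 2 := by
  by_contra! hcon
  obtain ⟨i, hi⟩ := hτ false
  obtain ⟨j, hj⟩ := hτ true
  have key : ∀ l, Relation.ReflTransGen (fun i j => Meets (germ α R₀ Rα (τ i) (x i))
      (germ α R₀ Rα (τ j) (x j))) i l → τ l = false := by
    intro l hl
    induction hl with
    | refl => exact hi
    | @tail b c _ hbc ih =>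
      by_contra hc
      have hne : τ b ≠ τ c := fun h => hc (h ▸ ih)
      exact absurd ((meets_of_ne hα₀ hαπ hR₀ hRα hne _ _).1 hbc) (not_le.2 (hcon b c hne))
  have := key j (h i j)
  rw [hj] at this
  exact absurd this (by simp)

lemma kind_surjective (k ℓ : ℕ) (b : Bool) : ∃ i, kind (k + 1) (ℓ + 1) i = b := by
  cases b
  · exact ⟨Fin.castAdd (ℓ + 1) 0, by simp⟩
  · exact ⟨Fin.natAdd (k + 1) 0, by simp⟩

end Density

/-! ### Laplace asymptotics by dominated convergence -/

lemma lintegral_exp_neg_norm_ne_top {n : ℕ} {c : ℝ} (hc : 0 < c) :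
    ∫⁻ x : Fin n → Plane, ENNReal.ofReal (Real.exp (-(c * ‖x‖))) ≠ ∞ := by
  -- One more than the dimension makes `(1 + ‖x‖) ^ (-N)` integrable, and it dominates the
  -- exponential through the `N`-th term of its series.
  set N := Module.finrank ℝ (Fin n → Plane) + 1 with hN
  have hfin := finite_integral_one_add_norm (μ := (volume : Measure (Fin n → Plane)))
    (r := (N : ℝ)) (by rw [hN]; exact_mod_cast Nat.lt_succ_self _)
  have hle : ∀ x : Fin n → Plane, ENNReal.ofReal (Real.exp (-(c * ‖x‖))) ≤
      ENNReal.ofReal (Real.exp c * (N ! / c ^ N)) *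
        ENNReal.ofReal ((1 + ‖x‖) ^ (-(N : ℝ))) := by
    intro x
    have hx : 0 < 1 + ‖x‖ := by positivity
    rw [← ENNReal.ofReal_mul (by positivity)]
    refine ENNReal.ofReal_le_ofReal ?_
    have h1 := Real.pow_div_factorial_le_exp (x := c * (1 + ‖x‖)) (by positivity) N
    rw [Real.rpow_neg hx.le, Real.rpow_natCast, Real.exp_neg]
    have h2 : Real.exp (c * ‖x‖) = Real.exp (c * (1 + ‖x‖)) / Real.exp c := by
      rw [← Real.exp_sub]
      congr 1
      ring
    rw [h2, inv_div]
    have hfac : (0 : ℝ) < N ! := by positivity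
    rw [mul_pow, div_le_iff₀ hfac] at h1
    rw [div_le_iff₀ (Real.exp_pos _)]
    calc Real.exp c = Real.exp c * (1 / c ^ N) * ((1 + ‖x‖) ^ N)⁻¹ * (c ^ N * (1 + ‖x‖) ^ N) := by
          field_simp
      _ ≤ Real.exp c * (1 / c ^ N) * ((1 + ‖x‖) ^ N)⁻¹ *
          (Real.exp (c * (1 + ‖x‖)) * N !) := by gcongr
      _ = _ := by ring
  refine ((lintegral_mono hle).trans_lt ?_).ne
  rw [lintegral_const_mul' _ _ ENNReal.ofReal_ne_top]
  exact ENNReal.mul_lt_top ENNReal.ofReal_lt_top hfin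

variable {α R₀ Rα p q : ℝ}

/-- The density of clusters after rescaling the points of the same kind towards each other. -/
def rescaledDensity (α R₀ Rα p q : ℝ) (k ℓ : ℕ) (s : ℝ)
    (y : (Fin k → Plane) × Plane × (Fin ℓ → Plane)) : ℝ≥0∞ :=
  ENNReal.ofReal (Real.exp s) * clusterDensity α R₀ Rα p q (kind (k + 1) (ℓ + 1)) s
    (pinned (s⁻¹ • y.1) y.2.1 (s⁻¹ • y.2.2))

lemma cons_zero_smul {n : ℕ} (c : ℝ) (u : Fin n → Plane) :
    (Fin.cons 0 (c • u) : Fin (n + 1) → Plane) = c • (Fin.cons 0 u : Fin (n + 1) → Plane) := by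
  funext i
  refine Fin.cases ?_ (fun j => ?_) i <;> simp

lemma cons_add_const {n : ℕ} (z : Plane) (v : Fin n → Plane) :
    (Fin.cons z (fun i => v i + z) : Fin (n + 1) → Plane) =
      fun i => (Fin.cons 0 v : Fin (n + 1) → Plane) i + z := by
  funext i
  refine Fin.cases ?_ (fun j => ?_) i <;> simp

lemma pinned_eq {k ℓ : ℕ} (c : ℝ) (u : Fin k → Plane) (z : Plane) (v : Fin ℓ → Plane) :
    pinned (c • u) z (c • v) = Fin.append (c • (Fin.cons 0 u : Fin (k + 1) → Plane))
      (fun i => (c • (Fin.cons 0 v : Fin (ℓ + 1) → Plane)) i + z) := by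
  rw [pinned, cons_zero_smul, cons_add_const, cons_zero_smul]

/-- Because `p + q = 1`, the factor `e^s` subtracts exactly 1 from each of the two areas. The
slanted area carries `p`, since it is the horizontal sticks that must avoid it, and conversely. -/
lemma rescaledDensity_eq (hpq : p + q = 1) (k ℓ : ℕ) (s : ℝ)
    (y : (Fin k → Plane) × Plane × (Fin ℓ → Plane)) :
    rescaledDensity α R₀ Rα p q k ℓ s y =
      {x | Linked fun i => germ α R₀ Rα (kind (k + 1) (ℓ + 1) i) (x i)}.indicator 1
        (pinned (s⁻¹ • y.1) y.2.1 (s⁻¹ • y.2.2)) *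
      (ENNReal.ofReal (Real.exp (-(p *
          (s * (area (s⁻¹ • (Fin.cons 0 y.2.2 : Fin (ℓ + 1) → Plane)) - 1))))) *
        ENNReal.ofReal (Real.exp (-(q *
          (s * (area (s⁻¹ • (Fin.cons 0 y.1 : Fin (k + 1) → Plane)) - 1)))))) := by
  rw [rescaledDensity, clusterDensity, mul_left_comm]
  congr 1
  rw [pinned_eq, cover_append_false, cover_append_true]
  change _ * ENNReal.ofReal (Real.exp (-(s * (p * area _ + q * area _)))) = _
  rw [area_add, ← ENNReal.ofReal_mul (Real.exp_nonneg _), ← ENNReal.ofReal_mul (Real.exp_nonneg _),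
    ← Real.exp_add, ← Real.exp_add]
  congr 2
  have : q = 1 - p := by linarith
  subst this
  ring

/-- The limit of `rescaledDensity`. -/
def limitDensity (p q : ℝ) (k ℓ : ℕ) (y : (Fin k → Plane) × Plane × (Fin ℓ → Plane)) : ℝ≥0∞ :=
  (Metric.closedBall 0 (1 / 2)).indicator 1 y.2.1 *
    (ENNReal.ofReal (Real.exp (-(p * extent (Fin.cons 0 y.2.2 : Fin (ℓ + 1) → Plane)))) *
      ENNReal.ofReal (Real.exp (-(q * extent (Fin.cons 0 y.1 : Fin (k + 1) → Plane)))))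

lemma eventually_cross {n : ℕ} (τ : Fin n → Bool) (x : ℝ → Fin n → Plane) {S : Set ℝ}
    (hS : IsOpen S) {r : ℝ} (hr : r ∈ S)
    (hx : ∀ i j, τ i ≠ τ j → Tendsto (fun s => dist (x s i) (x s j)) atTop (𝓝 r)) :
    ∀ᶠ s in atTop, ∀ i j, τ i ≠ τ j → dist (x s i) (x s j) ∈ S := by
  rw [eventually_all]
  intro i
  rw [eventually_all]
  intro j
  by_cases hij : τ i = τ j
  · simp [hij]
  · filter_upwards [(hx i j hij).eventually (hS.mem_nhds hr)] with s hs _ using hs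

lemma tendsto_dist_pinned {k ℓ : ℕ} (y : (Fin k → Plane) × Plane × (Fin ℓ → Plane))
    (i j : Fin (k + 1 + (ℓ + 1))) (hij : kind (k + 1) (ℓ + 1) i ≠ kind (k + 1) (ℓ + 1) j) :
    Tendsto (fun s : ℝ => dist (pinned (s⁻¹ • y.1) y.2.1 (s⁻¹ • y.2.2) i)
      (pinned (s⁻¹ • y.1) y.2.1 (s⁻¹ • y.2.2) j)) atTop (𝓝 ‖y.2.1‖) := by
  have h0 : ∀ a : Plane, Tendsto (fun s : ℝ => s⁻¹ • a) atTop (𝓝 0) := fun a => by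
    simpa using (tendsto_inv_atTop_zero (𝕜 := ℝ)).smul_const a
  have key : ∀ a b : Plane, Tendsto (fun s : ℝ => dist (s⁻¹ • a) (s⁻¹ • b + y.2.1)) atTop
      (𝓝 ‖y.2.1‖) := fun a b => by
    have := (h0 a).dist ((h0 b).add_const y.2.1)
    simpa using this
  simp_rw [pinned_eq]
  revert hij
  refine Fin.addCases (fun i => ?_) (fun i => ?_) i <;>
    refine Fin.addCases (fun j => ?_) (fun j => ?_) j <;> intro hij
  · simp at hij
  · simp only [Fin.append_left, Fin.append_right, Pi.smul_apply]
    exact key _ _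
  · simp only [Fin.append_left, Fin.append_right, Pi.smul_apply]
    simp_rw [dist_comm]
    exact key _ _
  · simp at hij

/-- All cross distances tend to the norm of the offset, so linkedness is eventually decided by
whether this norm is below or above 1/2; the excluded sphere is null. -/
lemma tendsto_rescaledDensity (hα₀ : 0 < α) (hαπ : α < Real.pi) (hR₀ : 0 < R₀) (hRα : 0 < Rα)
    (hpq : p + q = 1) (k ℓ : ℕ) (y : (Fin k → Plane) × Plane × (Fin ℓ → Plane))
    (hy : ‖y.2.1‖ ≠ 1 / 2) :
    Tendsto (fun s => rescaledDensity α R₀ Rα p q k ℓ s y) atTop (𝓝 (limitDensity p q k ℓ y)) := by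
  simp_rw [rescaledDensity_eq hpq]
  have hexp : ∀ (c : ℝ) (n : ℕ) (u : Fin n → Plane), Tendsto (fun s : ℝ =>
      ENNReal.ofReal (Real.exp (-(c *
        (s * (area (s⁻¹ • (Fin.cons 0 u : Fin (n + 1) → Plane)) - 1)))))) atTop
      (𝓝 (ENNReal.ofReal (Real.exp (-(c * extent (Fin.cons 0 u : Fin (n + 1) → Plane)))))) :=
    fun c n u => ENNReal.tendsto_ofReal ((Real.continuous_exp.tendsto _).comp
      ((tendsto_area _).const_mul c).neg)
  have hind : ∀ᶠ s : ℝ in atTop,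
      {x | Linked fun i => germ α R₀ Rα (kind (k + 1) (ℓ + 1) i) (x i)}.indicator
        (1 : (Fin (k + 1 + (ℓ + 1)) → Plane) → ℝ≥0∞)
        (pinned (s⁻¹ • y.1) y.2.1 (s⁻¹ • y.2.2)) =
      (Metric.closedBall 0 (1 / 2)).indicator 1 y.2.1 := by
    rcases lt_or_gt_of_ne hy with h | h
    · filter_upwards [eventually_cross (kind (k + 1) (ℓ + 1)) _ isOpen_Iio h
        (tendsto_dist_pinned y)] with s hs
      rw [indicator_of_mem, indicator_of_mem]
      · rfl
      · simpa using h.le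
      · exact linked_of_cross hα₀ hαπ hR₀ hRα (kind_surjective k ℓ)
          fun i j hij => (hs i j hij).le
    · filter_upwards [eventually_cross (kind (k + 1) (ℓ + 1)) _ isOpen_Ioi h
        (tendsto_dist_pinned y)] with s hs
      rw [indicator_of_notMem, indicator_of_notMem]
      · simpa using h
      · intro hl
        obtain ⟨i, j, hij, hd⟩ := Linked.exists_cross hα₀ hαπ hR₀ hRα (kind_surjective k ℓ) hl
        exact absurd hd (not_le.2 (hs i j hij))
  have hne : (Metric.closedBall (0 : Plane) (1 / 2)).indicator (1 : Plane → ℝ≥0∞) y.2.1 ≠ ∞ := by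
    by_cases h : y.2.1 ∈ Metric.closedBall (0 : Plane) (1 / 2)
    · rw [indicator_of_mem h]
      exact ENNReal.one_ne_top
    · rw [indicator_of_notMem h]
      exact ENNReal.zero_ne_top
  refine Tendsto.congr' (f₁ := fun s : ℝ => (Metric.closedBall 0 (1 / 2)).indicator 1 y.2.1 * _)
    (by filter_upwards [hind] with s hs; rw [hs]) ?_
  refine ENNReal.Tendsto.const_mul ?_ (Or.inr hne)
  exact ENNReal.Tendsto.mul (hexp p ℓ y.2.2) (Or.inr ENNReal.ofReal_ne_top) (hexp q k y.1)
    (Or.inr ENNReal.ofReal_ne_top)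

/-- An integrable bound for `rescaledDensity`. -/
def boundDensity (p q : ℝ) (k ℓ : ℕ) (y : (Fin k → Plane) × Plane × (Fin ℓ → Plane)) : ℝ≥0∞ :=
  ENNReal.ofReal (Real.exp (-(q / (k + 1 + (ℓ + 1) : ℕ) * ‖y.1‖))) *
    ((Metric.closedBall 0 (k + 1 + (ℓ + 1) : ℕ)).indicator 1 y.2.1 *
      ENNReal.ofReal (Real.exp (-(p / (k + 1 + (ℓ + 1) : ℕ) * ‖y.2.2‖))))

/-- For a distance `d ≤ M` with `M ≥ 1` one has `d ≤ M * min 1 d`, so the excess area over 1 is at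
least the largest distance to the pinned point divided by `M`. -/
lemma exp_area_le {n : ℕ} {c s M : ℝ} (hc : 0 < c) (hs : 0 < s) (hM : 1 ≤ M) (u : Fin n → Plane)
    (h : ∀ i, dist (s⁻¹ • u i) 0 ≤ M) :
    Real.exp (-(c * (s * (area (s⁻¹ • (Fin.cons 0 u : Fin (n + 1) → Plane)) - 1)))) ≤
      Real.exp (-(c / M * ‖u‖)) := by
  have hM0 : 0 < M := by linarith
  set A := area (s⁻¹ • (Fin.cons 0 u : Fin (n + 1) → Plane)) with hA
  have hA1 : 1 ≤ A := by
    have := one_add_min_dist_le_area (s⁻¹ • (Fin.cons 0 u : Fin (n + 1) → Plane)) 0 0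
    simpa using this
  have hu : ‖u‖ ≤ M * (s * (A - 1)) := by
    refine (pi_norm_le_iff_of_nonneg (by
      have : 0 ≤ A - 1 := by linarith
      positivity)).2 fun i => ?_
    have h1 := one_add_min_dist_le_area (s⁻¹ • (Fin.cons 0 u : Fin (n + 1) → Plane)) i.succ 0
    simp only [Pi.smul_apply, Fin.cons_succ, Fin.cons_zero, smul_zero] at h1
    have h2 : dist (s⁻¹ • u i) 0 ≤ M * min 1 (dist (s⁻¹ • u i) 0) := by
      rcases min_cases 1 (dist (s⁻¹ • u i) 0) with ⟨hm, -⟩ | ⟨hm, -⟩ <;> rw [hm]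
      · linarith [h i]
      · nlinarith [dist_nonneg (x := s⁻¹ • u i) (y := 0)]
    have h3 : dist (s⁻¹ • u i) 0 = s⁻¹ * ‖u i‖ := by
      rw [dist_zero_right, norm_smul, Real.norm_of_nonneg (inv_nonneg.2 hs.le)]
    have h4 : s⁻¹ * ‖u i‖ ≤ M * (A - 1) := by
      rw [← h3]
      exact h2.trans (mul_le_mul_of_nonneg_left (by linarith) hM0.le)
    rw [inv_mul_le_iff₀ hs] at h4
    linarith
  refine Real.exp_le_exp.2 (neg_le_neg ?_)
  rw [div_mul_eq_mul_div, div_le_iff₀ hM0]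
  have := mul_le_mul_of_nonneg_left hu hc.le
  linarith

/-- Where the density is nonzero the family is linked, so all distances are at most its size, which
serves as `M` in `exp_area_le` and as the radius for the offset. -/
lemma rescaledDensity_le (hα₀ : 0 < α) (hαπ : α < Real.pi) (hR₀ : 0 < R₀) (hRα : 0 < Rα)
    (hp : 0 < p) (hq : 0 < q) (hpq : p + q = 1) (k ℓ : ℕ) {s : ℝ} (hs : 0 < s)
    (y : (Fin k → Plane) × Plane × (Fin ℓ → Plane)) :
    rescaledDensity α R₀ Rα p q k ℓ s y ≤ boundDensity p q k ℓ y := by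
  rw [rescaledDensity_eq hpq]
  by_cases hl : Linked fun i => germ α R₀ Rα (kind (k + 1) (ℓ + 1) i)
      (pinned (s⁻¹ • y.1) y.2.1 (s⁻¹ • y.2.2) i)
  · have hd := Linked.dist_le hα₀ hαπ hR₀ hRα hl
    have hM : (1 : ℝ) ≤ (k + 1 + (ℓ + 1) : ℕ) := by
      exact_mod_cast (by omega : 1 ≤ k + 1 + (ℓ + 1))
    have hz : y.2.1 ∈ Metric.closedBall (0 : Plane) (k + 1 + (ℓ + 1) : ℕ) := by
      have := hd (Fin.natAdd (k + 1) 0) (Fin.castAdd (ℓ + 1) 0)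
      simpa [pinned] using this
    have hu : ∀ i, dist (s⁻¹ • y.1 i) 0 ≤ (k + 1 + (ℓ + 1) : ℕ) := fun i => by
      have := hd (Fin.castAdd (ℓ + 1) i.succ) (Fin.castAdd (ℓ + 1) 0)
      simp only [pinned, Fin.append_left, Fin.cons_succ, Fin.cons_zero, Pi.smul_apply] at this
      exact this
    have hv : ∀ i, dist (s⁻¹ • y.2.2 i) 0 ≤ (k + 1 + (ℓ + 1) : ℕ) := fun i => by
      have := hd (Fin.natAdd (k + 1) i.succ) (Fin.natAdd (k + 1) 0)
      simp only [pinned, Fin.append_right, Fin.cons_succ, Fin.cons_zero, Pi.smul_apply]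
        at this
      rw [dist_eq_norm, add_sub_cancel_right] at this
      rwa [dist_zero_right]
    rw [indicator_of_mem (by exact hl), Pi.one_apply, one_mul, boundDensity, indicator_of_mem hz,
      Pi.one_apply, one_mul, mul_comm]
    exact mul_le_mul' (ENNReal.ofReal_le_ofReal (exp_area_le hq hs hM _ hu))
      (ENNReal.ofReal_le_ofReal (exp_area_le hp hs hM _ hv))
  · rw [indicator_of_notMem (by exact hl), zero_mul]
    exact zero_le

lemma lintegral_prod_three {k ℓ : ℕ} {f : (Fin k → Plane) → ℝ≥0∞} {g : Plane → ℝ≥0∞}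
    {h : (Fin ℓ → Plane) → ℝ≥0∞} (hf : Measurable f) (hg : Measurable g) (hh : Measurable h) :
    ∫⁻ y : (Fin k → Plane) × Plane × (Fin ℓ → Plane), f y.1 * (g y.2.1 * h y.2.2) =
      (∫⁻ u, f u) * ((∫⁻ z, g z) * ∫⁻ v, h v) := by
  rw [Measure.volume_eq_prod, lintegral_prod_mul (g := fun y : Plane × (Fin ℓ → Plane) =>
    g y.1 * h y.2) hf.aemeasurable
    ((hg.comp measurable_fst).mul (hh.comp measurable_snd)).aemeasurable,
    Measure.volume_eq_prod, lintegral_prod_mul hg.aemeasurable hh.aemeasurable]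

lemma lintegral_boundDensity_ne_top (hp : 0 < p) (hq : 0 < q) (k ℓ : ℕ) :
    ∫⁻ y, boundDensity p q k ℓ y ≠ ∞ := by
  have hM : (0 : ℝ) < (k + 1 + (ℓ + 1) : ℕ) := by exact_mod_cast (by omega : 0 < k + 1 + (ℓ + 1))
  unfold boundDensity
  rw [lintegral_prod_three (f := fun u => ENNReal.ofReal
      (Real.exp (-(q / (k + 1 + (ℓ + 1) : ℕ) * ‖u‖))))
    (g := (Metric.closedBall 0 (k + 1 + (ℓ + 1) : ℕ)).indicator 1)
    (h := fun v => ENNReal.ofReal (Real.exp (-(p / (k + 1 + (ℓ + 1) : ℕ) * ‖v‖))))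
    (by fun_prop) (measurable_one.indicator Metric.isClosed_closedBall.measurableSet) (by fun_prop),
    lintegral_indicator_one Metric.isClosed_closedBall.measurableSet]
  exact ENNReal.mul_ne_top (lintegral_exp_neg_norm_ne_top (by positivity))
    (ENNReal.mul_ne_top measure_closedBall_lt_top.ne
      (lintegral_exp_neg_norm_ne_top (by positivity)))

lemma measurable_exp_extent (c : ℝ) (n : ℕ) : Measurable fun u : Fin n → Plane =>
    ENNReal.ofReal (Real.exp (-(c * extent (Fin.cons 0 u : Fin (n + 1) → Plane)))) :=
  (((measurable_extent _).comp (measurable_cons.comp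
    (measurable_prodMk_left (x := (0 : Plane))))).const_mul c).neg.exp.ennreal_ofReal

lemma lintegral_limitDensity (hp : 0 < p) (hq : 0 < q) (k ℓ : ℕ) :
    ∫⁻ y, limitDensity p q k ℓ y =
      ENNReal.ofReal (((k + 1)! / q ^ k) ^ 2 * ((ℓ + 1)! / p ^ ℓ) ^ 2) := by
  have h1 : volume (Metric.closedBall (0 : Plane) (1 / 2)) = 1 := by
    have : Metric.closedBall (0 : Plane) (1 / 2) =
        Metric.closedBall (0 : ℝ) (1 / 2) ×ˢ Metric.closedBall (0 : ℝ) (1 / 2) := by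
      rw [closedBall_prod_same]
      rfl
    rw [this, Measure.volume_eq_prod, Measure.prod_prod, Real.volume_closedBall]
    norm_num
  have h2 : ∀ y, limitDensity p q k ℓ y =
      ENNReal.ofReal (Real.exp (-(q * extent (Fin.cons 0 y.1 : Fin (k + 1) → Plane)))) *
      ((Metric.closedBall 0 (1 / 2)).indicator 1 y.2.1 *
        ENNReal.ofReal (Real.exp (-(p * extent (Fin.cons 0 y.2.2 : Fin (ℓ + 1) → Plane))))) :=
    fun y => by
      rw [limitDensity]
      ring
  simp_rw [h2]
  rw [lintegral_prod_three (f := fun u => ENNReal.ofReal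
      (Real.exp (-(q * extent (Fin.cons 0 u : Fin (k + 1) → Plane)))))
    (g := (Metric.closedBall 0 (1 / 2)).indicator 1)
    (h := fun v => ENNReal.ofReal
      (Real.exp (-(p * extent (Fin.cons 0 v : Fin (ℓ + 1) → Plane)))))
    (measurable_exp_extent q k) (measurable_one.indicator Metric.isClosed_closedBall.measurableSet)
    (measurable_exp_extent p ℓ), lintegral_exp_extent hq, lintegral_exp_extent hp,
    lintegral_indicator_one Metric.isClosed_closedBall.measurableSet, h1, one_mul,
    ← ENNReal.ofReal_mul (by positivity)]

lemma measurable_rescaledDensity (k ℓ : ℕ) (s : ℝ) :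
    Measurable (rescaledDensity α R₀ Rα p q k ℓ s) := by
  refine Measurable.const_mul ((measurable_clusterDensity _ s).comp
    ((measurable_pinned k ℓ).comp (f := fun y : (Fin k → Plane) × Plane × (Fin ℓ → Plane) =>
      (s⁻¹ • y.1, y.2.1, s⁻¹ • y.2.2)) ?_)) _
  fun_prop

lemma tendsto_lintegral_rescaledDensity (hα₀ : 0 < α) (hαπ : α < Real.pi) (hR₀ : 0 < R₀)
    (hRα : 0 < Rα) (hp : 0 < p) (hq : 0 < q) (hpq : p + q = 1) (k ℓ : ℕ) :
    Tendsto (fun s => ∫⁻ y, rescaledDensity α R₀ Rα p q k ℓ s y) atTop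
      (𝓝 (ENNReal.ofReal (((k + 1)! / q ^ k) ^ 2 * ((ℓ + 1)! / p ^ ℓ) ^ 2))) := by
  rw [← lintegral_limitDensity hp hq]
  refine tendsto_lintegral_filter_of_dominated_convergence (boundDensity p q k ℓ)
    (Eventually.of_forall fun s => measurable_rescaledDensity k ℓ s) ?_
    (lintegral_boundDensity_ne_top hp hq k ℓ) ?_
  · filter_upwards [eventually_gt_atTop 0] with s hs
    exact Eventually.of_forall (rescaledDensity_le hα₀ hαπ hR₀ hRα hp hq hpq k ℓ hs)
  · have h1 : ∀ᵐ z : Plane, ‖z‖ ≠ 1 / 2 := by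
      have := Measure.addHaar_sphere (volume : Measure Plane) 0 (1 / 2)
      rw [ae_iff]
      convert this using 2
      ext z
      simp
    have h2 : ∀ᵐ y : (Fin k → Plane) × Plane × (Fin ℓ → Plane), ‖y.2.1‖ ≠ 1 / 2 := by
      rw [Measure.volume_eq_prod]
      refine Measure.quasiMeasurePreserving_snd.ae (p := fun w : Plane × (Fin ℓ → Plane) =>
        ‖w.1‖ ≠ 1 / 2) ?_
      rw [Measure.volume_eq_prod]
      exact Measure.quasiMeasurePreserving_fst.ae h1
    filter_upwards [h2] with y hy
    exact tendsto_rescaledDensity hα₀ hαπ hR₀ hRα hpq k ℓ y hy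

lemma lintegral_rescaledDensity (k ℓ : ℕ) {s : ℝ} (hs : 0 < s) :
    ∫⁻ y, rescaledDensity α R₀ Rα p q k ℓ s y =
      ENNReal.ofReal (Real.exp s * s ^ (2 * (k + ℓ))) * ∫⁻ u : Fin k → Plane, ∫⁻ z : Plane,
        ∫⁻ v : Fin ℓ → Plane,
          clusterDensity α R₀ Rα p q (kind (k + 1) (ℓ + 1)) s (pinned u z v) := by
  set Φ := clusterDensity α R₀ Rα p q (kind (k + 1) (ℓ + 1)) s with hΦ
  rw [Measure.volume_eq_prod, lintegral_prod _ (measurable_rescaledDensity k ℓ s).aemeasurable]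
  have h1 : ∀ u : Fin k → Plane, ∫⁻ w, rescaledDensity α R₀ Rα p q k ℓ s (u, w) =
      ENNReal.ofReal (Real.exp s) * ENNReal.ofReal (s ^ (2 * ℓ)) *
        ∫⁻ z : Plane, ∫⁻ v : Fin ℓ → Plane, Φ (pinned (s⁻¹ • u) z v) := by
    intro u
    rw [Measure.volume_eq_prod, lintegral_prod (fun w => rescaledDensity α R₀ Rα p q k ℓ s (u, w))
      ((measurable_rescaledDensity k ℓ s).comp measurable_prodMk_left).aemeasurable,
      ← lintegral_const_mul' _ _ (ENNReal.mul_ne_top ENNReal.ofReal_ne_top ENNReal.ofReal_ne_top)]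
    refine lintegral_congr fun z => ?_
    rw [mul_assoc, ← lintegral_inv_smul_pi (fun v => Φ (pinned (s⁻¹ • u) z v)) hs,
      ← lintegral_const_mul' _ _ ENNReal.ofReal_ne_top]
    rfl
  simp_rw [h1]
  rw [lintegral_const_mul' _ _ (ENNReal.mul_ne_top ENNReal.ofReal_ne_top ENNReal.ofReal_ne_top),
    lintegral_inv_smul_pi (fun u => ∫⁻ z : Plane, ∫⁻ v : Fin ℓ → Plane, Φ (pinned u z v)) hs,
    ← mul_assoc, ← ENNReal.ofReal_mul (Real.exp_nonneg _), ← ENNReal.ofReal_mul (by positivity)]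
  congr 2
  ring

/-! ### Palm probabilities and their asymptotics -/

section Asymptotics

variable {α R₀ Rα p q t : ℝ}

lemma measurableSet_frame_preimage_unitSquare :
    MeasurableSet (frame α R₀ Rα ⁻¹' unitSquare) :=
  measurable_frame measurableSet_unitSquare

lemma volume_frame_preimage_unitSquare (hα₀ : 0 < α) (hαπ : α < Real.pi) (hR₀ : 0 < R₀)
    (hRα : 0 < Rα) : ENNReal.ofReal (volume.real (parallelogram 0 α R₀ Rα)) *
      volume (frame α R₀ Rα ⁻¹' unitSquare) = 1 := by
  have h := lintegral_frame hα₀ hαπ hR₀ hRα (measurable_one.indicator measurableSet_unitSquare :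
    Measurable (unitSquare.indicator (1 : Plane → ℝ≥0∞)))
  rw [lintegral_indicator_one measurableSet_unitSquare, volume_unitSquare] at h
  rw [h, ← lintegral_indicator_one measurableSet_frame_preimage_unitSquare]
  rfl

/-- By translation invariance each stick contributes as much as the first horizontal one; this is
the source of the factor `m`. -/
lemma lintegral_sum_pin (hα₀ : 0 < α) (hαπ : α < Real.pi) (hR₀ : 0 < R₀) (hRα : 0 < Rα)
    (k ℓ : ℕ) (s : ℝ) :
    ∫⁻ x, (∑ i, (frame α R₀ Rα ⁻¹' unitSquare).indicator 1 (x i)) *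
        clusterDensity α R₀ Rα p q (kind (k + 1) (ℓ + 1)) s x =
      (k + 1 + (ℓ + 1) : ℕ) * (volume (frame α R₀ Rα ⁻¹' unitSquare) *
        ∫⁻ u : Fin k → Plane, ∫⁻ z : Plane, ∫⁻ v : Fin ℓ → Plane,
          clusterDensity α R₀ Rα p q (kind (k + 1) (ℓ + 1)) s (pinned u z v)) := by
  set V := frame α R₀ Rα ⁻¹' unitSquare with hV
  have hVm : MeasurableSet V := measurableSet_frame_preimage_unitSquare
  have hV1 : ENNReal.ofReal (volume.real (parallelogram 0 α R₀ Rα)) * volume V = 1 :=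
    volume_frame_preimage_unitSquare hα₀ hαπ hR₀ hRα
  have hV0 : volume V ≠ 0 := fun h => by simp [h] at hV1
  have hVt : volume V ≠ ∞ := fun h => by
    rw [h, ENNReal.mul_top (ENNReal.ofReal_pos.2
      (volume_real_parallelogram_pos hα₀ hαπ hR₀ hRα)).ne'] at hV1
    exact ENNReal.top_ne_one hV1
  have hf := measurable_clusterDensity (α := α) (R₀ := R₀) (Rα := Rα) (p := p) (q := q)
    (kind (k + 1) (ℓ + 1)) s
  have hinv := fun x c => clusterDensity_add (α := α) (R₀ := R₀) (Rα := Rα) (p := p) (q := q)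
    (kind (k + 1) (ℓ + 1)) s x c
  have hm : ∀ i, Measurable fun x : Fin (k + 1 + (ℓ + 1)) → Plane =>
      V.indicator 1 (x i) * clusterDensity α R₀ Rα p q (kind (k + 1) (ℓ + 1)) s x := fun i =>
    ((measurable_one.indicator hVm).comp (measurable_pi_apply i)).mul hf
  simp_rw [Finset.sum_mul]
  rw [lintegral_finsetSum _ fun i _ => hm i,
    Finset.sum_congr rfl fun i _ => (lintegral_pin_comm hf hinv hVm hV0 hVt i
      (Fin.castAdd (ℓ + 1) 0)).trans (lintegral_pin hf hinv hVm),
    Finset.sum_const, Finset.card_univ, Fintype.card_fin, nsmul_eq_mul]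

lemma palmProb_eq (hp : 0 < p) (hq : 0 < q) (hpq : p + q = 1) {μ : Measure Config}
    (hμ : IsPoissonProcess μ (ENNReal.ofReal t • rho p q α R₀ Rα)) (E : Set Config) :
    palmProb μ E = (∫⁻ ξ : Config, ∑' w : {w : Germ // w ∈ ξ.1 ∧ w.1 ∈ unitSquare},
      E.indicator (fun _ => (1 : ℝ≥0∞)) (ξ.recentre w.1.1) ∂μ) / ENNReal.ofReal t := by
  rw [palmProb, lintegral_card_unitSquare hp hq hpq hμ]

lemma palmProb_clusterEvent (hp : 0 < p) (hq : 0 < q) (hpq : p + q = 1) {μ : Measure Config}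
    (hμ : IsPoissonProcess μ (ENNReal.ofReal t • rho p q α R₀ Rα)) (k ℓ : ℕ) :
    palmProb μ (clusterEvent α k ℓ) =
      (∫⁻ ξ, clusterCount α k ℓ unitSquare ξ ∂μ) / ENNReal.ofReal t :=
  palmProb_eq hp hq hpq hμ _

lemma palmProb_le_one (μ : Measure Config) (E : Set Config) : palmProb μ E ≤ 1 := by
  rw [palmProb]
  refine ENNReal.div_le_of_le_mul ?_
  rw [one_mul]
  exact lintegral_mono fun ξ => ENNReal.tsum_le_tsum fun w => indicator_le_self' (by simp) _

/-- The clusters are either of one of the types `(k, ℓ)` with `k + ℓ = m`, and of only one. -/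
lemma palmProb_clusterSizeEvent (hα : α ≠ 0) (hp : 0 < p) (hq : 0 < q) (hpq : p + q = 1)
    {μ : Measure Config} (hμ : IsPoissonProcess μ (ENNReal.ofReal t • rho p q α R₀ Rα)) (m : ℕ) :
    palmProb μ (clusterSizeEvent α m) =
      ∑ ij ∈ Finset.HasAntidiagonal.antidiagonal m, palmProb μ (clusterEvent α ij.1 ij.2) := by
  have hind : ∀ ξ : Config, (clusterSizeEvent α m).indicator (fun _ => (1 : ℝ≥0∞)) ξ =
      ∑ ij ∈ Finset.HasAntidiagonal.antidiagonal m,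
        (clusterEvent α ij.1 ij.2).indicator (fun _ => (1 : ℝ≥0∞)) ξ := by
    intro ξ
    by_cases h : ξ ∈ clusterSizeEvent α m
    · obtain ⟨k, ℓ, hkl, h'⟩ := id h
      rw [indicator_of_mem h, Finset.sum_eq_single (k, ℓ), indicator_of_mem h']
      · rintro ⟨i, j⟩ - hne
        refine indicator_of_notMem (fun h'' => hne ?_) _
        have h1 : (i : ℕ∞) = k := h''.2.1.symm.trans h'.2.1
        have h2 : (j : ℕ∞) = ℓ := h''.2.2.symm.trans h'.2.2
        rw [Nat.cast_inj] at h1 h2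
        rw [h1, h2]
      · exact fun hn => absurd (Finset.HasAntidiagonal.mem_antidiagonal.2 hkl) hn
    · rw [indicator_of_notMem h, Finset.sum_eq_zero]
      rintro ⟨i, j⟩ hij
      exact indicator_of_notMem (fun h' =>
        h ⟨i, j, Finset.HasAntidiagonal.mem_antidiagonal.1 hij, h'⟩) _
  simp_rw [palmProb_clusterEvent hp hq hpq hμ]
  rw [palmProb_eq hp hq hpq hμ]
  simp_rw [hind, div_eq_mul_inv]
  rw [← Finset.sum_mul, ← lintegral_finsetSum _
    fun ij _ => measurable_clusterCount hα ij.1 ij.2 measurableSet_unitSquare]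
  congr 1
  refine lintegral_congr fun ξ => ?_
  exact Summable.tsum_finsetSum fun _ _ => ENNReal.summable

lemma volume_transverse_eq (b : Bool) {n : ℕ} {i j : Fin n} (hij : i ≠ j) :
    volume {x : Fin n → Plane | transverse b (x i) = transverse b (x j)} = 0 := by
  let T : Plane →ₗ[ℝ] ℝ := if b then LinearMap.fst ℝ ℝ ℝ else LinearMap.snd ℝ ℝ ℝ
  have hT : ∀ y, T y = transverse b y := fun y => by cases b <;> rfl
  let W : Submodule ℝ (Fin n → Plane) :=
    LinearMap.ker (T ∘ₗ (@LinearMap.proj ℝ (Fin n) _ (fun _ => Plane) _ _ i -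
      @LinearMap.proj ℝ (Fin n) _ (fun _ => Plane) _ _ j))
  have hW : {x : Fin n → Plane | transverse b (x i) = transverse b (x j)} = W := by
    ext x
    simp [W, ← hT, sub_eq_zero]
  rw [hW]
  refine Measure.addHaar_submodule _ _ fun htop => ?_
  -- The vector `(1, 1)` at index `i` violates the equation for either coordinate, so the subspace
  -- is proper.
  have h1 : (Pi.single i (1, 1) : Fin n → Plane) ∈ W := htop ▸ Submodule.mem_top
  cases b <;> simp [W, T, hij.symm] at h1

/-- Almost surely, there are no clusters of several parallel sticks. -/
lemma clusterDensity_ae_eq_zero (hα₀ : 0 < α) (hαπ : α < Real.pi) (hR₀ : 0 < R₀) (hRα : 0 < Rα)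
    {n : ℕ} (hn : 2 ≤ n) {τ : Fin n → Bool} {b : Bool} (hτ : ∀ i, τ i = b) (s : ℝ) :
    ∀ᵐ x, clusterDensity α R₀ Rα p q τ s x = 0 := by
  let i₀ : Fin n := ⟨0, by omega⟩
  let i₁ : Fin n := ⟨1, by omega⟩
  have h : ∀ᵐ x : Fin n → Plane, ∀ j, i₀ ≠ j → transverse b (x i₀) ≠ transverse b (x j) := by
    rw [ae_all_iff]
    intro j
    by_cases hj : i₀ = j
    · exact Eventually.of_forall fun x h => absurd hj h
    · rw [ae_iff]
      refine measure_mono_null (fun x hx => ?_) (volume_transverse_eq b hj)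
      by_contra hcon
      exact hx fun _ h => hcon h
  filter_upwards [h] with x hx
  rw [clusterDensity, indicator_of_notMem, zero_mul]
  intro hl
  have key : ∀ l, Relation.ReflTransGen (fun i j => Meets (germ α R₀ Rα (τ i) (x i))
      (germ α R₀ Rα (τ j) (x j))) i₀ l → l = i₀ := by
    intro l hl
    induction hl with
    | refl => rfl
    | @tail c d _ hcd ih =>
      rw [ih] at hcd
      by_contra hd
      simp only [hτ] at hcd
      exact hx d (Ne.symm hd) (hcd.same_kind hα₀ hαπ hR₀ hRα).1
  have := key i₁ (hl i₀ i₁)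
  simp [i₀, i₁] at this

lemma palmProb_clusterEvent_eq_zero (hα₀ : 0 < α) (hαπ : α < Real.pi) (hR₀ : 0 < R₀)
    (hRα : 0 < Rα) (hp : 0 < p) (hq : 0 < q) (hpq : p + q = 1) (ht : 0 < t) {μ : Measure Config}
    (hμ : IsPoissonProcess μ (ENNReal.ofReal t • rho p q α R₀ Rα)) {k ℓ : ℕ} (h2 : 2 ≤ k + ℓ)
    (h0 : k = 0 ∨ ℓ = 0) : palmProb μ (clusterEvent α k ℓ) = 0 := by
  have hkind : ∃ b, ∀ i, kind k ℓ i = b := by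
    rcases h0 with rfl | rfl
    · exact ⟨true, fun i => Fin.addCases (fun j => j.elim0) (fun j => kind_natAdd 0 ℓ j) i⟩
    · exact ⟨false, fun i => Fin.addCases (fun j => kind_castAdd k 0 j) (fun j => j.elim0) i⟩
  obtain ⟨b, hb⟩ := hkind
  have h := lintegral_clusterCount hα₀ hαπ hR₀ hRα hp hq ht hμ k ℓ
  have hI : ∫⁻ x, (∑ i, (frame α R₀ Rα ⁻¹' unitSquare).indicator 1 (x i)) *
      clusterDensity α R₀ Rα p q (kind k ℓ) (t * volume.real (parallelogram 0 α R₀ Rα)) x = 0 := by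
    rw [← lintegral_zero]
    refine lintegral_congr_ae ?_
    filter_upwards [clusterDensity_ae_eq_zero hα₀ hαπ hR₀ hRα h2 hb _] with x hx
    rw [hx, mul_zero]
  rw [hI, mul_zero, mul_eq_zero] at h
  rw [palmProb_clusterEvent hp hq hpq hμ, h.resolve_left, ENNReal.zero_div]
  exact_mod_cast (Nat.mul_pos k.factorial_pos ℓ.factorial_pos).ne'

/-- The common factor of the asymptotics of the probabilities of the cluster types of size `m`. -/
def sizeFactor (p q : ℝ) (m : ℕ) (s : ℝ) : ℝ :=
  (1 / s) ^ ((m : ℤ) - 3) * Real.exp (-s) * (p * q) ^ (-2 * ((m : ℤ) - 1)) * m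

/-- The weight of the cluster type `(k, ℓ)` among those of the same size. -/
def typeWeight (p q : ℝ) (k ℓ : ℕ) : ℝ := p ^ (3 * k) * (k ! : ℝ) * q ^ (3 * ℓ) * (ℓ ! : ℝ)

lemma sizeFactor_pos (hp : 0 < p) (hq : 0 < q) {m : ℕ} (hm : 0 < m) {s : ℝ} (hs : 0 < s) :
    0 < sizeFactor p q m s := by
  unfold sizeFactor
  positivity

lemma typeWeight_pos (hp : 0 < p) (hq : 0 < q) (k ℓ : ℕ) : 0 < typeWeight p q k ℓ := by
  unfold typeWeight
  positivity

/-- An exact identity for every `t > 0`. With `s` the product of `t` and the parallelogram area and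
`m` the size, the Mecke formula gives `s^m`, undoing the rescaling gives `s^(-2(m-2)) e^(-s)`, and
the pinned region divided by `t` gives `s⁻¹`: in all `s^(3-m) e^(-s)`. The middle factor is
normalised by the limit of the rescaled integral. -/
lemma toReal_palmProb_clusterEvent (hα₀ : 0 < α) (hαπ : α < Real.pi) (hR₀ : 0 < R₀)
    (hRα : 0 < Rα) (hp : 0 < p) (hq : 0 < q) (hpq : p + q = 1) (ht : 0 < t) {μ : Measure Config}
    (hμ : IsPoissonProcess μ (ENNReal.ofReal t • rho p q α R₀ Rα)) (k ℓ : ℕ) :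
    (palmProb μ (clusterEvent α (k + 1) (ℓ + 1))).toReal =
      sizeFactor p q (k + 1 + (ℓ + 1)) (t * volume.real (parallelogram 0 α R₀ Rα)) *
      (typeWeight p q (k + 1) (ℓ + 1) / (((k + 1)! / q ^ k) ^ 2 * ((ℓ + 1)! / p ^ ℓ) ^ 2)) *
      (∫⁻ y, rescaledDensity α R₀ Rα p q k ℓ
        (t * volume.real (parallelogram 0 α R₀ Rα)) y).toReal := by
  have hβ := volume_real_parallelogram_pos hα₀ hαπ hR₀ hRα
  have hV := congrArg ENNReal.toReal (volume_frame_preimage_unitSquare hα₀ hαπ hR₀ hRα)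
  have h := congrArg ENNReal.toReal
    (lintegral_clusterCount hα₀ hαπ hR₀ hRα hp hq ht hμ (k + 1) (ℓ + 1))
  rw [lintegral_sum_pin hα₀ hαπ hR₀ hRα] at h
  set β := volume.real (parallelogram 0 α R₀ Rα)
  have hs : 0 < t * β := mul_pos ht hβ
  rw [palmProb_clusterEvent hp hq hpq hμ, lintegral_rescaledDensity k ℓ hs]
  simp only [ENNReal.toReal_mul, ENNReal.toReal_pow, ENNReal.toReal_natCast, ENNReal.toReal_div,
    ENNReal.toReal_one, ENNReal.toReal_ofReal hβ.le, ENNReal.toReal_ofReal ht.le,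
    ENNReal.toReal_ofReal (mul_pos hs hp).le, ENNReal.toReal_ofReal (mul_pos hs hq).le,
    ENNReal.toReal_ofReal (by positivity : 0 ≤ Real.exp (t * β) * (t * β) ^ (2 * (k + ℓ)))]
    at h hV ⊢
  generalize (∫⁻ u : Fin k → Plane, ∫⁻ z : Plane, ∫⁻ v : Fin ℓ → Plane,
    clusterDensity α R₀ Rα p q (kind (k + 1) (ℓ + 1)) (t * β) (pinned u z v)).toReal = K at h ⊢
  generalize (∫⁻ ξ, clusterCount α (k + 1) (ℓ + 1) unitSquare ξ ∂μ).toReal = N at h ⊢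
  generalize (volume (frame α R₀ Rα ⁻¹' unitSquare)).toReal = v at h hV
  obtain rfl : v = β⁻¹ := eq_inv_of_mul_eq_one_right hV
  have e1 : (1 / (t * β)) ^ (((k + 1 + (ℓ + 1) : ℕ) : ℤ) - 3) = (t * β) / (t * β) ^ (k + ℓ) := by
    have : (((k + 1 + (ℓ + 1) : ℕ) : ℤ) - 3) = ((k + ℓ : ℕ) : ℤ) - 1 := by push_cast; ring
    rw [this, zpow_sub_one₀ (by positivity), zpow_natCast, one_div, inv_inv, inv_pow]
    field_simp
  have e2 : (p * q) ^ (-2 * (((k + 1 + (ℓ + 1) : ℕ) : ℤ) - 1)) =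
      ((p * q) ^ (2 * (k + ℓ + 1)))⁻¹ := by
    have : -2 * (((k + 1 + (ℓ + 1) : ℕ) : ℤ) - 1) = -((2 * (k + ℓ + 1) : ℕ) : ℤ) := by
      push_cast
      ring
    rw [this, zpow_neg, zpow_natCast]
  have hN : N = (t * β * p) ^ (k + 1) * (t * β * q) ^ (ℓ + 1) *
      ((k + 1 + (ℓ + 1) : ℕ) * (β⁻¹ * K)) / ((k + 1)! * (ℓ + 1)! : ℕ) := by
    rw [← h]
    have : (((k + 1)! * (ℓ + 1)! : ℕ) : ℝ) ≠ 0 := by positivity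
    field_simp
  rw [sizeFactor, typeWeight, e1, e2, Real.exp_neg, hN]
  push_cast
  have := Real.exp_pos (t * β)
  field_simp
  ring

lemma tendsto_palmProb_clusterEvent (hα₀ : 0 < α) (hαπ : α < Real.pi) (hR₀ : 0 < R₀)
    (hRα : 0 < Rα) (hp : 0 < p) (hq : 0 < q) (hpq : p + q = 1) {μ : ℝ → Measure Config}
    (hμ : ∀ t : ℝ, 0 < t → IsPoissonProcess (μ t) (ENNReal.ofReal t • rho p q α R₀ Rα))
    {k ℓ : ℕ} (hk : 1 ≤ k) (hℓ : 1 ≤ ℓ) :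
    Tendsto (fun t => (palmProb (μ t) (clusterEvent α k ℓ)).toReal /
      sizeFactor p q (k + ℓ) (t * volume.real (parallelogram 0 α R₀ Rα))) atTop
      (𝓝 (typeWeight p q k ℓ)) := by
  obtain ⟨k, rfl⟩ := Nat.exists_eq_add_of_le' hk
  obtain ⟨ℓ, rfl⟩ := Nat.exists_eq_add_of_le' hℓ
  have hβ := volume_real_parallelogram_pos hα₀ hαπ hR₀ hRα
  have h := ((ENNReal.tendsto_toReal ENNReal.ofReal_ne_top).comp
    (tendsto_lintegral_rescaledDensity hα₀ hαπ hR₀ hRα hp hq hpq k ℓ)).comp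
    (tendsto_id.atTop_mul_const hβ)
  have hL : 0 < ((k + 1)! / q ^ k) ^ 2 * ((ℓ + 1)! / p ^ ℓ) ^ 2 := by positivity
  rw [ENNReal.toReal_ofReal hL.le] at h
  have h' := h.const_mul
    (typeWeight p q (k + 1) (ℓ + 1) / (((k + 1)! / q ^ k) ^ 2 * ((ℓ + 1)! / p ^ ℓ) ^ 2))
  rw [div_mul_cancel₀ _ hL.ne'] at h'
  refine h'.congr' ?_
  filter_upwards [eventually_gt_atTop 0] with t ht
  rw [toReal_palmProb_clusterEvent hα₀ hαπ hR₀ hRα hp hq hpq ht (hμ t ht), mul_assoc,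
    mul_div_cancel_left₀ _ (sizeFactor_pos hp hq (by omega) (mul_pos ht hβ)).ne']
  rfl

lemma tendsto_palmProb_clusterSizeEvent (hα₀ : 0 < α) (hαπ : α < Real.pi) (hR₀ : 0 < R₀)
    (hRα : 0 < Rα) (hp : 0 < p) (hq : 0 < q) (hpq : p + q = 1) {μ : ℝ → Measure Config}
    (hμ : ∀ t : ℝ, 0 < t → IsPoissonProcess (μ t) (ENNReal.ofReal t • rho p q α R₀ Rα))
    {m : ℕ} (hm : 2 ≤ m) :
    Tendsto (fun t => (palmProb (μ t) (clusterSizeEvent α m)).toReal /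
      sizeFactor p q m (t * volume.real (parallelogram 0 α R₀ Rα))) atTop
      (𝓝 (∑ ij ∈ (Finset.HasAntidiagonal.antidiagonal m).filter
        (fun ij => 1 ≤ ij.1 ∧ 1 ≤ ij.2), typeWeight p q ij.1 ij.2)) := by
  refine Tendsto.congr' ?_ (tendsto_finsetSum
    ((Finset.HasAntidiagonal.antidiagonal m).filter (fun ij => 1 ≤ ij.1 ∧ 1 ≤ ij.2))
    (f := fun ij t => (palmProb (μ t) (clusterEvent α ij.1 ij.2)).toReal /
      sizeFactor p q m (t * volume.real (parallelogram 0 α R₀ Rα))) ?_)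
  · filter_upwards [eventually_gt_atTop 0] with t ht
    rw [palmProb_clusterSizeEvent hα₀.ne' hp hq hpq (hμ t ht), ENNReal.toReal_sum fun ij _ =>
      ((palmProb_le_one _ _).trans_lt ENNReal.one_lt_top).ne, Finset.sum_div]
    -- The types of a single kind drop out exactly, not just asymptotically; this needs `m ≥ 2`, as
    -- one stick alone is a cluster.
    refine Finset.sum_subset (Finset.filter_subset _ _) fun ij hij hn => ?_
    rw [Finset.HasAntidiagonal.mem_antidiagonal] at hij
    have h0 : ij.1 = 0 ∨ ij.2 = 0 := by
      by_contra! hcon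
      exact hn (Finset.mem_filter.2
        ⟨Finset.HasAntidiagonal.mem_antidiagonal.2 hij, by omega, by omega⟩)
    rw [palmProb_clusterEvent_eq_zero hα₀ hαπ hR₀ hRα hp hq hpq ht (hμ t ht) (by omega) h0,
      ENNReal.toReal_zero, zero_div]
  · intro ij hij
    obtain ⟨h, h1, h2⟩ := Finset.mem_filter.1 hij
    rw [← Finset.HasAntidiagonal.mem_antidiagonal.1 h]
    exact tendsto_palmProb_clusterEvent hα₀ hαπ hR₀ hRα hp hq hpq hμ h1 h2

end Asymptotics

end

end Sticks

/-- `μ t` is the Poisson process with intensity measure `t ρ`; `a ∼ b` is stated as `a / b → 1`. -/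
theorem theorem2p1 (k ℓ m : ℕ) (hk : 1 ≤ k) (hℓ : 1 ≤ ℓ) (hm : m = k + ℓ)
    (α R₀ Rα p q : ℝ) (hα₀ : 0 < α) (hαπ : α < Real.pi) (hR₀ : 0 < R₀) (hRα : 0 < Rα)
    (hp : 0 < p) (hq : 0 < q) (hpq : p + q = 1)
    (μ : ℝ → Measure Sticks.Config)
    (hμ : ∀ t : ℝ, 0 < t →
      Sticks.IsPoissonProcess (μ t) (ENNReal.ofReal t • Sticks.rho p q α R₀ Rα)) :
    Tendsto
      (fun t : ℝ =>
        (Sticks.palmProb (μ t) (Sticks.clusterEvent α k ℓ)).toReal /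
          ((1 / (t * volume.real (Sticks.parallelogram 0 α R₀ Rα))) ^ ((m : ℤ) - 3) *
            Real.exp (-(t * volume.real (Sticks.parallelogram 0 α R₀ Rα))) *
            (p * q) ^ (-2 * ((m : ℤ) - 1)) * m *
            (p ^ (3 * k) * (k ! : ℝ)) * (q ^ (3 * ℓ) * (ℓ ! : ℝ))))
      atTop (𝓝 1) ∧
    Tendsto
      (fun t : ℝ =>
        ((Sticks.palmProb (μ t) (Sticks.clusterEvent α k ℓ)).toReal /
            (Sticks.palmProb (μ t) (Sticks.clusterSizeEvent α m)).toReal) /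
          (p ^ (3 * k) * (k ! : ℝ) * q ^ (3 * ℓ) * (ℓ ! : ℝ) /
            ∑ ij ∈ (Finset.HasAntidiagonal.antidiagonal m).filter (fun ij => 1 ≤ ij.1 ∧ 1 ≤ ij.2),
              p ^ (3 * ij.1) * (ij.1 ! : ℝ) * q ^ (3 * ij.2) * (ij.2 ! : ℝ)))
      atTop (𝓝 1) := by
  have hβ := Sticks.volume_real_parallelogram_pos hα₀ hαπ hR₀ hRα
  have hw := Sticks.typeWeight_pos hp hq k ℓ
  have h1 := Sticks.tendsto_palmProb_clusterEvent hα₀ hαπ hR₀ hRα hp hq hpq hμ hk hℓ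
  rw [← hm] at h1
  have h2 := Sticks.tendsto_palmProb_clusterSizeEvent hα₀ hαπ hR₀ hRα hp hq hpq hμ
    (by omega : 2 ≤ m)
  have hW : 0 < ∑ ij ∈ (Finset.HasAntidiagonal.antidiagonal m).filter
      (fun ij => 1 ≤ ij.1 ∧ 1 ≤ ij.2), Sticks.typeWeight p q ij.1 ij.2 :=
    Finset.sum_pos (fun ij _ => Sticks.typeWeight_pos hp hq ij.1 ij.2)
      ⟨(k, ℓ), Finset.mem_filter.2 ⟨Finset.HasAntidiagonal.mem_antidiagonal.2 hm.symm, hk, hℓ⟩⟩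
  constructor
  · have h := h1.div_const (Sticks.typeWeight p q k ℓ)
    rw [div_self hw.ne'] at h
    refine h.congr fun t => ?_
    rw [Sticks.sizeFactor, Sticks.typeWeight, div_div]
    congr 1
    ring
  · have h := (h1.div h2 hW.ne').div_const (Sticks.typeWeight p q k ℓ /
      ∑ ij ∈ (Finset.HasAntidiagonal.antidiagonal m).filter
        (fun ij => 1 ≤ ij.1 ∧ 1 ≤ ij.2), Sticks.typeWeight p q ij.1 ij.2)
    rw [div_self (div_pos hw hW).ne'] at h
    refine h.congr' ?_
    filter_upwards [eventually_gt_atTop 0] with t ht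
    simp only [Pi.div_apply]
    -- The size factor is common to numerator and denominator and positive for `t > 0`, so it
    -- cancels.
    rw [div_div_div_cancel_right₀
      (Sticks.sizeFactor_pos hp hq (by omega) (mul_pos ht hβ)).ne']
    rfl
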